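/- **Setting.** Let $d\ge 1$, let $\mathsf Z$ be a Polish space with its Borel $\sigma$-field, and let $\mathrm Q$ be a Markov kernel on $\mathsf Z$ with invariant probability measure $\pi$. Assume that there is an integer $t_{\rm mix}\ge 1$ such that for all $k\ge 1$ $$\sup_{z,z'}\tfrac12\|\mathrm Q^k(z,\cdot)-\mathrm Q^k(z',\cdot)\|_{TV}\le (1/4)^{\lfloor k/t_{\rm mix}\rfloor},$$ where $\|\mu\|_{TV}=|\mu|(\mathsf Z)$. Let $\zeta\ge 1$ and $\rho\in(0,1)$ be any constants such that $\sup_z\|\mathrm Q^k(z,\cdot)-\pi\|_{TV}\le\zeta\rho^k$ for all $k\ge1$. Let $A:\mathsf Z\to\mathbb R^{d\times d}$ and $b:\mathsf Z\to\mathbb R^d$ be measurable and $\pi$-integrable with $\int A\,d\pi=\bar A$ and $\int b\,d\pi=\bar b$. Assume that $-\bar A$ is Hurwitz and put $$\theta^\star=\bar A^{-1}\bar b,\qquad \tilde A(z)=A(z)-\bar A,\qquad \varepsilon(z)=\tilde A(z)\theta^\star-(b(z)-\bar b).$$ Assume that (with the Euclidean and spectral norms) $$C_A=\sup_z\|A(z)\|\vee\sup_z\|\tilde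 A(z)\|<\infty,\qquad \|\varepsilon\|_\infty=\sup_z\|\varepsilon(z)\|<\infty.$$ **Constants.** Let $Q$ be the unique symmetric positive definite solution of $\bar A^\top Q+Q\bar A=I$, and let $\|\cdot\|_Q$ be the operator norm associated with $x\mapsto (x^\top Qx)^{1/2}$. Put $$\kappa_Q=\frac{\lambda_{\max}(Q)}{\lambda_{\min}(Q)},\qquad a=\tfrac12\|Q\|^{-1},\qquad \alpha_\infty=\tfrac12\|\bar A\|_Q^{-2}\|Q\|^{-1}\wedge\|Q\|,\qquad m=\lceil 8\kappa_Q^{1/2}C_A/a\rceil,$$ $$\alpha^{(M)}_\infty=\Big[\alpha_\infty\wedge\kappa_Q^{-1/2}C_A^{-1}\wedge \frac{a}{6e\kappa_QC_A}\Big]m^{-1},\qquad C_\Gamma=4(\kappa_Q^{1/2}C_A+a/6)^2m,\qquad \alpha^{(M)}_{q,\infty}=\alpha^{(M)}_\infty\wedge\frac{a}{12C_\Gamma q},$$ $$\alpha^{(b)}_{p,\infty}=\Big(\alpha^{(M)}_{p(1+\log d),\infty}\wedge\frac1{1+C_A}\wedge\frac1{ap}\Big)t_{\rm mix}^{-1},\qquad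 D_1=2^{7/2}\kappa_Q^{1/2}a^{-1}\big(e^{-1/4}+\sqrt{2\pi e}\,C_Aa^{-1}\big).$$ For real numbers $D_{J,1},D_{J,2}\ge 0$ put $$c_{W,1}=\zeta^{1/(2p)}\big(4\kappa_Q^{1/2}(\kappa_Q^{1/2}+1)+2^8\kappa_Q^{1/2}D_1+2^4D_1\big),$$ $$c^{(1)}_{W,1}=\zeta^{1/(2p)}\big(148(\kappa_Q^{1/2}(1+\kappa_Q^{1/2})+D_{J,1}+D_{J,2})+8c_{W,1}\kappa_Q^{1/2}a^{-1}\big),$$ $$c^{(1)}_{W,2}=\zeta^{1/(2p)}\big(2D_1+4\kappa_Q^{1/2}+8(D_{J,1}+D_{J,2})\big),\qquad c^{(1)}_{W,3}=c^{(1)}_{W,1}+c^{(1)}_{W,2},$$ $$c^{(2)}_{W,1}=192\,C_A\kappa_Q^{1/2}t_{\rm mix}a^{-1/2}\|\varepsilon\|_\infty,\qquad c^{(2)}_{W,2}=432\,C_AD_1c^{(1)}_{W,3}t_{\rm mix}^{3/2}a^{-1/2}\|\varepsilon\|_\infty.$$ **The chain.** For $\alpha>0$ let $\mathrm Q_J$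 be the Markov kernel on $\mathbb R^d\times\mathsf Z$ of the chain $(J_t,Z_{t+1})_{t\ge0}$, where $J_{t+1}=(I-\alpha\bar A)J_t-\alpha\varepsilon(Z_{t+1})$ and $Z_{t+2}\sim\mathrm Q(Z_{t+1},\cdot)$. Let $\mathbb E_\xi$ be the expectation when $(J_0,Z_1)\sim\xi$, and put $\psi(J,z)=\tilde A(z)J$. **Proposition.** Let $2\le p<\infty$, $\alpha\in(0,\alpha^{(b)}_{p,\infty})$ and $D_{J,1},D_{J,2}\ge0$. Then $\mathrm Q_J$ has a unique invariant probability measure $\Pi_{J,\alpha}$, the function $\psi$ is $\Pi_{J,\alpha}$-integrable, and with $\bar\psi_t=\psi(J_t,Z_{t+1})-\int\psi\,d\Pi_{J,\alpha}$ the following holds. For every probability measure $\xi$ on $\mathbb R^d\times\mathsf Z$ with $$\mathbb E_\xi^{1/p}[\|J_0\|^p]\le D_1\sqrt{\alpha a p\,t_{\rm mix}}\,\|\varepsilon\|_\infty$$ (in particular, whenever $J_0=0$ and $Z_1$ has an arbitrary law), and every $n\ge 0$, $$\mathbb E_\xi^{1/p}\Big[\Big\|\sum_{t=0}^{n-1}\bar\psi_t\Big\|^p\Big]\le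 c^{(2)}_{W,1}\,p^{3/2}(\alpha n)^{1/2}+c^{(2)}_{W,2}\,p^3\alpha^{-1/2}\sqrt{\log\tfrac{1}{\alpha a}}.$$ -/

import Mathlib

open MeasureTheory ProbabilityTheory
open scoped ENNReal Matrix

noncomputable section

namespace MarkovLSA

/-! ### Markov chains and total variation -/

/-- Powers of a Markov kernel are Markov kernels. -/
instance isMarkovKernel_pow {X : Type*} [MeasurableSpace X] (κ : Kernel X X) [IsMarkovKernel κ]
    (k : ℕ) : IsMarkovKernel (κ ^ k) := by
  induction k with
  | zero =>
    have h : IsMarkovKernel (Kernel.id : Kernel X X) := inferInstance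
    rw [pow_zero]
    exact h
  | succ k ih =>
    have h : IsMarkovKernel ((κ ^ k) ∘ₖ κ) := inferInstance
    rw [pow_succ]
    exact h

/-- The total variation norm `|μ - ν|(X)` of the signed measure `μ - ν`. -/
def tvNorm {X : Type*} [MeasurableSpace X] (μ ν : Measure X) [IsFiniteMeasure μ]
    [IsFiniteMeasure ν] : ℝ≥0∞ :=
  (μ.toSignedMeasure - ν.toSignedMeasure).totalVariation Set.univ

/-- The Dobrushin coefficient `sup_{z, z'} (1/2) ‖κ(z, ·) - κ(z', ·)‖_TV`. -/
def dobrushin {X : Type*} [MeasurableSpace X] (κ : Kernel X X) [IsMarkovKernel κ] : ℝ≥0∞ :=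
  ⨆ (z : X) (z' : X), (1 / 2 : ℝ≥0∞) * tvNorm (κ z) (κ z')

/-- `π` is invariant for `Q`, and `Q` is uniformly geometrically ergodic with mixing time
`tmix`. -/
structure UniformlyErgodic {Z : Type*} [MeasurableSpace Z] (Q : Kernel Z Z) [IsMarkovKernel Q]
    (π : Measure Z) (tmix : ℕ) : Prop where
  invariant : Kernel.Invariant Q π
  tmix_pos : 1 ≤ tmix
  mixing : ∀ k : ℕ, 1 ≤ k → dobrushin (Q ^ k) ≤ (1 / 4 : ℝ≥0∞) ^ (k / tmix)

/-- The law on path space of the Markov chain with initial law `ξ` and transition kernel `κ`. -/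
def chainLaw {X : Type*} [MeasurableSpace X] (κ : Kernel X X) [IsMarkovKernel κ]
    (ξ : Measure X) : Measure (ℕ → X) :=
  Kernel.trajMeasure (X := fun _ : ℕ => X) ξ
    (fun n => κ.comap (fun h : (i : Finset.Iic n) → X => h ⟨n, Finset.mem_Iic.2 le_rfl⟩)
      (measurable_pi_apply _))

/-! ### Matrices -/

/-- The spectral norm of a matrix. -/
def opNorm {d : ℕ} (M : Matrix (Fin d) (Fin d) ℝ) : ℝ :=
  ‖Matrix.toEuclideanCLM (n := Fin d) (𝕜 := ℝ) M‖

/-- The action of a matrix on Euclidean space. -/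
def act {d : ℕ} (M : Matrix (Fin d) (Fin d) ℝ) (x : EuclideanSpace ℝ (Fin d)) :
    EuclideanSpace ℝ (Fin d) :=
  Matrix.toEuclideanCLM (n := Fin d) (𝕜 := ℝ) M x

/-- A real matrix is Hurwitz if all its complex eigenvalues have negative real part. -/
def IsHurwitz {d : ℕ} (M : Matrix (Fin d) (Fin d) ℝ) : Prop :=
  ∀ c ∈ spectrum ℂ (M.map (algebraMap ℝ ℂ)), c.re < 0

/-- `P` is a symmetric positive definite solution of the Lyapunov equation
`Mᵀ P + P M = I`. -/
def IsLyapunovSolution {d : ℕ} (M P : Matrix (Fin d) (Fin d) ℝ) : Prop :=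
  P.PosDef ∧ Mᵀ * P + P * M = 1

open Classical in
/-- The symmetric positive definite solution of `Mᵀ P + P M = I`; it exists and is unique when
`-M` is Hurwitz. -/
def lyapunov {d : ℕ} (M : Matrix (Fin d) (Fin d) ℝ) : Matrix (Fin d) (Fin d) ℝ :=
  if h : ∃ P, IsLyapunovSolution M P then h.choose else 0

/-- The norm `‖x‖_P = (xᵀ P x)^{1/2}`. -/
def vecNorm {d : ℕ} (P : Matrix (Fin d) (Fin d) ℝ) (x : EuclideanSpace ℝ (Fin d)) : ℝ :=
  Real.sqrt (inner ℝ x (act P x))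

/-- The operator norm `‖M‖_P = max_{‖x‖_P = 1} ‖M x‖_P`. -/
def opNormWrt {d : ℕ} (P M : Matrix (Fin d) (Fin d) ℝ) : ℝ :=
  sSup {r : ℝ | ∃ x : EuclideanSpace ℝ (Fin d), vecNorm P x = 1 ∧ r = vecNorm P (act M x)}

/-! ### Linear stochastic approximation -/

/-- The data of a linear stochastic approximation problem: measurable `A`, `b` on the noise space
and the matrix and vector of the limiting linear system `Ā θ = b̄`. -/
structure LSA (d : ℕ) (Z : Type*) [MeasurableSpace Z] where
  A : Z → Matrix (Fin d) (Fin d) ℝ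
  b : Z → EuclideanSpace ℝ (Fin d)
  Abar : Matrix (Fin d) (Fin d) ℝ
  bbar : EuclideanSpace ℝ (Fin d)
  measurable_A : ∀ i j, Measurable (fun z => A z i j)
  measurable_b : Measurable b

namespace LSA

variable {d : ℕ} {Z : Type*} [MeasurableSpace Z] (S : LSA d Z)

/-- `Ã(z) = A(z) - Ā`. -/
def Atilde (z : Z) : Matrix (Fin d) (Fin d) ℝ := S.A z - S.Abar

/-- The solution `θ⋆` of `Ā θ = b̄`. -/
def thetaStar : EuclideanSpace ℝ (Fin d) := act (S.Abar)⁻¹ S.bbar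

/-- The noise `ε(z) = Ã(z) θ⋆ - (b(z) - b̄)`. -/
def eps (z : Z) : EuclideanSpace ℝ (Fin d) := act (S.Atilde z) S.thetaStar - (S.b z - S.bbar)

/-- `C_A = sup_z ‖A(z)‖ ∨ sup_z ‖Ã(z)‖`. -/
def CA : ℝ := max (⨆ z, opNorm (S.A z)) (⨆ z, opNorm (S.Atilde z))

/-- `‖ε‖_∞ = sup_z ‖ε(z)‖`. -/
def epsSup : ℝ := ⨆ z, ‖S.eps z‖

/-- `C_A` is finite and `-Ā` is Hurwitz. -/
structure StabilityAssumption : Prop where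
  bdd_A : BddAbove (Set.range fun z => opNorm (S.A z))
  bdd_Atilde : BddAbove (Set.range fun z => opNorm (S.Atilde z))
  hurwitz : IsHurwitz (-S.Abar)

/-- `∫ A dπ = Ā`, `∫ b dπ = b̄` and `‖ε‖_∞` is finite. -/
structure NoiseAssumption (π : Measure Z) : Prop where
  integrable_A : ∀ i j, Integrable (fun z => S.A z i j) π
  integral_A : ∀ i j, ∫ z, S.A z i j ∂π = S.Abar i j
  integrable_b : Integrable S.b π
  integral_b : ∫ z, S.b z ∂π = S.bbar
  bdd_eps : BddAbove (Set.range fun z => ‖S.eps z‖)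

/-! #### Problem constants -/

/-- The Lyapunov matrix of `Ā`. -/
def lyap : Matrix (Fin d) (Fin d) ℝ := lyapunov S.Abar

/-- `κ_Q = λ_max(Q) / λ_min(Q)` for the Lyapunov matrix `Q`. -/
def kappa : ℝ := sSup (spectrum ℝ S.lyap) / sInf (spectrum ℝ S.lyap)

/-- `a = ‖Q‖⁻¹ / 2`. -/
def a : ℝ := (opNorm S.lyap)⁻¹ / 2

/-- `α_∞ = (1/2) ‖Ā‖_Q⁻² ‖Q‖⁻¹ ∧ ‖Q‖`. -/
def alphaInf : ℝ :=
  min ((1 / 2) * ((opNormWrt S.lyap S.Abar) ^ 2)⁻¹ * (opNorm S.lyap)⁻¹) (opNorm S.lyap)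

/-- The integer `⌈8 κ_Q^{1/2} C_A / a⌉`. -/
def blockLen : ℕ := ⌈8 * Real.sqrt S.kappa * S.CA / S.a⌉₊

/-- `α_∞^{(M)}`. -/
def alphaInfM : ℝ :=
  min S.alphaInf (min ((Real.sqrt S.kappa)⁻¹ * S.CA⁻¹)
    (S.a / (6 * Real.exp 1 * S.kappa * S.CA))) * (S.blockLen : ℝ)⁻¹

/-- `C_Γ`. -/
def CGamma : ℝ := 4 * (Real.sqrt S.kappa * S.CA + S.a / 6) ^ 2 * (S.blockLen : ℝ)

/-- `α_{q,∞}^{(M)} = α_∞^{(M)} ∧ (a / (12 C_Γ)) / q`. -/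
def alphaM (q : ℝ) : ℝ := min S.alphaInfM (S.a / (12 * S.CGamma) / q)

/-- `α_{p,∞}^{(b)} = (α_{p(1 + log d),∞}^{(M)} ∧ 1/(1 + C_A) ∧ 1/(a p)) / tmix`. -/
def alphaB (tmix : ℕ) (p : ℝ) : ℝ :=
  min (S.alphaM (p * (1 + Real.log d))) (min (1 / (1 + S.CA)) (1 / (S.a * p))) * (tmix : ℝ)⁻¹

/-- `D₁`. -/
def D1 : ℝ :=
  2 ^ (7 / 2 : ℝ) * Real.sqrt S.kappa * S.a⁻¹ *
    (Real.exp (-1 / 4) + Real.sqrt (2 * Real.pi * Real.exp 1) * S.CA * S.a⁻¹)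

/-- `c_{W,1}`. -/
def cW1 (ζ p : ℝ) : ℝ :=
  ζ ^ (1 / (2 * p)) * (4 * Real.sqrt S.kappa * (Real.sqrt S.kappa + 1)
    + 2 ^ 8 * Real.sqrt S.kappa * S.D1 + 2 ^ 4 * S.D1)

/-- `c_{W,1}^{(1)}`. -/
def cW11 (ζ p DJ1 DJ2 : ℝ) : ℝ :=
  ζ ^ (1 / (2 * p)) * (148 * (Real.sqrt S.kappa * (1 + Real.sqrt S.kappa) + (DJ1 + DJ2))
    + 8 * S.cW1 ζ p * Real.sqrt S.kappa * S.a⁻¹)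

/-- `c_{W,2}^{(1)}`. -/
def cW12 (ζ p DJ1 DJ2 : ℝ) : ℝ :=
  ζ ^ (1 / (2 * p)) * (2 * S.D1 + 4 * Real.sqrt S.kappa + 8 * (DJ1 + DJ2))

/-- `c_{W,3}^{(1)}`. -/
def cW13 (ζ p DJ1 DJ2 : ℝ) : ℝ := S.cW11 ζ p DJ1 DJ2 + S.cW12 ζ p DJ1 DJ2

/-- `c_{W,1}^{(2)}`, the constant of the leading term. -/
def cW21 (tmix : ℕ) : ℝ :=
  192 * S.CA * Real.sqrt S.kappa * tmix * S.a ^ (-1 / 2 : ℝ) * S.epsSup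

/-- `c_{W,2}^{(2)}`, the constant of the remainder term. -/
def cW22 (tmix : ℕ) (ζ p DJ1 DJ2 : ℝ) : ℝ :=
  432 * S.CA * S.D1 * S.cW13 ζ p DJ1 DJ2 * (tmix : ℝ) ^ (3 / 2 : ℝ) * S.a ^ (-1 / 2 : ℝ) * S.epsSup

/-! #### The chain `(J_t, Z_{t+1})` -/

/-- One step of the recursion: `J_{t+1} = (I - α Ā) J_t - α ε(Z_{t+1})`, as a function of
`(J_t, Z_{t+1})`. -/
def stepJ (α : ℝ) (y : EuclideanSpace ℝ (Fin d) × Z) : EuclideanSpace ℝ (Fin d) :=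
  act (1 - α • S.Abar) y.1 - α • S.eps y.2

lemma measurable_eps : Measurable S.eps := by
  have h : Measurable fun z => act (S.Atilde z) S.thetaStar := by
    have h2 : Measurable fun z => (S.Atilde z) *ᵥ (S.thetaStar).ofLp := by
      refine measurable_pi_iff.2 fun i => ?_
      simp only [Matrix.mulVec, dotProduct, Atilde, Matrix.sub_apply]
      exact Finset.measurable_sum _ fun j _ => ((S.measurable_A i j).sub_const _).mul_const _
    exact (WithLp.measurable_toLp 2 _).comp h2
  exact h.sub (S.measurable_b.sub_const _)

lemma measurable_stepJ (α : ℝ) : Measurable (S.stepJ α) := by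
  have h : Measurable fun x : EuclideanSpace ℝ (Fin d) => act (1 - α • S.Abar) x :=
    (Matrix.toEuclideanCLM (n := Fin d) (𝕜 := ℝ) (1 - α • S.Abar)).continuous.measurable
  exact (h.comp measurable_fst).sub ((S.measurable_eps.comp measurable_snd).const_smul α)

/-- The transition kernel `Q_J` of the chain `(J_t, Z_{t+1})`: from `(J, z)` the first coordinate
moves to `(I - α Ā) J - α ε(z)`, and the second one is drawn from `Q(z, ·)`. -/
def kernelJ (Q : Kernel Z Z) [IsMarkovKernel Q] (α : ℝ) :
    Kernel (EuclideanSpace ℝ (Fin d) × Z) (EuclideanSpace ℝ (Fin d) × Z) :=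
  (Kernel.deterministic (S.stepJ α) (S.measurable_stepJ α)) ×ₖ (Q.comap Prod.snd measurable_snd)

instance (Q : Kernel Z Z) [IsMarkovKernel Q] (α : ℝ) : IsMarkovKernel (S.kernelJ Q α) := by
  unfold kernelJ
  infer_instance

/-- `ψ(J, z) = Ã(z) J`. -/
def psi (y : EuclideanSpace ℝ (Fin d) × Z) : EuclideanSpace ℝ (Fin d) := act (S.Atilde y.2) y.1

/-- `ψ̄ = ψ - E_ν[ψ]`. -/
def psiBar (ν : Measure (EuclideanSpace ℝ (Fin d) × Z)) (y : EuclideanSpace ℝ (Fin d) × Z) :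
    EuclideanSpace ℝ (Fin d) :=
  S.psi y - ∫ y', S.psi y' ∂ν

end LSA

end MarkovLSA

end

/-! Write `G = I - αĀ`, with `F_t` the past of the chain and `m = t_mix`. The sum of the `ψ̄_t` has
size `√(αn)` because `ψ(J_t, Z_{t+1}) = Ã(Z_{t+1}) J_t` decorrelates on the time scale `m` of the
noise, although `J_t` itself relaxes only on the much longer scale `1/(αa)`. Since `ψ` is linear in
`J`, its mean after `s` steps from `(J, z)` is affine in `J`: it equals `M_s(z) G^s J + R_s(z)`,
where `M_s(z)` is the `Q^s`-mean of `Ã` (`integral_psi_kernelJ_pow`). As `∫ Ã dπ = 0`, `M_s` decays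
like `(1/4)^(s/m)`, and the oscillation of `R_s` decays at the same rate up to a factor `s`
(`norm_psiRemainder_sub_le`). So the conditional means of `ψ̄_{t+km}` given `F_t` are summable in
`k`, with a sum of order `‖J_t‖` plus the stationary size of `J`.

Two applications of one probabilistic tool finish the proof. It is a Burkholder-type inequality in
`L^p` for adapted sequences with summable conditional means (`lpNorm_sum_sq_le_of_condExp_step`). It
follows from 2-uniform smoothness of the `p`-norm (`norm_add_rpow_add_norm_sub_rpow_le`), applied to
the martingale obtained by projecting the whole sum on the past. Applied to `J_t = G^t J_0 - α Σ
G^(t-1-s) ε(Z_{s+1})`, it shows that `J` has size `√(pmκα/a)` (`memLp_fst_and_lpNorm_fst_le`);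
applied to `ψ̄_t` it gives `lpNorm_sum_psiBar_sq_le`. The stationary part of `J` yields the term in
`(αn)^(1/2)`, while the geometrically forgotten initial value yields a remainder bounded in `n`. The
bounds so obtained are of order `p` in both terms, and comparing constants concludes
(`le_of_sum_sq_bound`).

The contraction `‖G^k‖ ≤ √κ (1 - αa)^(k/2)` comes from the Lyapunov equation (`stepBounds`). The
invariant law is the law of the stationary solution `-α Σ G^k ε(Z_{-k})`, driven by the time
reversal of the stationary noise (`exists_invariant_kernelJ`). Uniqueness is a synchronous coupling:
two chains sharing their noise have difference `G^t (J - J')` (`eq_of_invariant_kernelJ`). -/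

namespace MarkovLSA

/-! ### Differences of integrals and total variation. -/

section TotalVariation

variable {X : Type*} [MeasurableSpace X] {F : Type*} [NormedAddCommGroup F] [NormedSpace ℝ F]

/-- Integrals of a bounded function against two finite measures differ by at most the total
variation of their difference. -/
lemma norm_integral_sub_le_tvNorm (μ ν : Measure X) [IsFiniteMeasure μ] [IsFiniteMeasure ν]
    {f : X → F} (hf : StronglyMeasurable f) {C : ℝ} (hC : ∀ x, ‖f x‖ ≤ C) :
    ‖∫ x, f x ∂μ - ∫ x, f x ∂ν‖ ≤ C * (tvNorm μ ν).toReal := by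
  set s : SignedMeasure X := μ.toSignedMeasure - ν.toSignedMeasure with hs
  set j := s.toJordanDecomposition with hj
  have hint : ∀ (ρ : Measure X) [IsFiniteMeasure ρ], Integrable f ρ := fun ρ _ =>
    Integrable.of_bound hf.aestronglyMeasurable C (ae_of_all _ hC)
  -- Moving the negative parts across turns the Jordan decomposition into an identity between
  -- positive measures, so vector-valued integrals apply directly.
  have hsum : μ + j.negPart = ν + j.posPart := by
    have h1 : j.posPart.toSignedMeasure - j.negPart.toSignedMeasure
        = μ.toSignedMeasure - ν.toSignedMeasure := by
      rw [← hs, ← s.toSignedMeasure_toJordanDecomposition]; rfl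
    have h2 : (μ + j.negPart).toSignedMeasure = (ν + j.posPart).toSignedMeasure := by
      rw [Measure.toSignedMeasure_add, Measure.toSignedMeasure_add]
      rw [sub_eq_sub_iff_add_eq_add] at h1
      rw [← h1]; abel
    exact (Measure.toSignedMeasure_eq_toSignedMeasure_iff).1 h2
  have h3 : ∫ x, f x ∂μ + ∫ x, f x ∂j.negPart = ∫ x, f x ∂ν + ∫ x, f x ∂j.posPart := by
    rw [← integral_add_measure (hint _) (hint _), ← integral_add_measure (hint _) (hint _), hsum]
  have h4 : ∫ x, f x ∂μ - ∫ x, f x ∂ν = ∫ x, f x ∂j.posPart - ∫ x, f x ∂j.negPart := by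
    rw [sub_eq_sub_iff_add_eq_add, h3, add_comm]
  have hb : ∀ (ρ : Measure X) [IsFiniteMeasure ρ], ‖∫ x, f x ∂ρ‖ ≤ C * (ρ Set.univ).toReal :=
    fun ρ _ => norm_integral_le_of_norm_le_const (ae_of_all _ hC)
  have h5 : (tvNorm μ ν).toReal = (j.posPart Set.univ).toReal + (j.negPart Set.univ).toReal := by
    rw [tvNorm, SignedMeasure.totalVariation, Measure.add_apply,
      ENNReal.toReal_add (measure_ne_top _ _) (measure_ne_top _ _)]
  rw [h4, h5, mul_add]
  exact (norm_sub_le _ _).trans (add_le_add (hb _) (hb _))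

end TotalVariation

/-! ### Mixing and uniqueness of the invariant law of the noise. -/

section Mixing

variable {Z : Type*} [MeasurableSpace Z] {Q : Kernel Z Z} [IsMarkovKernel Q] {π : Measure Z}
  {m : ℕ} {F : Type*} [NormedAddCommGroup F] [NormedSpace ℝ F]

lemma UniformlyErgodic.norm_integral_pow_sub_le (hQ : UniformlyErgodic Q π m)
    {f : Z → F} (hf : StronglyMeasurable f) {C : ℝ} (hC : ∀ x, ‖f x‖ ≤ C) (k : ℕ) (z z' : Z) :
    ‖∫ x, f x ∂(Q ^ k) z - ∫ x, f x ∂(Q ^ k) z'‖ ≤ 2 * C * (1 / 4) ^ (k / m) := by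
  have hC0 : 0 ≤ C := (norm_nonneg _).trans (hC z)
  rcases Nat.eq_zero_or_pos k with rfl | hk
  · have hb : ∀ (ρ : Measure Z) [IsProbabilityMeasure ρ], ‖∫ x, f x ∂ρ‖ ≤ C := fun ρ _ => by
      simpa using norm_integral_le_of_norm_le_const (μ := ρ) (ae_of_all _ hC)
    rw [Nat.zero_div, pow_zero (1 / 4 : ℝ), mul_one, two_mul]
    exact (norm_sub_le _ _).trans (add_le_add (hb ((Q ^ 0) z)) (hb ((Q ^ 0) z')))
  refine (norm_integral_sub_le_tvNorm _ _ hf hC).trans ?_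
  have h1 : (1 / 2 : ℝ≥0∞) * tvNorm ((Q ^ k) z) ((Q ^ k) z') ≤ (1 / 4 : ℝ≥0∞) ^ (k / m) :=
    (le_iSup₂ (f := fun z z' => (1 / 2 : ℝ≥0∞) * tvNorm ((Q ^ k) z) ((Q ^ k) z')) z z').trans
      (hQ.mixing k hk)
  have h2 := ENNReal.toReal_mono (by simp) h1
  rw [ENNReal.toReal_mul, ENNReal.toReal_pow] at h2
  norm_num at h2
  have h3 : (tvNorm ((Q ^ k) z) ((Q ^ k) z')).toReal ≤ 2 * (1 / 4) ^ (k / m) := by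
    norm_num; linarith
  calc _ ≤ C * (2 * (1 / 4) ^ (k / m)) := mul_le_mul_of_nonneg_left h3 hC0
    _ = _ := by ring

end Mixing

section Kernels

variable {X : Type*} [MeasurableSpace X] {κ : Kernel X X} {μ : Measure X}
  {F : Type*} [NormedAddCommGroup F] [NormedSpace ℝ F]

lemma invariant_pow (h : Kernel.Invariant κ μ) (k : ℕ) : Kernel.Invariant (κ ^ k) μ := by
  induction k with
  | zero => rw [pow_zero]; exact Measure.id_comp
  | succ k ih => rw [pow_succ]; exact ih.comp h

lemma integral_pow_succ {f : X → F} (k : ℕ) (x : X) (hf : Integrable f ((κ ^ (k + 1)) x)) :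
    ∫ y, f y ∂(κ ^ (k + 1)) x = ∫ y, ∫ w, f w ∂(κ ^ k) y ∂κ x := by
  have h : κ ^ (k + 1) = (κ ^ k) ∘ₖ κ := pow_succ κ k
  rw [h] at hf ⊢
  exact Kernel.integral_comp hf

lemma integral_invariant (h : Kernel.Invariant κ μ) {f : X → F} (hf : Integrable f μ) :
    ∫ x, ∫ y, f y ∂κ x ∂μ = ∫ x, f x ∂μ := by
  -- A measure is read as a constant kernel from a point, so that statements on compositions of
  -- kernels apply.
  have hc : κ ∘ₖ Kernel.const Unit μ = Kernel.const Unit μ := by rw [Kernel.comp_const, h.def]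
  have h' := Kernel.integral_comp (η := κ) (κ := Kernel.const Unit μ) (a := ()) (f := f)
    (by rwa [hc, Kernel.const_apply])
  rw [hc, Kernel.const_apply] at h'
  exact h'.symm

lemma integrable_integral_of_invariant (h : Kernel.Invariant κ μ) {f : X → F}
    (hf : Integrable f μ) : Integrable (fun x => ∫ y, f y ∂κ x) μ := by
  have hc : κ ∘ₖ Kernel.const Unit μ = Kernel.const Unit μ := by rw [Kernel.comp_const, h.def]
  have h' : Integrable f ((κ ∘ₖ Kernel.const Unit μ) ()) := by rwa [hc, Kernel.const_apply]
  exact h'.integral_comp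

lemma stronglyMeasurable_integral_pow {f : X → F} (hf : StronglyMeasurable f) (k : ℕ) :
    StronglyMeasurable fun z => ∫ x, f x ∂(κ ^ k) z :=
  StronglyMeasurable.integral_kernel hf

end Kernels

section Mixing

variable {Z : Type*} [MeasurableSpace Z] {Q : Kernel Z Z} [IsMarkovKernel Q] {π : Measure Z}
  {m : ℕ} {F : Type*} [NormedAddCommGroup F] [NormedSpace ℝ F]

/-- Convergence of the iterates to a (possibly different) invariant probability measure. -/
lemma UniformlyErgodic.norm_integral_pow_sub_integral_le (hQ : UniformlyErgodic Q π m)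
    {π' : Measure Z} [IsProbabilityMeasure π'] (hπ' : Kernel.Invariant Q π') [CompleteSpace F]
    {f : Z → F} (hf : StronglyMeasurable f) {C : ℝ} (hC : ∀ x, ‖f x‖ ≤ C) (k : ℕ) (z : Z) :
    ‖∫ x, f x ∂(Q ^ k) z - ∫ x, f x ∂π'‖ ≤ 2 * C * (1 / 4) ^ (k / m) := by
  have hint : Integrable f π' := Integrable.of_bound hf.aestronglyMeasurable C (ae_of_all _ hC)
  have hb : ∀ z, ‖∫ x, f x ∂(Q ^ k) z‖ ≤ C := fun z => by
    simpa using norm_integral_le_of_norm_le_const (μ := (Q ^ k) z) (ae_of_all _ hC)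
  have hint' : Integrable (fun z => ∫ x, f x ∂(Q ^ k) z) π' :=
    Integrable.of_bound (stronglyMeasurable_integral_pow hf k).aestronglyMeasurable C
      (ae_of_all _ hb)
  -- Invariance makes the difference an average over `z'` of two-point differences.
  rw [← integral_invariant (invariant_pow hπ' k) hint]
  have h1 : ∫ x, f x ∂(Q ^ k) z - ∫ z', ∫ x, f x ∂(Q ^ k) z' ∂π'
      = ∫ z', (∫ x, f x ∂(Q ^ k) z - ∫ x, f x ∂(Q ^ k) z') ∂π' := by
    rw [integral_sub (integrable_const _) hint']; simp
  rw [h1]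
  simpa using norm_integral_le_of_norm_le_const (μ := π')
    (ae_of_all _ fun z' => hQ.norm_integral_pow_sub_le hf hC k z z')

lemma UniformlyErgodic.eq_of_invariant (hQ : UniformlyErgodic Q π m) [IsProbabilityMeasure π]
    {π' : Measure Z} [IsProbabilityMeasure π'] (hπ' : Kernel.Invariant Q π') : π' = π := by
  ext s hs
  have hne : Nonempty Z := by
    by_contra h
    have := not_nonempty_iff.1 h
    exact IsProbabilityMeasure.ne_zero π (Measure.eq_zero_of_isEmpty π)
  obtain ⟨z⟩ := hne
  set f : Z → ℝ := s.indicator 1 with hfdef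
  have hf : StronglyMeasurable f := stronglyMeasurable_one.indicator hs
  have hC : ∀ x, ‖f x‖ ≤ 1 := fun x => by
    simp only [hfdef, Set.indicator]; split_ifs <;> simp
  have hlim : Filter.Tendsto (fun k : ℕ => 4 * (1 / 4 : ℝ) ^ k) Filter.atTop (nhds 0) := by
    simpa using (tendsto_pow_atTop_nhds_zero_of_lt_one (r := (1 / 4 : ℝ)) (by norm_num)
      (by norm_num)).const_mul 4
  -- At time `k * m` the iterate started at one fixed point is within `2 (1/4)^k` of both integrals.
  have hle : ∀ k : ℕ, |∫ x, f x ∂π' - ∫ x, f x ∂π| ≤ 4 * (1 / 4 : ℝ) ^ k := fun k => by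
    have h1 := hQ.norm_integral_pow_sub_integral_le hπ' hf hC (k * m) z
    have h2 := hQ.norm_integral_pow_sub_integral_le hQ.invariant hf hC (k * m) z
    rw [Nat.mul_div_cancel _ hQ.tmix_pos] at h1 h2
    rw [Real.norm_eq_abs] at h1 h2
    rw [abs_le] at *
    constructor <;> linarith [h1.1, h1.2, h2.1, h2.2]
  have h0 : |∫ x, f x ∂π' - ∫ x, f x ∂π| ≤ 0 := ge_of_tendsto' hlim hle
  have h3 : ∫ x, f x ∂π' = ∫ x, f x ∂π := by
    have := abs_nonpos_iff.1 h0; linarith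
  rw [hfdef, integral_indicator_one hs, integral_indicator_one hs] at h3
  exact (measureReal_eq_measureReal_iff).1 h3

end Mixing

/-! ### A two-point inequality for powers of a Hilbert norm. -/

section TwoPoint

variable {E : Type*} [NormedAddCommGroup E]

/-- By convexity the exponential lies below its chord on `[0, 6/5]`, and `exp (6/5) ≤ 17/5 = 1 + 3 *
(4/5)`. -/
lemma exp_le_one_add_three_mul {v : ℝ} (h0 : 0 ≤ v) (h1 : v ≤ 4 / 5) :
    Real.exp (3 / 2 * v) ≤ 1 + 3 * v := by
  have he : Real.exp (6 / 5) ≤ 17 / 5 := by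
    have h2 : Real.exp (1 / 5) ≤ 5 / 4 := by
      have h3 := Real.add_one_le_exp (-(1 / 5) : ℝ)
      rw [Real.exp_neg] at h3
      have h4 := Real.exp_pos (1 / 5)
      have h5 : (4 / 5 : ℝ) ≤ (Real.exp (1 / 5))⁻¹ := by linarith
      rw [le_inv_comm₀ (by norm_num) h4] at h5
      linarith
    have h6 : Real.exp (6 / 5) = Real.exp 1 * Real.exp (1 / 5) := by
      rw [← Real.exp_add]; norm_num
    have h7 := Real.exp_one_lt_d9
    rw [h6]
    nlinarith [Real.exp_pos 1, Real.exp_pos (1 / 5)]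
  have hc := convexOn_exp.2 (Set.mem_univ 0) (Set.mem_univ (6 / 5 : ℝ))
    (by linarith : 0 ≤ 1 - 5 / 4 * v) (by linarith : 0 ≤ 5 / 4 * v) (by ring)
  simp only [smul_eq_mul, mul_zero, zero_add, Real.exp_zero, mul_one] at hc
  rw [show 5 / 4 * v * (6 / 5) = 3 / 2 * v by ring] at hc
  nlinarith

lemma norm_rpow_eq_sq_rpow (x : E) (p : ℝ) : ‖x‖ ^ p = (‖x‖ ^ 2) ^ (p / 2) := by
  rw [← Real.rpow_natCast, ← Real.rpow_mul (norm_nonneg _)]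
  congr 1; push_cast; ring

/-- A two-point inequality expressing the 2-uniform smoothness of the `p`-norm. -/
lemma norm_add_rpow_add_norm_sub_rpow_le [InnerProductSpace ℝ E] {p : ℝ} (hp : 2 ≤ p) (x y : E) :
    ‖x + y‖ ^ p + ‖x - y‖ ^ p ≤ 2 * (‖x‖ ^ 2 + 3 * p * ‖y‖ ^ 2) ^ (p / 2) := by
  have hp2 : 0 ≤ p / 2 := by linarith
  rw [norm_rpow_eq_sq_rpow, norm_rpow_eq_sq_rpow]
  -- If `y` is large relative to `x / √p`, the triangle inequality suffices. Otherwise `‖x ± y‖² = a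
  -- (1 ± 2r + u)` is bounded through `1 + t ≤ exp t`, and the terms linear in `r` combine into a
  -- `cosh`, which is at most Gaussian; `r² ≤ u` is Cauchy–Schwarz.
  rcases le_or_gt (4 / 5 * ‖x‖ ^ 2) (p * ‖y‖ ^ 2) with h | h
  · have hkey : ∀ c : ℝ, c ≤ ‖x‖ + ‖y‖ → 0 ≤ c →
        c ^ 2 ≤ ‖x‖ ^ 2 + 3 * p * ‖y‖ ^ 2 := fun c hc h0 => by
      have h1 : c ^ 2 ≤ (‖x‖ + ‖y‖) ^ 2 := by gcongr
      nlinarith [sq_nonneg (‖x‖ * 4 - ‖y‖ * 5), sq_nonneg ‖y‖]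
    have h1 := Real.rpow_le_rpow (by positivity)
      (hkey _ (norm_add_le x y) (norm_nonneg _)) hp2
    have h2 := Real.rpow_le_rpow (by positivity)
      (hkey _ (norm_sub_le x y) (norm_nonneg _)) hp2
    linarith
  · set a := ‖x‖ ^ 2 with ha
    have hb0 : 0 ≤ ‖y‖ ^ 2 := by positivity
    have ha0 : 0 < a := by nlinarith
    set r := inner ℝ x y / a with hr
    set u := ‖y‖ ^ 2 / a with hu
    have hu0 : 0 ≤ u := by positivity
    have hru : r ^ 2 ≤ u := by
      have h1 := real_inner_mul_inner_self_le x y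
      rw [real_inner_self_eq_norm_sq, real_inner_self_eq_norm_sq] at h1
      rw [hr, hu, div_pow, div_le_div_iff₀ (by positivity) ha0]
      nlinarith
    have hpu : p * u ≤ 4 / 5 := by
      rw [hu, ← mul_div_assoc, div_le_iff₀ ha0]; exact h.le
    have hgen : ∀ s : ℝ, ∀ w : ℝ, 0 ≤ w → w = a * (1 + 2 * s + u) →
        w ^ (p / 2) ≤ a ^ (p / 2) * (Real.exp (p * u / 2) * Real.exp (p * s)) := by
      intro s w hw hs
      have h1 : w ≤ a * Real.exp (2 * s + u) := by
        rw [hs]; gcongr; linarith [Real.add_one_le_exp (2 * s + u)]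
      calc w ^ (p / 2) ≤ (a * Real.exp (2 * s + u)) ^ (p / 2) := Real.rpow_le_rpow hw h1 hp2
        _ = _ := by
          rw [Real.mul_rpow ha0.le (Real.exp_pos _).le, ← Real.exp_mul, ← Real.exp_add]
          congr 2; ring
    have hxy : ‖x + y‖ ^ 2 = a * (1 + 2 * r + u) := by
      rw [norm_add_sq_real, hr, hu]; field_simp; rw [ha]
    have hxy' : ‖x - y‖ ^ 2 = a * (1 + 2 * (-r) + u) := by
      rw [norm_sub_sq_real, hr, hu]; field_simp; ring
    have h1 := hgen r _ (by positivity) hxy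
    have h2 := hgen (-r) _ (by positivity) hxy'
    have h3 : Real.exp (p * r) + Real.exp (p * -r) ≤ 2 * Real.exp (p ^ 2 * u / 2) := by
      have h4 := Real.cosh_le_exp_half_sq (p * r)
      rw [Real.cosh_eq] at h4
      have h5 : Real.exp ((p * r) ^ 2 / 2) ≤ Real.exp (p ^ 2 * u / 2) := by
        apply Real.exp_le_exp.2; nlinarith [sq_nonneg p]
      rw [mul_neg]; linarith
    -- Here `1 + p ≤ 3p/2`, which is where `p ≥ 2` is needed, reduces the exponent to
    -- `(p/2)(3/2)pu`.
    have h6 : Real.exp (p * u / 2) * Real.exp (p ^ 2 * u / 2) ≤ (1 + 3 * (p * u)) ^ (p / 2) := by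
      have h7 := exp_le_one_add_three_mul (v := p * u) (by positivity) hpu
      calc _ ≤ (Real.exp (3 / 2 * (p * u))) ^ (p / 2) := by
            rw [← Real.exp_add, ← Real.exp_mul]
            apply Real.exp_le_exp.2
            nlinarith [mul_nonneg (mul_nonneg (by linarith : 0 ≤ p) hu0) (by linarith : 0 ≤ p - 2)]
        _ ≤ _ := Real.rpow_le_rpow (Real.exp_pos _).le h7 hp2
    have h8 : a + 3 * p * ‖y‖ ^ 2 = a * (1 + 3 * (p * u)) := by
      rw [hu]; field_simp
    rw [h8, Real.mul_rpow ha0.le (by positivity)]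
    have ha1 : 0 ≤ a ^ (p / 2) := by positivity
    calc _ ≤ a ^ (p / 2) * (Real.exp (p * u / 2) * (Real.exp (p * r) + Real.exp (p * -r))) := by
          linarith
      _ ≤ a ^ (p / 2) * (Real.exp (p * u / 2) * (2 * Real.exp (p ^ 2 * u / 2))) := by gcongr
      _ = 2 * (a ^ (p / 2) * (Real.exp (p * u / 2) * Real.exp (p ^ 2 * u / 2))) := by ring
      _ ≤ _ := by gcongr

end TwoPoint

/-! ### Adding a martingale increment in `L^p`. -/

section Smoothness

variable {Ω : Type*} {m m0 : MeasurableSpace Ω} {μ : Measure Ω} {E : Type*}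
  [NormedAddCommGroup E]

lemma lpNorm_rpow_eq_integral {p : ℝ} (hp : 0 < p) {f : Ω → E}
    (hf : AEStronglyMeasurable f μ) :
    lpNorm f (ENNReal.ofReal p) μ ^ p = ∫ x, ‖f x‖ ^ p ∂μ := by
  have h0 : ENNReal.ofReal p ≠ 0 := by simpa using hp
  rw [lpNorm_eq_integral_norm_rpow_toReal h0 ENNReal.ofReal_ne_top hf,
    ENNReal.toReal_ofReal hp.le, ← Real.rpow_mul (by positivity), inv_mul_cancel₀ hp.ne',
    Real.rpow_one]

lemma lpNorm_norm_sq {p : ℝ} (hp : 2 ≤ p) {f : Ω → E} (hf : AEStronglyMeasurable f μ) :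
    lpNorm (fun x => ‖f x‖ ^ 2) (ENNReal.ofReal (p / 2)) μ = lpNorm f (ENNReal.ofReal p) μ ^ 2 := by
  have hp0 : 0 < p := by linarith
  have h1 := lpNorm_rpow_eq_integral (μ := μ) (p := p / 2) (by linarith) (hf.norm.pow 2)
  have h2 := lpNorm_rpow_eq_integral (μ := μ) hp0 hf
  have h3 : (lpNorm f (ENNReal.ofReal p) μ ^ 2) ^ (p / 2) = lpNorm f (ENNReal.ofReal p) μ ^ p := by
    rw [← Real.rpow_natCast, ← Real.rpow_mul lpNorm_nonneg]
    congr 1; push_cast; ring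
  have h4 : lpNorm (fun x => ‖f x‖ ^ 2) (ENNReal.ofReal (p / 2)) μ ^ (p / 2)
      = (lpNorm f (ENNReal.ofReal p) μ ^ 2) ^ (p / 2) := by
    rw [h3, h2]; refine Eq.trans h1 (integral_congr_ae (ae_of_all _ fun x => ?_))
    simp only [Pi.pow_apply, norm_pow, norm_norm]
    exact (norm_rpow_eq_sq_rpow (f x) p).symm
  exact (Real.rpow_left_inj lpNorm_nonneg (by positivity) (by linarith)).1 h4

lemma memLp_norm_sq {p : ℝ} {f : Ω → E} (hf : MemLp f (ENNReal.ofReal p) μ) :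
    MemLp (fun x => ‖f x‖ ^ 2) (ENNReal.ofReal (p / 2)) μ := by
  have h := hf.norm_rpow_div (2 : ℝ≥0∞)
  rw [ENNReal.ofReal_div_of_pos (by norm_num)]
  simpa using h

/-- The `Lᵖ` norm of a sum of a random vector and a martingale increment. -/
lemma lpNorm_add_sq_le_of_condExp_eq_zero [InnerProductSpace ℝ E]
    [CompleteSpace E] [IsProbabilityMeasure μ] (hm : m ≤ m0)
    {p : ℝ} (hp : 2 ≤ p) {X D : Ω → E} (hX : MemLp X (ENNReal.ofReal p) μ)
    (hD : MemLp D (ENNReal.ofReal p) μ) (hXm : StronglyMeasurable[m] X) (hD0 : μ[D|m] =ᵐ[μ] 0) :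
    lpNorm (X + D) (ENNReal.ofReal p) μ ^ 2
      ≤ lpNorm X (ENNReal.ofReal p) μ ^ 2 + 6 * p * lpNorm D (ENNReal.ofReal p) μ ^ 2 := by
  have hp0 : 0 < p := by linarith
  have hP1 : 1 ≤ ENNReal.ofReal p := ENNReal.one_le_ofReal.2 (by linarith)
  have hXi : Integrable X μ := hX.integrable hP1
  have hDi : Integrable D μ := hD.integrable hP1
  set A := lpNorm X (ENNReal.ofReal p) μ with hA
  set B := lpNorm D (ENNReal.ofReal p) μ with hB
  have hA0 : 0 ≤ A := lpNorm_nonneg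
  have hB0 : 0 ≤ B := lpNorm_nonneg
  -- The conditional expectation of `X - D` is `X`, and conditioning contracts the norm; so the
  -- second term of the two-point inequality is at least `A ^ p`.
  have hcontr : A ≤ lpNorm (X - D) (ENNReal.ofReal p) μ := by
    have h1 : μ[X - D|m] =ᵐ[μ] X := by
      have h2 := condExp_sub hXi hDi m
      filter_upwards [h2, hD0] with x hx hx0
      rw [hx, Pi.sub_apply, hx0, condExp_of_stronglyMeasurable hm hXm hXi]; simp
    have h3 := (hX.sub hD).lpNorm_condExp_le_lpNorm (m := m) hP1
    have h4 : lpNorm (μ[X - D|m]) (ENNReal.ofReal p) μ = A := by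
      rw [hA, ← toReal_eLpNorm hX.1, ← toReal_eLpNorm integrable_condExp.1, eLpNorm_congr_ae h1]
    rwa [h4] at h3
  have hint : ∀ {f : Ω → E}, MemLp f (ENNReal.ofReal p) μ → Integrable (fun x => ‖f x‖ ^ p) μ := by
    intro f hf
    have := hf.integrable_norm_rpow (by simpa using hp0) ENNReal.ofReal_ne_top
    rwa [ENNReal.toReal_ofReal hp0.le] at this
  set W : Ω → ℝ := fun x => ‖X x‖ ^ 2 + 3 * p * ‖D x‖ ^ 2 with hW
  have hDW : MemLp (fun x => 3 * p * ‖D x‖ ^ 2) (ENNReal.ofReal (p / 2)) μ :=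
    (memLp_norm_sq hD).const_mul (3 * p)
  have hWm : MemLp W (ENNReal.ofReal (p / 2)) μ := (memLp_norm_sq hX).add hDW
  have hW0 : ∀ x, 0 ≤ W x := fun x => by positivity
  have hWn : lpNorm W (ENNReal.ofReal (p / 2)) μ ≤ A ^ 2 + 3 * p * B ^ 2 := by
    have h1 := lpNorm_add_le (memLp_norm_sq hX) (g := fun x => 3 * p * ‖D x‖ ^ 2)
      (ENNReal.one_le_ofReal.2 (by linarith : 1 ≤ p / 2))
    have h2 : lpNorm (fun x => 3 * p * ‖D x‖ ^ 2) (ENNReal.ofReal (p / 2)) μ = 3 * p * B ^ 2 := by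
      have h3 := lpNorm_const_smul (3 * p) (fun x => ‖D x‖ ^ 2) μ (p := ENNReal.ofReal (p / 2))
      rw [lpNorm_norm_sq hp hD.1] at h3
      refine Eq.trans ?_ (h3.trans ?_)
      · rfl
      · rw [coe_nnnorm, Real.norm_of_nonneg (by positivity)]
    rw [lpNorm_norm_sq hp hX.1, h2] at h1
    exact h1
  have hWi : Integrable (fun x => W x ^ (p / 2)) μ := by
    have := hWm.integrable_norm_rpow (by simpa using hp0) ENNReal.ofReal_ne_top
    rw [ENNReal.toReal_ofReal (by linarith)] at this
    simpa only [Real.norm_of_nonneg (hW0 _)] using this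
  have hmain : ∫ x, ‖(X + D) x‖ ^ p ∂μ + ∫ x, ‖(X - D) x‖ ^ p ∂μ
      ≤ 2 * (A ^ 2 + 3 * p * B ^ 2) ^ (p / 2) := by
    rw [← integral_add (hint (hX.add hD)) (hint (hX.sub hD))]
    calc _ ≤ ∫ x, 2 * W x ^ (p / 2) ∂μ :=
          integral_mono ((hint (hX.add hD)).add (hint (hX.sub hD))) (hWi.const_mul 2)
            fun x => norm_add_rpow_add_norm_sub_rpow_le hp (X x) (D x)
      _ = 2 * lpNorm W (ENNReal.ofReal (p / 2)) μ ^ (p / 2) := by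
          rw [integral_const_mul, lpNorm_rpow_eq_integral (by linarith) hWm.1]
          simp only [Real.norm_of_nonneg (hW0 _)]
      _ ≤ _ := by gcongr; exact lpNorm_nonneg
  rw [← lpNorm_rpow_eq_integral hp0 (hX.add hD).1, ← lpNorm_rpow_eq_integral hp0 (hX.sub hD).1]
    at hmain
  have hAp : (A ^ 2) ^ (p / 2) ≤ lpNorm (X - D) (ENNReal.ofReal p) μ ^ p := by
    calc (A ^ 2) ^ (p / 2) = A ^ p := by
          rw [← Real.rpow_natCast, ← Real.rpow_mul hA0]; congr 1; push_cast; ring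
      _ ≤ _ := by gcongr
  -- Midpoint convexity of `t ↦ t^(p/2)` gives `2 (A² + 3pB²)^(p/2) - A^p ≤ (A² + 6pB²)^(p/2)`,
  -- hence the constant 6.
  have hconv := (convexOn_rpow (p := p / 2) (by linarith)).2
    (Set.mem_Ici.2 (by positivity : 0 ≤ A ^ 2)) (Set.mem_Ici.2
      (by positivity : 0 ≤ A ^ 2 + 6 * p * B ^ 2)) 
      (by norm_num : (0 : ℝ) ≤ 1 / 2) (by norm_num : (0 : ℝ) ≤ 1 / 2) (by norm_num)
  simp only [smul_eq_mul] at hconv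
  rw [show 1 / 2 * A ^ 2 + 1 / 2 * (A ^ 2 + 6 * p * B ^ 2) = A ^ 2 + 3 * p * B ^ 2 by ring]
    at hconv
  have hfin : (lpNorm (X + D) (ENNReal.ofReal p) μ ^ 2) ^ (p / 2)
      ≤ (A ^ 2 + 6 * p * B ^ 2) ^ (p / 2) := by
    calc _ = lpNorm (X + D) (ENNReal.ofReal p) μ ^ p := by
          rw [← Real.rpow_natCast, ← Real.rpow_mul lpNorm_nonneg]; congr 1; push_cast; ring
      _ ≤ _ := by linarith
  exact (Real.rpow_le_rpow_iff (by positivity) (by positivity) (by linarith)).1 hfin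

end Smoothness

/-! ### Moment bound for sums with summable conditional means. -/

section Mixingale

variable {Ω : Type*} {m0 : MeasurableSpace Ω} {μ : Measure Ω} {E : Type*}
  [NormedAddCommGroup E]

lemma lpNorm_congr_ae {q : ℝ≥0∞} {f g : Ω → E} (h : f =ᵐ[μ] g) : lpNorm f q μ = lpNorm g q μ := by
  by_cases hf : AEStronglyMeasurable f μ
  · rw [← toReal_eLpNorm hf, ← toReal_eLpNorm (hf.congr h), eLpNorm_congr_ae h]
  · rw [lpNorm_of_not_aestronglyMeasurable hf,
      lpNorm_of_not_aestronglyMeasurable fun hg => hf (hg.congr h.symm)]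

variable [InnerProductSpace ℝ E] [CompleteSpace E] [IsProbabilityMeasure μ]

lemma lpNorm_condExp_sum_le {ι : Type*} {m : MeasurableSpace Ω} {q : ℝ≥0∞} (hq : 1 ≤ q)
    {X : ι → Ω → E} (s : Finset ι) (hX : ∀ i ∈ s, MemLp (X i) q μ) :
    lpNorm (μ[∑ i ∈ s, X i|m]) q μ ≤ ∑ i ∈ s, lpNorm (μ[X i|m]) q μ := by
  rw [lpNorm_congr_ae (condExp_finsetSum (fun i hi => (hX i hi).integrable hq) m)]
  exact lpNorm_sum_le (fun i hi => (hX i hi).condExp hq) hq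

/-- A moment bound for sums of an adapted sequence whose conditional expectations given the past
are summable. -/
lemma lpNorm_sum_sq_le_of_condExp {p : ℝ} (hp : 2 ≤ p) (𝒢 : Filtration ℕ m0) {X : ℕ → Ω → E}
    (hX : ∀ j, MemLp (X j) (ENNReal.ofReal p) μ) (hXm : ∀ j, StronglyMeasurable[𝒢 j] (X j))
    {B : ℕ → ℝ}
    (hB : ∀ j K, ∑ k ∈ Finset.range K, lpNorm (μ[X (j + k)|𝒢 j]) (ENNReal.ofReal p) μ ≤ B j)
    (N : ℕ) :
    lpNorm (∑ j ∈ Finset.range N, X j) (ENNReal.ofReal p) μ ^ 2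
      ≤ 24 * p * ∑ j ∈ Finset.range N, B j ^ 2 := by
  have hP1 : 1 ≤ ENNReal.ofReal p := ENNReal.one_le_ofReal.2 (by linarith)
  have hXi : ∀ j, Integrable (X j) μ := fun j => (hX j).integrable hP1
  rcases Nat.eq_zero_or_pos N with rfl | hN
  · simp
  set S : Ω → E := ∑ j ∈ Finset.range N, X j with hS
  have hSp : MemLp S (ENNReal.ofReal p) μ := memLp_finsetSum' _ fun j _ => hX j
  have hSi : Integrable S μ := hSp.integrable hP1
  -- The tail sums matter because the part of `S` before `j` is known at time `j`: the increment of
  -- `E[S | 𝒢 j]` involves only conditional means of the tail, of size at most `B j + B (j + 1)`.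
  set R : ℕ → Ω → E := fun j => ∑ i ∈ Finset.Ico j N, X i with hR
  have hRp : ∀ j, MemLp (R j) (ENNReal.ofReal p) μ := fun j => memLp_finsetSum' _ fun i _ => hX i
  have hRi : ∀ j, Integrable (R j) μ := fun j => (hRp j).integrable hP1
  have hB0 : ∀ j, 0 ≤ B j := fun j => by simpa using hB j 0
  have hR1 : ∀ j, lpNorm (μ[R j|𝒢 j]) (ENNReal.ofReal p) μ ≤ B j := fun j => by
    refine (lpNorm_condExp_sum_le hP1 _ fun i _ => hX i).trans ?_
    rw [Finset.sum_Ico_eq_sum_range]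
    exact hB j _
  have hR2 : ∀ j, lpNorm (μ[R (j + 1)|𝒢 j]) (ENNReal.ofReal p) μ ≤ B j := fun j => by
    refine (lpNorm_condExp_sum_le hP1 _ fun i _ => hX i).trans ?_
    rw [Finset.sum_Ico_eq_sum_range]
    refine le_trans ?_ (hB j (N - (j + 1) + 1))
    rw [Finset.sum_range_succ']
    refine le_trans (Finset.sum_le_sum fun i _ => ?_) (le_add_of_nonneg_right lpNorm_nonneg)
    rw [add_assoc, add_comm 1 i]
  have hpast : ∀ j i, i ≤ j →
      μ[∑ k ∈ Finset.range i, X k|𝒢 j] = ∑ k ∈ Finset.range i, X k := fun j i hij =>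
    condExp_of_stronglyMeasurable (𝒢.le j) (Finset.stronglyMeasurable_sum _ fun k hk =>
      (hXm k).mono (𝒢.mono ((Finset.mem_range.1 hk).le.trans hij)))
      (integrable_finsetSum' _ fun k _ => hXi k)
  have hsplit : ∀ j, j ≤ N → S = ∑ k ∈ Finset.range j, X k + R j := fun j hj =>
    (Finset.sum_range_add_sum_Ico _ hj).symm
  have hcond : ∀ j i, i ≤ j → i ≤ N →
      μ[S|𝒢 j] =ᵐ[μ] ∑ k ∈ Finset.range i, X k + μ[R i|𝒢 j] := fun j i hij hiN => by
    have h1 := condExp_add (integrable_finsetSum' (Finset.range i) fun k _ => hXi k) (hRi i) (𝒢 j)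
      (μ := μ)
    rw [hpast j i hij, ← hsplit i hiN] at h1
    exact h1
  -- A step adds at most `6p (B (j+1) + B j)² ≤ 12p B (j+1)² + 12p B j²`. The subtracted `12p B j²`
  -- reserves room for the second half of that cost, which makes the induction close with 24.
  have hM : ∀ j, j < N → lpNorm (μ[S|𝒢 j]) (ENNReal.ofReal p) μ ^ 2
      ≤ 24 * p * ∑ i ∈ Finset.range (j + 1), B i ^ 2 - 12 * p * B j ^ 2 := by
    intro j
    induction j with
    | zero =>
      intro h0
      have h1 : lpNorm (μ[S|𝒢 0]) (ENNReal.ofReal p) μ ≤ B 0 := by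
        rw [lpNorm_congr_ae (hcond 0 0 le_rfl (Nat.zero_le _))]
        simpa using hR1 0
      have h2 : lpNorm (μ[S|𝒢 0]) (ENNReal.ofReal p) μ ^ 2 ≤ B 0 ^ 2 := by
        gcongr; exact lpNorm_nonneg
      simp only [zero_add, Finset.sum_range_one]
      nlinarith [sq_nonneg (B 0)]
    | succ j ih =>
      intro hj
      have ih' := ih (by omega)
      set D : Ω → E := μ[S|𝒢 (j + 1)] - μ[S|𝒢 j] with hD
      have hDp : MemLp D (ENNReal.ofReal p) μ := (hSp.condExp hP1).sub (hSp.condExp hP1)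
      have hD0 : μ[D|𝒢 j] =ᵐ[μ] 0 := by
        have h1 := condExp_sub (μ := μ) (integrable_condExp (f := S) (m := 𝒢 (j + 1)))
          (integrable_condExp (f := S) (m := 𝒢 j)) (𝒢 j)
        have h2 := condExp_condExp_of_le (μ := μ) (f := S) (𝒢.mono (Nat.le_succ j)) (𝒢.le (j + 1))
        have h3 : μ[μ[S|𝒢 j]|𝒢 j] = μ[S|𝒢 j] :=
          condExp_of_stronglyMeasurable (𝒢.le j) stronglyMeasurable_condExp integrable_condExp
        filter_upwards [h1, h2] with x hx1 hx2
        rw [hD, hx1, Pi.sub_apply, h3, hx2]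
        simp
      have hDn : lpNorm D (ENNReal.ofReal p) μ ≤ B (j + 1) + B j := by
        have h1 : D =ᵐ[μ] μ[R (j + 1)|𝒢 (j + 1)] - μ[R (j + 1)|𝒢 j] := by
          have hb := condExp_add (μ := μ) (hXi j) (hRi (j + 1)) (𝒢 j)
          rw [condExp_of_stronglyMeasurable (𝒢.le j) (hXm j) (hXi j)] at hb
          have hRj : R j = X j + R (j + 1) := Finset.sum_eq_sum_Ico_succ_bot (by omega) _
          rw [← hRj] at hb
          filter_upwards [hcond (j + 1) (j + 1) le_rfl hj.le, hcond j j le_rfl (by omega), hb]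
            with x hx1 hx2 hx3
          rw [hD, Pi.sub_apply, hx1, hx2, Pi.add_apply, Pi.add_apply, hx3,
            Finset.sum_range_succ, Pi.add_apply, Pi.add_apply, Pi.sub_apply]
          abel
        rw [lpNorm_congr_ae h1]
        exact (lpNorm_sub_le ((hRp (j + 1)).condExp hP1) hP1).trans (add_le_add (hR1 _) (hR2 j))
      have hstep := lpNorm_add_sq_le_of_condExp_eq_zero (μ := μ) (𝒢.le j) hp
        (hSp.condExp hP1 (m := 𝒢 j)) hDp stronglyMeasurable_condExp hD0
      have hsum : μ[S|𝒢 j] + D = μ[S|𝒢 (j + 1)] := by rw [hD]; abel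
      rw [hsum] at hstep
      have h5 : lpNorm D (ENNReal.ofReal p) μ ^ 2 ≤ 2 * B (j + 1) ^ 2 + 2 * B j ^ 2 := by
        have h6 : lpNorm D (ENNReal.ofReal p) μ ^ 2 ≤ (B (j + 1) + B j) ^ 2 := by
          gcongr; exact lpNorm_nonneg
        nlinarith [sq_nonneg (B (j + 1) - B j)]
      rw [Finset.sum_range_succ]
      nlinarith
  obtain ⟨N', rfl⟩ : ∃ N', N = N' + 1 := ⟨N - 1, by omega⟩
  have hfin : μ[S|𝒢 N'] = S := by
    refine condExp_of_stronglyMeasurable (𝒢.le N') (Finset.stronglyMeasurable_sum _ fun k hk =>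
      (hXm k).mono (𝒢.mono (Nat.lt_succ_iff.1 (Finset.mem_range.1 hk)))) hSi
  have h := hM N' (Nat.lt_succ_self _)
  rw [hfin] at h
  nlinarith [sq_nonneg (B N')]

lemma sum_range_mul_eq {M : Type*} [AddCommMonoid M] (f : ℕ → M) (m N : ℕ) :
    ∑ t ∈ Finset.range (N * m), f t
      = ∑ r ∈ Finset.range m, ∑ j ∈ Finset.range N, f (r + j * m) := by
  induction N with
  | zero => simp
  | succ N ih =>
    rw [Nat.succ_mul, Finset.sum_range_add, ih]
    simp only [Finset.sum_range_succ]
    rw [Finset.sum_add_distrib]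
    congr 1
    exact Finset.sum_congr rfl fun r _ => by rw [add_comm]

/-- A moment bound for sums of an adapted sequence whose conditional expectations given the past
are summable along arithmetic progressions of step `m`. -/
lemma lpNorm_sum_sq_le_of_condExp_step {p : ℝ} (hp : 2 ≤ p) (𝒢 : Filtration ℕ m0)
    {X : ℕ → Ω → E} (hX : ∀ j, MemLp (X j) (ENNReal.ofReal p) μ)
    (hXm : ∀ j, StronglyMeasurable[𝒢 j] (X j)) {B : ℕ → ℝ} {m : ℕ} (hm : 1 ≤ m) {n : ℕ}
    (hB : ∀ t K, t < n → (∀ k < K, t + k * m < n) →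
      ∑ k ∈ Finset.range K, lpNorm (μ[X (t + k * m)|𝒢 t]) (ENNReal.ofReal p) μ ≤ B t) :
    lpNorm (∑ t ∈ Finset.range n, X t) (ENNReal.ofReal p) μ ^ 2
      ≤ 24 * p * m * ∑ t ∈ Finset.range n, B t ^ 2 := by
  have hP1 : 1 ≤ ENNReal.ofReal p := ENNReal.one_le_ofReal.2 (by linarith)
  -- Padding by zero beyond `n` lets every residue class mod `m` be summed over the same number of
  -- terms, while the hypothesis is only used at times below `n`.
  set X' : ℕ → Ω → E := fun t => if t < n then X t else 0 with hX'
  set B' : ℕ → ℝ := fun t => if t < n then B t else 0 with hB'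
  have hX'p : ∀ j, MemLp (X' j) (ENNReal.ofReal p) μ := fun j => by
    simp only [hX']; split_ifs
    · exact hX j
    · exact MemLp.zero
  have hX'm : ∀ j, StronglyMeasurable[𝒢 j] (X' j) := fun j => by
    simp only [hX']; split_ifs
    · exact hXm j
    · exact stronglyMeasurable_zero
  have hzero : ∀ t j, n ≤ t → lpNorm (μ[X' t|𝒢 j]) (ENNReal.ofReal p) μ = 0 := fun t j ht => by
    simp only [hX', if_neg (not_lt.2 ht), condExp_zero, lpNorm_zero]
  have hB'b : ∀ t K, ∑ k ∈ Finset.range K, lpNorm (μ[X' (t + k * m)|𝒢 t]) (ENNReal.ofReal p) μ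
      ≤ B' t := by
    intro t K
    by_cases ht : t < n
    · simp only [hB', if_pos ht]
      induction K with
      | zero => simpa using hB t 0 ht (by simp)
      | succ K ih =>
        by_cases hK : t + K * m < n
        · have hall : ∀ k < K + 1, t + k * m < n := fun k hk => by
            have : k * m ≤ K * m := Nat.mul_le_mul_right _ (by omega)
            omega
          refine le_of_eq_of_le (Finset.sum_congr rfl fun k hk => ?_) (hB t (K + 1) ht hall)
          simp only [hX', if_pos (hall k (Finset.mem_range.1 hk))]
        · rw [Finset.sum_range_succ, hzero _ _ (not_lt.1 hK), add_zero]
          exact ih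
    · simp only [hB', if_neg ht]
      refine Finset.sum_nonpos fun k _ => (hzero _ _ ?_).le
      have := Nat.zero_le (k * m); omega
  have hnm : n ≤ n * m := Nat.le_mul_of_pos_right _ hm
  have hsumX : ∑ t ∈ Finset.range n, X t
      = ∑ r ∈ Finset.range m, ∑ j ∈ Finset.range n, X' (r + j * m) := by
    rw [← sum_range_mul_eq]
    refine (Finset.sum_congr rfl fun t ht => ?_).trans
      (Finset.sum_subset (Finset.range_mono hnm) fun t _ ht => ?_)
    · simp only [hX', if_pos (Finset.mem_range.1 ht)]
    · simp only [hX', if_neg (fun h => ht (Finset.mem_range.2 h))]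
  have hsumB : ∑ t ∈ Finset.range n, B t ^ 2
      = ∑ r ∈ Finset.range m, ∑ j ∈ Finset.range n, B' (r + j * m) ^ 2 := by
    rw [← sum_range_mul_eq (fun t => B' t ^ 2)]
    refine (Finset.sum_congr rfl fun t ht => ?_).trans
      (Finset.sum_subset (Finset.range_mono hnm) fun t _ ht => ?_)
    · simp only [hB', if_pos (Finset.mem_range.1 ht)]
    · simp only [hB', if_neg (fun h => ht (Finset.mem_range.2 h))]; simp
  have hclass : ∀ r, lpNorm (∑ j ∈ Finset.range n, X' (r + j * m)) (ENNReal.ofReal p) μ ^ 2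
      ≤ 24 * p * ∑ j ∈ Finset.range n, B' (r + j * m) ^ 2 := fun r => by
    let ℋ : Filtration ℕ m0 :=
      { seq := fun j => 𝒢 (r + j * m)
        mono' := fun i j hij => 𝒢.mono (by gcongr)
        le' := fun j => 𝒢.le _ }
    refine lpNorm_sum_sq_le_of_condExp hp ℋ (X := fun j => X' (r + j * m))
      (B := fun j => B' (r + j * m)) (fun j => hX'p _) (fun j => hX'm _) (fun j K => ?_) n
    refine le_of_eq_of_le (Finset.sum_congr rfl fun k _ => ?_) (hB'b (r + j * m) K)
    have : r + (j + k) * m = r + j * m + k * m := by ring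
    simp only [this]
    rfl
  have htri : lpNorm (∑ t ∈ Finset.range n, X t) (ENNReal.ofReal p) μ
      ≤ ∑ r ∈ Finset.range m,
        lpNorm (∑ j ∈ Finset.range n, X' (r + j * m)) (ENNReal.ofReal p) μ := by
    rw [hsumX]
    exact lpNorm_sum_le (fun r _ => memLp_finsetSum' _ fun j _ => hX'p _) hP1
  -- The factor `m` is the price of Cauchy–Schwarz over the `m` residue classes.
  calc lpNorm (∑ t ∈ Finset.range n, X t) (ENNReal.ofReal p) μ ^ 2
      ≤ (∑ r ∈ Finset.range m,
        lpNorm (∑ j ∈ Finset.range n, X' (r + j * m)) (ENNReal.ofReal p) μ) ^ 2 := by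
        gcongr; exact lpNorm_nonneg
    _ ≤ (Finset.range m).card * ∑ r ∈ Finset.range m,
        lpNorm (∑ j ∈ Finset.range n, X' (r + j * m)) (ENNReal.ofReal p) μ ^ 2 :=
        sq_sum_le_card_mul_sum_sq
    _ ≤ (Finset.range m).card * ∑ r ∈ Finset.range m,
        (24 * p * ∑ j ∈ Finset.range n, B' (r + j * m) ^ 2) := by
        gcongr with r _; exact hclass r
    _ = _ := by rw [hsumB, ← Finset.mul_sum, Finset.card_range]; ring

end Mixingale

/-! ### Path laws of Markov chains and the Markov property. -/

section Chain

open Preorder Filtration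

variable {X : Type*}

/-- Appending a point to a finite path. -/
def appendPath (a : ℕ) (y : ((i : Finset.Iic a) → X) × X) : (i : Finset.Iic (a + 1)) → X :=
  fun i => if h : (i : ℕ) ≤ a then y.1 ⟨i, Finset.mem_Iic.2 h⟩ else y.2

lemma frestrictLe_succ_eq (a : ℕ) :
    frestrictLe (π := fun _ : ℕ => X) (a + 1)
      = appendPath a ∘ fun ω => (frestrictLe a ω, ω (a + 1)) := by
  ext ω i
  simp only [Function.comp, appendPath, frestrictLe_apply]
  split_ifs with h
  · rfl
  · have hi := Finset.mem_Iic.1 i.2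
    have : (i : ℕ) = a + 1 := by omega
    rw [this]

variable [MeasurableSpace X]

/-- Every finite set of times lies in an initial segment, so both measures are projective limits of
the same family. -/
lemma measure_eq_of_map_frestrictLe {μ ν : Measure (ℕ → X)} [IsFiniteMeasure ν]
    (h : ∀ a, μ.map (frestrictLe (π := fun _ : ℕ => X) a) = ν.map (frestrictLe a)) : μ = ν := by
  let P : (I : Finset ℕ) → Measure ((i : I) → X) := fun I => ν.map I.restrict
  have hν : IsProjectiveLimit ν P := fun I => rfl
  have hμ : IsProjectiveLimit μ P := fun I => by
    have hI : I ⊆ Finset.Iic (I.sup id) := I.subset_Iic_sup_id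
    have h1 : I.restrict (π := fun _ : ℕ => X) = Finset.restrict₂ hI ∘ frestrictLe (I.sup id) := rfl
    simp only [P]
    rw [h1, ← Measure.map_map (Finset.measurable_restrict₂ (X := fun _ => X) hI) (by fun_prop),
      ← Measure.map_map (Finset.measurable_restrict₂ (X := fun _ => X) hI) (by fun_prop), h]
  exact hμ.unique hν

lemma measurable_appendPath (a : ℕ) : Measurable (appendPath (X := X) a) := by
  refine measurable_pi_iff.2 fun i => ?_
  unfold appendPath
  by_cases h : (i : ℕ) ≤ a
  · simp only [h, dite_true]; fun_prop
  · simp only [h, dite_false]; fun_prop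

/-- The last point of a finite path. -/
def lastPoint (a : ℕ) (h : (i : Finset.Iic a) → X) : X := h ⟨a, Finset.mem_Iic.2 le_rfl⟩

lemma measurable_lastPoint (a : ℕ) : Measurable (lastPoint (X := X) a) := measurable_pi_apply _

variable (κ : Kernel X X) [IsMarkovKernel κ] (ξ : Measure X)

instance [IsProbabilityMeasure ξ] : IsProbabilityMeasure (chainLaw κ ξ) :=
  inferInstanceAs (IsProbabilityMeasure (Kernel.trajMeasure (X := fun _ : ℕ => X) ξ
    (fun n => κ.comap (lastPoint n) (measurable_lastPoint n))))

lemma map_frestrictLe_compProd_chainLaw [IsProbabilityMeasure ξ] (a : ℕ) :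
    (chainLaw κ ξ).map (frestrictLe a) ⊗ₘ κ.comap (lastPoint a) (measurable_lastPoint a)
      = (chainLaw κ ξ).map (fun ω => (frestrictLe a ω, ω (a + 1))) :=
  Kernel.map_frestrictLe_trajMeasure_compProd_eq_map_trajMeasure (X := fun _ : ℕ => X) (μ₀ := ξ)
    (κ := fun n => κ.comap (lastPoint n) (measurable_lastPoint n)) (a := a)

lemma map_zero_chainLaw : (chainLaw κ ξ).map (fun ω => ω 0) = ξ := by
  have h1 : (chainLaw κ ξ).map (frestrictLe (π := fun _ : ℕ => X) 0)
      = ξ.map (MeasurableEquiv.piUnique (fun _ : Finset.Iic 0 => X)).symm := by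
    unfold chainLaw Kernel.trajMeasure
    rw [Measure.map_comp _ _ (by fun_prop), Kernel.traj_map_frestrictLe, Kernel.partialTraj_self,
      Measure.id_comp]
  have h2 : (fun ω : ℕ → X => ω 0) = lastPoint 0 ∘ frestrictLe 0 := rfl
  rw [h2, ← Measure.map_map (measurable_lastPoint 0) (by fun_prop), h1,
    Measure.map_map (measurable_lastPoint 0) (by fun_prop)]
  exact Measure.map_id

variable [IsProbabilityMeasure ξ]

/-- The chain law is characterised by the initial law and the transition kernel. -/
lemma eq_chainLaw {μ : Measure (ℕ → X)} (h0 : μ.map (fun ω => ω 0) = ξ)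
    (h : ∀ a, μ.map (frestrictLe a) ⊗ₘ κ.comap (lastPoint a) (measurable_lastPoint a)
      = μ.map (fun ω => (frestrictLe a ω, ω (a + 1)))) : μ = chainLaw κ ξ := by
  refine measure_eq_of_map_frestrictLe fun a => ?_
  induction a with
  | zero =>
    have h2 : frestrictLe (π := fun _ : ℕ => X) 0
        = (MeasurableEquiv.piUnique (fun _ : Finset.Iic 0 => X)).symm ∘ fun ω => ω 0 := by
      ext ω i
      have hi : (i : ℕ) = 0 := Nat.le_zero.1 (Finset.mem_Iic.1 i.2)
      simp only [frestrictLe_apply, Function.comp]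
      rw [hi]; rfl
    rw [h2, ← Measure.map_map (by fun_prop) (by fun_prop), h0,
      ← Measure.map_map (by fun_prop) (by fun_prop), map_zero_chainLaw]
  | succ a ih =>
    rw [frestrictLe_succ_eq, ← Measure.map_map (measurable_appendPath a) (by fun_prop), ← h a, ih,
      map_frestrictLe_compProd_chainLaw, Measure.map_map (measurable_appendPath a) (by fun_prop)]

lemma map_succ_chainLaw (t : ℕ) :
    (chainLaw κ ξ).map (fun ω => ω (t + 1)) = κ ∘ₘ (chainLaw κ ξ).map (fun ω => ω t) := by
  have h1 := congrArg Measure.snd (map_frestrictLe_compProd_chainLaw κ ξ t)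
  rw [Measure.snd_compProd, Measure.snd_map_prodMk (by fun_prop)] at h1
  rw [← h1]
  have h2 : (fun ω : ℕ → X => ω t) = lastPoint t ∘ frestrictLe t := rfl
  rw [h2, ← Measure.map_map (measurable_lastPoint t) (by fun_prop)]
  ext s hs
  rw [Measure.bind_apply hs (Kernel.aemeasurable _), Measure.bind_apply hs (Kernel.aemeasurable _),
    lintegral_map (Kernel.measurable_coe κ hs) (measurable_lastPoint t)]
  rfl

lemma map_chainLaw_of_invariant (h : Kernel.Invariant κ ξ) (t : ℕ) :
    (chainLaw κ ξ).map (fun ω => ω t) = ξ := by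
  induction t with
  | zero => exact map_zero_chainLaw κ ξ
  | succ t ih => rw [map_succ_chainLaw, ih]; exact h

/-- Almost sure properties of transitions hold along the chain. -/
lemma ae_chainLaw_of_forall {R : X × X → Prop} (hR : MeasurableSet {y | R y})
    (h : ∀ x, ∀ᵐ y ∂κ x, R (x, y)) (t : ℕ) : ∀ᵐ ω ∂chainLaw κ ξ, R (ω t, ω (t + 1)) := by
  have hm : Measurable fun y : ((i : Finset.Iic t) → X) × X => (lastPoint t y.1, y.2) :=
    ((measurable_lastPoint t).comp measurable_fst).prodMk measurable_snd
  have h1 : ∀ᵐ y ∂(chainLaw κ ξ).map (fun ω => (frestrictLe t ω, ω (t + 1))),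
      R (lastPoint t y.1, y.2) := by
    rw [← map_frestrictLe_compProd_chainLaw]
    exact (Measure.ae_compProd_iff (hm hR)).2 (ae_of_all _ fun x => h (lastPoint t x))
  exact ae_of_ae_map (f := fun ω => (frestrictLe t ω, ω (t + 1))) (by fun_prop) h1

variable {F : Type*} [NormedAddCommGroup F] [NormedSpace ℝ F] [CompleteSpace F]

/-- Events of the past are preimages under `frestrictLe t`. On them the set integrals agree because
the joint law of the past and the next point is the composition product of the past with the kernel.
-/
lemma condExp_chainLaw_succ {f : X → F} (hf : StronglyMeasurable f) (t : ℕ)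
    (hfi : Integrable (fun ω => f (ω (t + 1))) (chainLaw κ ξ)) :
    (chainLaw κ ξ)[fun ω => f (ω (t + 1))|piLE t] =ᵐ[chainLaw κ ξ]
      fun ω => ∫ y, f y ∂κ (ω t) := by
  set ρ := (chainLaw κ ξ).map (frestrictLe (π := fun _ : ℕ => X) t) with hρ
  set η := κ.comap (lastPoint (X := X) t) (measurable_lastPoint t) with hη
  have hpm : Measurable fun ω : ℕ → X => (frestrictLe (π := fun _ : ℕ => X) t ω, ω (t + 1)) := by
    fun_prop
  have hfi' : Integrable (fun y : ((i : Finset.Iic t) → X) × X => f y.2) (ρ ⊗ₘ η) := by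
    rw [map_frestrictLe_compProd_chainLaw]
    exact (integrable_map_measure (hf.comp_measurable measurable_snd).aestronglyMeasurable
      hpm.aemeasurable).2 hfi
  have hint : Integrable (fun h => ∫ y, f y ∂η h) ρ := by
    simpa using Integrable.integral_compProd (κ := Kernel.const Unit ρ)
      (η := Kernel.prodMkLeft Unit η) (a := ()) hfi'
  have hint' : Integrable (fun ω : ℕ → X => ∫ y, f y ∂κ (ω t)) (chainLaw κ ξ) :=
    hint.comp_aemeasurable (by fun_prop : AEMeasurable (frestrictLe t) (chainLaw κ ξ))
  refine (ae_eq_condExp_of_forall_setIntegral_eq (piLE.le t) hfi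
    (fun s _ _ => hint'.integrableOn) ?_ ?_).symm
  · intro s hs _
    rw [piLE_eq_comap_frestrictLe] at hs
    obtain ⟨A, hA, rfl⟩ := hs
    have h1 := Measure.setIntegral_compProd (μ := ρ) (κ := η) hA MeasurableSet.univ
      (f := fun y => f y.2) hfi'.integrableOn
    simp only [Measure.restrict_univ] at h1
    have h2 := setIntegral_map (μ := chainLaw κ ξ) (hA.prod MeasurableSet.univ)
      (f := fun y : ((i : Finset.Iic t) → X) × X => f y.2)
      (hf.comp_measurable measurable_snd).aestronglyMeasurable hpm.aemeasurable
    have h3 := setIntegral_map (μ := chainLaw κ ξ) hA (f := fun h => ∫ y, f y ∂η h)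
      hint.aestronglyMeasurable (by fun_prop : AEMeasurable (frestrictLe t) (chainLaw κ ξ))
    rw [map_frestrictLe_compProd_chainLaw, h2] at h1
    rw [← hρ] at h3
    rw [h3] at h1
    rw [Set.mk_preimage_prod, Set.preimage_univ, Set.inter_univ] at h1
    exact h1.symm
  · rw [piLE_eq_comap_frestrictLe]
    have hsm : StronglyMeasurable (fun h => ∫ y, f y ∂η h) := StronglyMeasurable.integral_kernel hf
    exact (hsm.comp_measurable (comap_measurable _)).aestronglyMeasurable

/-- The Markov property. -/
lemma condExp_chainLaw {f : X → F} (hf : StronglyMeasurable f)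
    (hfκ : ∀ s x, Integrable f ((κ ^ s) x))
    (hfi : ∀ t, Integrable (fun ω => f (ω t)) (chainLaw κ ξ)) (t s : ℕ) :
    (chainLaw κ ξ)[fun ω => f (ω (t + s))|piLE t] =ᵐ[chainLaw κ ξ]
      fun ω => ∫ y, f y ∂(κ ^ s) (ω t) := by
  induction s generalizing t with
  | zero =>
    have h1 : (chainLaw κ ξ)[fun ω => f (ω (t + 0))|piLE t] = fun ω => f (ω (t + 0)) := by
      refine condExp_of_stronglyMeasurable (piLE.le t) ?_ (hfi _)
      rw [piLE_eq_comap_frestrictLe]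
      exact (hf.comp_measurable (measurable_lastPoint t)).comp_measurable (comap_measurable _)
    rw [h1]
    refine ae_of_all _ fun ω => ?_
    have h2 : (κ ^ 0) (ω t) = Measure.dirac (ω t) := by
      rw [pow_zero]; exact Kernel.id_apply _
    simp only [h2, add_zero]
    exact (integral_dirac' _ _ hf).symm
  | succ s ih =>
    have h1 := ih (t + 1)
    have h2 : (fun ω : ℕ → X => f (ω (t + (s + 1)))) = fun ω => f (ω (t + 1 + s)) := by
      ext ω; congr 2; ring
    have hg : StronglyMeasurable fun x => ∫ y, f y ∂(κ ^ s) x := stronglyMeasurable_integral_pow hf s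
    have hgi : Integrable (fun ω : ℕ → X => ∫ y, f y ∂(κ ^ s) (ω (t + 1))) (chainLaw κ ξ) :=
      integrable_condExp.congr h1
    have h3 := condExp_chainLaw_succ κ ξ hg t hgi
    have h4 := condExp_condExp_of_le (μ := chainLaw κ ξ)
      (f := fun ω : ℕ → X => f (ω (t + 1 + s))) ((piLE (X := fun _ : ℕ => X)).mono (Nat.le_succ t))
      (piLE.le (t + 1))
    rw [h2]
    refine h4.symm.trans ((condExp_congr_ae h1).trans (h3.trans (ae_of_all _ fun ω => ?_)))
    exact (integral_pow_succ s (ω t) (hfκ _ _)).symm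

end Chain

/-! ### Time reversal of the stationary noise chain. -/

section Reversal

open Preorder

variable {Z : Type*}

/-- Prepending a point to a path. -/
def consPath (y : (ℕ → Z) × Z) : ℕ → Z
  | 0 => y.2
  | k + 1 => y.1 k

/-- Prepending a point to a finite path. -/
def consFinPath (a : ℕ) (y : ((i : Finset.Iic a) → Z) × Z) : (i : Finset.Iic (a + 1)) → Z :=
  fun i => if h : (i : ℕ) = 0 then y.2
    else y.1 ⟨i - 1, Finset.mem_Iic.2 (by have := Finset.mem_Iic.1 i.2; omega)⟩

lemma frestrictLe_consPath (a : ℕ) (y : (ℕ → Z) × Z) :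
    frestrictLe (π := fun _ : ℕ => Z) (a + 1) (consPath y)
      = consFinPath a (frestrictLe a y.1, y.2) := by
  ext i
  obtain ⟨i, hi⟩ := i
  cases i with
  | zero => rfl
  | succ i => rfl

variable [MeasurableSpace Z]

lemma measurable_consPath : Measurable (consPath (Z := Z)) := by
  refine measurable_pi_iff.2 fun k => ?_
  cases k with
  | zero => exact measurable_snd
  | succ k => exact (measurable_pi_apply k).comp measurable_fst

lemma measurable_consFinPath (a : ℕ) : Measurable (consFinPath (Z := Z) a) := by
  refine measurable_pi_iff.2 fun i => ?_
  unfold consFinPath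
  split_ifs <;> fun_prop

lemma lintegral_invariant {Q : Kernel Z Z} {π : Measure Z} (hπ : Kernel.Invariant Q π) {f : Z → ℝ≥0∞} (hf : Measurable f) :
    ∫⁻ x, ∫⁻ y, f y ∂Q x ∂π = ∫⁻ x, f x ∂π := by
  conv_rhs => rw [← hπ.def]
  rw [Measure.lintegral_bind (Kernel.aemeasurable _) hf.aemeasurable]

variable [StandardBorelSpace Z] [Nonempty Z] {Q : Kernel Z Z} [IsMarkovKernel Q]
  {π : Measure Z} [IsProbabilityMeasure π]

/-- This is Bayes' rule: `posterior Q π` is the backward transition kernel of the stationary chain.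
-/
lemma lintegral_posterior_swap (hπ : Kernel.Invariant Q π) {f : Z × Z → ℝ≥0∞}
    (hf : Measurable f) :
    ∫⁻ x, ∫⁻ y, f (x, y) ∂(posterior Q π) x ∂π = ∫⁻ x, ∫⁻ y, f (y, x) ∂Q x ∂π := by
  have h' : Q ∘ₘ π = π := hπ
  have h1 := compProd_posterior_eq_map_swap (κ := Q) (μ := π)
  rw [h'] at h1
  rw [← Measure.lintegral_compProd hf, h1, lintegral_map hf measurable_swap]
  exact Measure.lintegral_compProd (hf.comp measurable_swap)

/-- Prepending a forward step to the time-reversed stationary chain does not change its law. -/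
lemma map_consPath_reversed (hπ : Kernel.Invariant Q π) :
    (chainLaw (posterior Q π) π ⊗ₘ Q.comap (fun ω : ℕ → Z => ω 0) (measurable_pi_apply 0)).map
      consPath = chainLaw (posterior Q π) π := by
  set ρ := chainLaw (posterior Q π) π with hρ
  set Q0 := Q.comap (fun ω : ℕ → Z => ω 0) (measurable_pi_apply 0) with hQ0
  have hlaw0 : ∀ {g : Z → ℝ≥0∞} (_ : Measurable g),
      ∫⁻ ω, g (ω 0) ∂ρ = ∫⁻ x, g x ∂π := by
    intro g hg
    conv_rhs => rw [← map_zero_chainLaw (posterior Q π) π]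
    rw [lintegral_map hg (measurable_pi_apply 0)]
  have hconv : ∀ {g : (ℕ → Z) → ℝ≥0∞}, Measurable g → ∫⁻ ω, g ω ∂((ρ ⊗ₘ Q0).map consPath)
      = ∫⁻ ω, ∫⁻ z', g (consPath (ω, z')) ∂Q (ω 0) ∂ρ := by
    intro g hg
    rw [lintegral_map hg measurable_consPath]
    exact Measure.lintegral_compProd (hg.comp measurable_consPath)
  refine eq_chainLaw _ _ ?_ fun a => ?_
  · refine Measure.ext_of_lintegral _ fun f hf => ?_
    rw [lintegral_map hf (measurable_pi_apply 0)]
    refine (hconv (hf.comp (measurable_pi_apply 0))).trans ?_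
    exact (hlaw0 hf.lintegral_kernel).trans (lintegral_invariant hπ hf)
  · refine Measure.ext_of_lintegral _ fun f hf => ?_
    have hm1 : Measurable fun ω : ℕ → Z => (frestrictLe (π := fun _ : ℕ => Z) a ω, ω (a + 1)) := by
      fun_prop
    have hL : Measurable fun h : (i : Finset.Iic a) → Z =>
        ∫⁻ w, f (h, w) ∂(posterior Q π) (lastPoint a h) :=
      Measurable.lintegral_kernel_prod_right'
        (κ := (posterior Q π).comap (lastPoint a) (measurable_lastPoint a)) hf
    rw [Measure.lintegral_compProd hf]
    refine (lintegral_map hL (by fun_prop)).trans ?_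
    refine (hconv (hL.comp (by fun_prop : Measurable (frestrictLe a)))).trans ?_
    refine Eq.trans ?_ ((lintegral_map hf hm1).trans (hconv (hf.comp hm1))).symm
    cases a with
    | zero =>
      -- The first transition of the extended path goes from the new point to the old head; it is a
      -- backward transition by Bayes' rule and stationarity.
      let u : Z → (i : Finset.Iic 0) → Z := fun x _ => x
      have hu : Measurable u := by fun_prop
      have hfr : ∀ y : (ℕ → Z) × Z, frestrictLe (π := fun _ : ℕ => Z) 0 (consPath y) = u y.2 := by
        intro y; ext i
        obtain ⟨i, hi⟩ := i
        obtain rfl : i = 0 := Nat.le_zero.1 (Finset.mem_Iic.1 hi)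
        rfl
      have hg : Measurable fun x => ∫⁻ w, f (u x, w) ∂(posterior Q π) x :=
        Measurable.lintegral_kernel_prod_right' (κ := posterior Q π)
          (f := fun y : Z × Z => f (u y.1, y.2)) (hf.comp (by fun_prop))
      have hg2 : Measurable fun x => ∫⁻ w, f (u w, x) ∂Q x :=
        Measurable.lintegral_kernel_prod_right' (κ := Q)
          (f := fun y : Z × Z => f (u y.2, y.1)) (hf.comp (by fun_prop))
      have h1 : ∫⁻ ω, ∫⁻ z', ∫⁻ w, f (u z', w) ∂(posterior Q π) z' ∂Q (ω 0) ∂ρ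
          = ∫⁻ ω, ∫⁻ z', f (u z', ω 0) ∂Q (ω 0) ∂ρ := by
        rw [hlaw0 (g := fun x => ∫⁻ z', ∫⁻ w, f (u z', w) ∂(posterior Q π) z' ∂Q x)
          hg.lintegral_kernel, hlaw0 (g := fun x => ∫⁻ z', f (u z', x) ∂Q x) hg2,
          lintegral_invariant hπ hg,
          lintegral_posterior_swap hπ (f := fun y => f (u y.1, y.2)) (hf.comp (by fun_prop))]
      simp only [Function.comp_def, hfr]
      exact h1
    | succ b =>
      -- Later transitions do not see the prepended point: given the path up to `b`, the new head
      -- depends on its head only and the next point on its last entry, so the two draws commute by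
      -- Fubini.
      let K : ((i : Finset.Iic b) → Z) × Z → ℝ≥0∞ := fun y =>
        ∫⁻ z', f (consFinPath b (y.1, z'), y.2) ∂Q (y.1 ⟨0, Finset.mem_Iic.2 (Nat.zero_le _)⟩)
      have hHm : Measurable fun y : (((i : Finset.Iic b) → Z) × Z) × Z =>
          f (consFinPath b (y.1.1, y.2), y.1.2) :=
        hf.comp (((measurable_consFinPath b).comp (by fun_prop)).prodMk (by fun_prop))
      have hK : Measurable K :=
        Measurable.lintegral_kernel_prod_right'
          (κ := Q.comap (fun y : ((i : Finset.Iic b) → Z) × Z =>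
            y.1 ⟨0, Finset.mem_Iic.2 (Nat.zero_le _)⟩) (by fun_prop)) hHm
      have hKL : Measurable fun h : (i : Finset.Iic b) → Z =>
          ∫⁻ w, K (h, w) ∂(posterior Q π) (lastPoint b h) :=
        Measurable.lintegral_kernel_prod_right'
          (κ := (posterior Q π).comap (lastPoint b) (measurable_lastPoint b)) hK
      have h1 := map_frestrictLe_compProd_chainLaw (posterior Q π) π b
      have h2 : ∫⁻ ω, K (frestrictLe b ω, ω (b + 1)) ∂ρ
          = ∫⁻ ω, ∫⁻ w, K (frestrictLe b ω, w) ∂(posterior Q π) (ω b) ∂ρ := by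
        rw [← lintegral_map hK (by fun_prop), ← h1, Measure.lintegral_compProd hK,
          lintegral_map (by exact hKL) (by fun_prop)]
        rfl
      have h3 : ∀ ω : ℕ → Z, ∫⁻ w, K (frestrictLe b ω, w) ∂(posterior Q π) (ω b)
          = ∫⁻ z', ∫⁻ w, f (consFinPath b (frestrictLe b ω, z'), w) ∂(posterior Q π) (ω b)
            ∂Q (ω 0) := by
        intro ω
        refine lintegral_lintegral_swap (μ := (posterior Q π) (ω b)) (ν := Q (ω 0)) (f := fun w z' =>
          f (consFinPath b (frestrictLe b ω, z'), w)) ?_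
        exact (hf.comp (((measurable_consFinPath b).comp (by fun_prop)).prodMk
          (by fun_prop))).aemeasurable
      simp only [h3] at h2
      simp only [Function.comp_def, frestrictLe_consPath]
      exact h2.symm

/-- Splitting off the head undoes `consPath`. Hence the head, given the older path, is one forward
step of `Q`; this avoids a two-sided chain. -/
lemma map_shift_reversed (hπ : Kernel.Invariant Q π) :
    (chainLaw (posterior Q π) π).map (fun ω => (fun k => ω (k + 1), ω 0))
      = chainLaw (posterior Q π) π ⊗ₘ
        Q.comap (fun ω : ℕ → Z => ω 0) (measurable_pi_apply 0) := by
  conv_lhs => rw [← map_consPath_reversed hπ]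
  rw [Measure.map_map (by fun_prop) measurable_consPath]
  exact Measure.map_id

end Reversal

/-! ### The joint kernel: existence of an invariant law. -/

namespace LSA

variable {d : ℕ} {Z : Type*} [MeasurableSpace Z] (S : LSA d Z)

/-- The matrix `I - α Ā` as a continuous linear map. -/
noncomputable def contraction (α : ℝ) : EuclideanSpace ℝ (Fin d) →L[ℝ] EuclideanSpace ℝ (Fin d) :=
  Matrix.toEuclideanCLM (n := Fin d) (𝕜 := ℝ) (1 - α • S.Abar)

lemma stepJ_eq (α : ℝ) (y : EuclideanSpace ℝ (Fin d) × Z) :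
    S.stepJ α y = S.contraction α y.1 - α • S.eps y.2 := rfl

variable (Q : Kernel Z Z) [IsMarkovKernel Q] (α : ℝ)

lemma kernelJ_apply (y : EuclideanSpace ℝ (Fin d) × Z) :
    S.kernelJ Q α y = (Q y.2).map (Prod.mk (S.stepJ α y)) := by
  rw [kernelJ, Kernel.prod_apply, Kernel.deterministic_apply, Kernel.comap_apply,
    Measure.dirac_prod]

lemma lintegral_kernelJ (y : EuclideanSpace ℝ (Fin d) × Z)
    {f : EuclideanSpace ℝ (Fin d) × Z → ℝ≥0∞} (hf : Measurable f) :
    ∫⁻ w, f w ∂S.kernelJ Q α y = ∫⁻ z, f (S.stepJ α y, z) ∂Q y.2 := by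
  rw [kernelJ_apply, lintegral_map hf measurable_prodMk_left]

lemma integral_kernelJ {F : Type*} [NormedAddCommGroup F] [NormedSpace ℝ F]
    (y : EuclideanSpace ℝ (Fin d) × Z)
    {f : EuclideanSpace ℝ (Fin d) × Z → F} (hf : StronglyMeasurable f) :
    ∫ w, f w ∂S.kernelJ Q α y = ∫ z, f (S.stepJ α y, z) ∂Q y.2 := by
  rw [kernelJ_apply, integral_map measurable_prodMk_left.aemeasurable hf.aestronglyMeasurable]

lemma invariant_map_snd {ν : Measure (EuclideanSpace ℝ (Fin d) × Z)}
    (hν : Kernel.Invariant (S.kernelJ Q α) ν) : Kernel.Invariant Q (ν.map Prod.snd) := by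
  refine Measure.ext_of_lintegral _ fun f hf => ?_
  rw [Measure.lintegral_bind (Kernel.aemeasurable _) hf.aemeasurable,
    lintegral_map hf.lintegral_kernel measurable_snd, lintegral_map hf measurable_snd,
    ← lintegral_invariant hν (f := fun y => f y.2) (hf.comp measurable_snd)]
  refine lintegral_congr fun y => ?_
  exact (S.lintegral_kernelJ Q α y (hf.comp measurable_snd)).symm

variable {Q α} {π : Measure Z} [IsProbabilityMeasure π] {m : ℕ}

section Existence

/-- The stationary solution of the recursion, driven by a path read backwards in time. -/
noncomputable def backwardSum (α : ℝ) (ω : ℕ → Z) : EuclideanSpace ℝ (Fin d) :=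
  -(α • ∑' k, (S.contraction α ^ k) (S.eps (ω k)))

lemma norm_eps_le (hε : BddAbove (Set.range fun z => ‖S.eps z‖)) (z : Z) :
    ‖S.eps z‖ ≤ S.epsSup := le_ciSup hε z

lemma summable_backward (hG : Summable fun k => ‖S.contraction α ^ k‖)
    (hε : BddAbove (Set.range fun z => ‖S.eps z‖)) (ω : ℕ → Z) :
    Summable fun k => (S.contraction α ^ k) (S.eps (ω k)) := by
  refine Summable.of_norm_bounded (hG.mul_right S.epsSup) fun k => ?_
  refine ((S.contraction α ^ k).le_opNorm _).trans ?_
  gcongr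
  exact S.norm_eps_le hε _

lemma norm_backwardSum_le (hG : Summable fun k => ‖S.contraction α ^ k‖)
    (hε : BddAbove (Set.range fun z => ‖S.eps z‖)) (ω : ℕ → Z) :
    ‖S.backwardSum α ω‖ ≤ |α| * ((∑' k, ‖S.contraction α ^ k‖) * S.epsSup) := by
  rw [backwardSum, norm_neg, norm_smul, Real.norm_eq_abs]
  gcongr
  rw [← tsum_mul_right]
  refine tsum_of_norm_bounded (hG.mul_right S.epsSup).hasSum fun k => ?_
  refine ((S.contraction α ^ k).le_opNorm _).trans ?_
  gcongr
  exact S.norm_eps_le hε _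

lemma measurable_backwardSum (hG : Summable fun k => ‖S.contraction α ^ k‖)
    (hε : BddAbove (Set.range fun z => ‖S.eps z‖)) : Measurable (S.backwardSum (Z := Z) α) := by
  have h1 : Measurable fun ω : ℕ → Z => ∑' k, (S.contraction α ^ k) (S.eps (ω k)) := by
    refine measurable_of_tendsto_metrizable
      (f := fun n (ω : ℕ → Z) => ∑ k ∈ Finset.range n, (S.contraction α ^ k) (S.eps (ω k)))
      (fun n => Finset.measurable_sum _ fun k _ => ?_) ?_
    · exact (S.contraction α ^ k).continuous.measurable.comp
        (S.measurable_eps.comp (measurable_pi_apply k))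
    · exact tendsto_pi_nhds.2 fun ω => (S.summable_backward hG hε ω).hasSum.tendsto_sum_nat
  exact (h1.const_smul α).neg

/-- Splitting off the term `k = 0` of the series is one step of the recursion, with the head of the
path as the newest noise. -/
lemma stepJ_backwardSum (hG : Summable fun k => ‖S.contraction α ^ k‖)
    (hε : BddAbove (Set.range fun z => ‖S.eps z‖)) (ω : ℕ → Z) :
    S.stepJ α (S.backwardSum α (fun k => ω (k + 1)), ω 0) = S.backwardSum α ω := by
  rw [stepJ_eq]
  simp only [backwardSum]
  rw [(S.summable_backward hG hε ω).tsum_eq_zero_add, map_neg, map_smul,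
    (S.contraction α).map_tsum (S.summable_backward hG hε _)]
  simp only [pow_zero, pow_succ', mul_apply_eq_comp, smul_add, neg_add_rev,
    one_apply_eq_self, sub_eq_add_neg]

/-- The law is that of the pair formed by the series over the tail of the reversed path and its
head. One step produces the series over the whole path and a fresh draw from `Q`, which has the same
law by `map_shift_reversed`. The almost sure bound on `J` makes `ψ` integrable and all moments of
`J` finite. -/
lemma exists_invariant_kernelJ [StandardBorelSpace Z] [Nonempty Z]
    (hG : Summable fun k => ‖S.contraction α ^ k‖)
    (hε : BddAbove (Set.range fun z => ‖S.eps z‖))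
    (hπ : Kernel.Invariant Q π) :
    ∃ ν : Measure (EuclideanSpace ℝ (Fin d) × Z), IsProbabilityMeasure ν ∧
      Kernel.Invariant (S.kernelJ Q α) ν ∧ ∃ C, ∀ᵐ y ∂ν, ‖y.1‖ ≤ C := by
  set ρ := chainLaw (posterior Q π) π
  have hF := S.measurable_backwardSum hG hε
  let Φ : (ℕ → Z) → EuclideanSpace ℝ (Fin d) × Z := fun ω =>
    (S.backwardSum α (fun k => ω (k + 1)), ω 0)
  have hΦ : Measurable Φ := (hF.comp (by fun_prop)).prodMk (by fun_prop)
  refine ⟨ρ.map Φ, Measure.isProbabilityMeasure_map hΦ.aemeasurable, ?_,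
    |α| * ((∑' k, ‖S.contraction α ^ k‖) * S.epsSup), ?_⟩
  · refine Measure.ext_of_lintegral _ fun f hf => ?_
    have hf' : Measurable fun y : (ℕ → Z) × Z => f (S.backwardSum α y.1, y.2) :=
      hf.comp ((hF.comp measurable_fst).prodMk measurable_snd)
    rw [Measure.lintegral_bind (Kernel.aemeasurable _) hf.aemeasurable,
      lintegral_map hf.lintegral_kernel hΦ, lintegral_map hf hΦ]
    have h1 : ∀ ω : ℕ → Z, ∫⁻ y, f y ∂S.kernelJ Q α (Φ ω)
        = ∫⁻ z, f (S.backwardSum α ω, z) ∂Q (ω 0) := fun ω => by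
      rw [S.lintegral_kernelJ Q α _ hf, S.stepJ_backwardSum hG hε]
    simp only [h1]
    have h2 := Measure.lintegral_compProd (μ := ρ)
      (κ := Q.comap (fun ω : ℕ → Z => ω 0) (measurable_pi_apply 0)) hf'
    refine h2.symm.trans ?_
    rw [← map_shift_reversed hπ, lintegral_map hf' (by fun_prop)]
  · rw [ae_map_iff hΦ.aemeasurable (measurableSet_le measurable_fst.norm measurable_const)]
    exact ae_of_all _ fun ω => S.norm_backwardSum_le hG hε _

end Existence

/-! ### Uniqueness of the joint invariant law. -/

section Uniqueness

/-- Synchronous coupling: started from the same `z`, both chains use the same noise, so `ε` cancels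
and the difference evolves by the deterministic contraction. -/
lemma norm_integral_kernelJ_pow_sub_le {F : Type*} [NormedAddCommGroup F] [NormedSpace ℝ F]
    [CompleteSpace F]
    {f : EuclideanSpace ℝ (Fin d) × Z → F} (hf : StronglyMeasurable f) {C : ℝ}
    (hC : ∀ y, ‖f y‖ ≤ C) {L : ℝ} (hL : ∀ J J' z, ‖f (J, z) - f (J', z)‖ ≤ L * ‖J - J'‖)
    (t : ℕ) (J J' : EuclideanSpace ℝ (Fin d)) (z : Z) :
    ‖∫ y, f y ∂(S.kernelJ Q α ^ t) (J, z) - ∫ y, f y ∂(S.kernelJ Q α ^ t) (J', z)‖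
      ≤ L * ‖(S.contraction α ^ t) (J - J')‖ := by
  have hfi : ∀ (μ : Measure (EuclideanSpace ℝ (Fin d) × Z)) [IsProbabilityMeasure μ],
      Integrable f μ := fun μ _ => Integrable.of_bound hf.aestronglyMeasurable C (ae_of_all _ hC)
  induction t generalizing J J' z with
  | zero =>
    have h : ∀ y, (S.kernelJ Q α ^ 0) y = Measure.dirac y := fun y => by
      rw [pow_zero]; exact Kernel.id_apply _
    rw [h, h, integral_dirac' _ _ hf, integral_dirac' _ _ hf]
    simpa using hL J J' z
  | succ t ih =>
    have hg := stronglyMeasurable_integral_pow (κ := S.kernelJ Q α) hf t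
    have hb : ∀ y, ‖∫ w, f w ∂(S.kernelJ Q α ^ t) y‖ ≤ C := fun y => by
      simpa using norm_integral_le_of_norm_le_const (μ := (S.kernelJ Q α ^ t) y) (ae_of_all _ hC)
    have hgi : ∀ J : EuclideanSpace ℝ (Fin d),
        Integrable (fun z' => ∫ w, f w ∂(S.kernelJ Q α ^ t) (J, z')) (Q z) := fun J =>
      Integrable.of_bound (hg.comp_measurable measurable_prodMk_left).aestronglyMeasurable C
        (ae_of_all _ fun z' => hb _)
    rw [integral_pow_succ t _ (hfi _), integral_pow_succ t _ (hfi _), S.integral_kernelJ Q α _ hg,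
      S.integral_kernelJ Q α _ hg, ← integral_sub (hgi _) (hgi _)]
    have hstep : S.stepJ α (J, z) - S.stepJ α (J', z) = S.contraction α (J - J') := by
      simp only [stepJ_eq, map_sub]; abel
    have h := norm_integral_le_of_norm_le_const (μ := Q z) (ae_of_all _ fun z' =>
      ih (S.stepJ α (J, z)) (S.stepJ α (J', z)) z')
    rw [hstep] at h
    rw [pow_succ]
    simpa using h

/-- Both laws have second marginal `π`. Replacing `J` by `0` at the start is forgotten in the limit,
so either integral is the limit of the same sequence, which depends on `π` alone. -/
lemma integral_eq_of_invariant_kernelJ (hQ : UniformlyErgodic Q π m)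
    (hG : Filter.Tendsto (fun k => ‖S.contraction α ^ k‖) Filter.atTop (nhds 0))
    {ν ν' : Measure (EuclideanSpace ℝ (Fin d) × Z)} [IsProbabilityMeasure ν]
    [IsProbabilityMeasure ν'] (hν : Kernel.Invariant (S.kernelJ Q α) ν)
    (hν' : Kernel.Invariant (S.kernelJ Q α) ν')
    {F : Type*} [NormedAddCommGroup F] [NormedSpace ℝ F] [CompleteSpace F]
    {f : EuclideanSpace ℝ (Fin d) × Z → F} (hf : StronglyMeasurable f) {C : ℝ}
    (hC : ∀ y, ‖f y‖ ≤ C) {L : ℝ} (hL : ∀ J J' z, ‖f (J, z) - f (J', z)‖ ≤ L * ‖J - J'‖) :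
    ∫ y, f y ∂ν = ∫ y, f y ∂ν' := by
  set u : ℕ → EuclideanSpace ℝ (Fin d) × Z → F := fun t y => ∫ w, f w ∂(S.kernelJ Q α ^ t) y
    with hu
  have hum : ∀ t, StronglyMeasurable (u t) := fun t => stronglyMeasurable_integral_pow hf t
  have hub : ∀ t y, ‖u t y‖ ≤ C := fun t y => by
    simpa using norm_integral_le_of_norm_le_const (μ := (S.kernelJ Q α ^ t) y) (ae_of_all _ hC)
  have hu0m : ∀ t, StronglyMeasurable fun y : EuclideanSpace ℝ (Fin d) × Z => u t (0, y.2) :=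
    fun t => (hum t).comp_measurable (measurable_const.prodMk measurable_snd)
  have key : ∀ (ν : Measure (EuclideanSpace ℝ (Fin d) × Z)) [IsProbabilityMeasure ν],
      Kernel.Invariant (S.kernelJ Q α) ν →
      Filter.Tendsto (fun t => ∫ z, u t (0, z) ∂π) Filter.atTop (nhds (∫ y, f y ∂ν)) := by
    intro ν _ hν
    have hmarg : ν.map Prod.snd = π := by
      have : IsProbabilityMeasure (ν.map Prod.snd) :=
        Measure.isProbabilityMeasure_map measurable_snd.aemeasurable
      exact hQ.eq_of_invariant (S.invariant_map_snd Q α hν)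
    have hfi : Integrable f ν := Integrable.of_bound hf.aestronglyMeasurable C (ae_of_all _ hC)
    have h1 : ∀ t, ∫ z, u t (0, z) ∂π = ∫ y, f y ∂ν + ∫ y, (u t (0, y.2) - u t y) ∂ν := fun t => by
      have hi1 : Integrable (fun y : EuclideanSpace ℝ (Fin d) × Z => u t (0, y.2)) ν :=
        Integrable.of_bound (hu0m t).aestronglyMeasurable C (ae_of_all _ fun y => hub t _)
      have hi2 : Integrable (u t) ν :=
        Integrable.of_bound (hum t).aestronglyMeasurable C (ae_of_all _ fun y => hub t _)
      have h4 : ∫ y, u t y ∂ν = ∫ y, f y ∂ν := integral_invariant (invariant_pow hν t) hfi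
      have h5 := integral_map (μ := ν) measurable_snd.aemeasurable (f := fun z => u t (0, z))
        ((hum t).comp_measurable measurable_prodMk_left).aestronglyMeasurable
      rw [integral_sub hi1 hi2, h4, ← hmarg, h5]
      abel
    have h2 : Filter.Tendsto (fun t => ∫ y, (u t (0, y.2) - u t y) ∂ν) Filter.atTop
        (nhds (∫ _, (0 : F) ∂ν)) := by
      -- Dominated convergence by the bound on `f` requires no moment of `J` under the invariant
      -- law, so uniqueness holds among all probability measures.
      refine tendsto_integral_of_dominated_convergence (fun _ => C + C)
        (fun t => ((hu0m t).sub (hum t)).aestronglyMeasurable) (integrable_const _)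
        (fun t => ae_of_all _ fun y => (norm_sub_le _ _).trans (add_le_add (hub _ _) (hub _ _)))
        (ae_of_all _ fun y => ?_)
      have h3 : Filter.Tendsto (fun t => |L| * (‖S.contraction α ^ t‖ * ‖0 - y.1‖)) Filter.atTop
          (nhds (|L| * (0 * ‖0 - y.1‖))) := (hG.mul_const _).const_mul _
      rw [zero_mul, mul_zero] at h3
      refine squeeze_zero_norm (fun t => ?_) h3
      refine (S.norm_integral_kernelJ_pow_sub_le hf hC hL t 0 y.1 y.2).trans ?_
      gcongr
      · exact le_abs_self L
      · exact (S.contraction α ^ t).le_opNorm _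
    simp only [h1]
    simpa using h2.const_add (∫ y, f y ∂ν)
  exact tendsto_nhds_unique (key ν hν) (key ν' hν')

/-- The test functions `1_B(z) exp(i⟨J, v⟩)` are bounded and Lipschitz in `J`. They give the
characteristic functions of the first coordinate restricted to `z ∈ B`, hence the values on
rectangles. -/
lemma eq_of_invariant_kernelJ (hQ : UniformlyErgodic Q π m)
    (hG : Filter.Tendsto (fun k => ‖S.contraction α ^ k‖) Filter.atTop (nhds 0))
    {ν ν' : Measure (EuclideanSpace ℝ (Fin d) × Z)} [IsProbabilityMeasure ν]
    [IsProbabilityMeasure ν'] (hν : Kernel.Invariant (S.kernelJ Q α) ν)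
    (hν' : Kernel.Invariant (S.kernelJ Q α) ν') : ν = ν' := by
  refine Measure.ext_prod fun {s B} hs hB => ?_
  have hfin : ∀ (μ : Measure (EuclideanSpace ℝ (Fin d) × Z)) [IsProbabilityMeasure μ],
      IsFiniteMeasure ((μ.restrict (Prod.snd ⁻¹' B)).map Prod.fst) := fun μ _ => inferInstance
  have hval : ∀ (μ : Measure (EuclideanSpace ℝ (Fin d) × Z)),
      μ (s ×ˢ B) = ((μ.restrict (Prod.snd ⁻¹' B)).map Prod.fst) s := fun μ => by
    rw [Measure.map_apply measurable_fst hs, Measure.restrict_apply (measurable_fst hs)]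
    rfl
  rw [hval, hval]
  congr 1
  have := hfin ν
  have := hfin ν'
  refine Measure.ext_of_charFun ?_
  ext v
  let e : EuclideanSpace ℝ (Fin d) → ℂ := fun x => Complex.exp (inner ℝ x v * Complex.I)
  have hec : Continuous e := by fun_prop
  let f : EuclideanSpace ℝ (Fin d) × Z → ℂ := (Prod.snd ⁻¹' B).indicator fun y => e y.1
  have hf : StronglyMeasurable f :=
    (hec.stronglyMeasurable.comp_measurable measurable_fst).indicator (measurable_snd hB)
  have hen : ∀ x, ‖e x‖ = 1 := fun x => Complex.norm_exp_ofReal_mul_I _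
  have hC : ∀ y, ‖f y‖ ≤ 1 := fun y => by
    simp only [f, Set.indicator]; split_ifs <;> simp [hen]
  have hL : ∀ J J' z, ‖f (J, z) - f (J', z)‖ ≤ ‖v‖ * ‖J - J'‖ := fun J J' z => by
    by_cases h : z ∈ B
    · have hf1 : ∀ x, f (x, z) = e x := fun x => Set.indicator_of_mem (s := Prod.snd ⁻¹' B) h _
      have h1 : e J - e J' = e J' * (Complex.exp (Complex.I * ((inner ℝ (J - J') v : ℝ) : ℂ)) - 1) := by
        simp only [e]
        rw [mul_sub, mul_one, ← Complex.exp_add, inner_sub_left]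
        congr 2; push_cast; ring
      rw [hf1, hf1, h1, norm_mul, hen, one_mul]
      refine Real.norm_exp_I_mul_ofReal_sub_one_le.trans ?_
      rw [mul_comm]; exact norm_inner_le_norm _ _
    · have hf0 : ∀ x, f (x, z) = 0 := fun x =>
        Set.indicator_of_notMem (s := Prod.snd ⁻¹' B) h _
      rw [hf0, hf0, sub_self, norm_zero]; positivity
  have hmain := S.integral_eq_of_invariant_kernelJ hQ hG hν hν' hf hC hL
  have hcf : ∀ (μ : Measure (EuclideanSpace ℝ (Fin d) × Z)),
      charFun ((μ.restrict (Prod.snd ⁻¹' B)).map Prod.fst) v = ∫ y, f y ∂μ := fun μ => by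
    rw [charFun_apply, integral_map measurable_fst.aemeasurable hec.aestronglyMeasurable,
      integral_indicator (measurable_snd hB)]
  rw [hcf, hcf, hmain]

end Uniqueness

end LSA

/-! ### The Lyapunov norm and contraction of `I - αĀ`. -/

section QuadraticForm

variable {d : ℕ} {M P : Matrix (Fin d) (Fin d) ℝ}

lemma act_add (M N : Matrix (Fin d) (Fin d) ℝ) (x : EuclideanSpace ℝ (Fin d)) :
    act (M + N) x = act M x + act N x := by
  simp [act]

lemma act_mul (M N : Matrix (Fin d) (Fin d) ℝ) (x : EuclideanSpace ℝ (Fin d)) :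
    act (M * N) x = act M (act N x) := by
  simp [act]

lemma act_one (x : EuclideanSpace ℝ (Fin d)) : act 1 x = x := by
  simp [act]

lemma norm_act_le (M : Matrix (Fin d) (Fin d) ℝ) (x : EuclideanSpace ℝ (Fin d)) :
    ‖act M x‖ ≤ opNorm M * ‖x‖ := ContinuousLinearMap.le_opNorm _ _

lemma inner_act_left (M : Matrix (Fin d) (Fin d) ℝ) (x y : EuclideanSpace ℝ (Fin d)) :
    inner ℝ (act M x) y = inner ℝ x (act Mᵀ y) := by
  have h : Matrix.toEuclideanCLM (n := Fin d) (𝕜 := ℝ) Mᵀ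
      = ContinuousLinearMap.adjoint (Matrix.toEuclideanCLM (n := Fin d) (𝕜 := ℝ) M) := by
    rw [← ContinuousLinearMap.star_eq_adjoint, ← map_star, Matrix.star_eq_conjTranspose,
      Matrix.conjTranspose_eq_transpose_of_trivial]
  rw [act, act, h, ContinuousLinearMap.adjoint_inner_right]

lemma inner_act_eq_sum_eigenvalues (hP : P.IsHermitian) (x : EuclideanSpace ℝ (Fin d)) :
    inner ℝ x (act P x)
      = ∑ i, hP.eigenvalues i * (inner ℝ (hP.eigenvectorBasis i) x) ^ 2 := by
  rw [← hP.eigenvectorBasis.sum_inner_mul_inner]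
  refine Finset.sum_congr rfl fun i _ => ?_
  have h1 : inner ℝ (hP.eigenvectorBasis i) (act P x)
      = hP.eigenvalues i * inner ℝ (hP.eigenvectorBasis i) x := by
    have h2 := inner_act_left P (hP.eigenvectorBasis i) x
    have hT : Pᵀ = P := by
      have := hP.eq; rwa [Matrix.conjTranspose_eq_transpose_of_trivial] at this
    rw [hT] at h2
    rw [← h2]
    have h3 : act P (hP.eigenvectorBasis i) = hP.eigenvalues i • hP.eigenvectorBasis i := by
      ext j
      have := congrFun (hP.mulVec_eigenvectorBasis i) j
      simpa [act] using this
    rw [h3, inner_smul_left]; simp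
  rw [h1, real_inner_comm]; ring

lemma sum_sq_inner_eigenvectorBasis (hP : P.IsHermitian) (x : EuclideanSpace ℝ (Fin d)) :
    ∑ i, (inner ℝ (hP.eigenvectorBasis i) x) ^ 2 = ‖x‖ ^ 2 := by
  have := hP.eigenvectorBasis.sum_sq_norm_inner_right x
  simpa using this

lemma inner_act_le_sSup_spectrum (hP : P.IsHermitian) (x : EuclideanSpace ℝ (Fin d)) :
    inner ℝ x (act P x) ≤ sSup (spectrum ℝ P) * ‖x‖ ^ 2 := by
  rw [inner_act_eq_sum_eigenvalues hP, ← sum_sq_inner_eigenvectorBasis hP, Finset.mul_sum]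
  refine Finset.sum_le_sum fun i _ => ?_
  gcongr
  rw [hP.spectrum_real_eq_range_eigenvalues]
  exact le_csSup (Set.finite_range _).bddAbove (Set.mem_range_self i)

lemma sInf_spectrum_le_inner_act (hP : P.IsHermitian) (x : EuclideanSpace ℝ (Fin d)) :
    sInf (spectrum ℝ P) * ‖x‖ ^ 2 ≤ inner ℝ x (act P x) := by
  rw [inner_act_eq_sum_eigenvalues hP, ← sum_sq_inner_eigenvectorBasis hP, Finset.mul_sum]
  refine Finset.sum_le_sum fun i _ => ?_
  gcongr
  rw [hP.spectrum_real_eq_range_eigenvalues]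
  exact csInf_le (Set.finite_range _).bddBelow (Set.mem_range_self i)

lemma sInf_spectrum_pos (hd : 1 ≤ d) (hP : P.PosDef) : 0 < sInf (spectrum ℝ P) := by
  have : Nonempty (Fin d) := ⟨⟨0, hd⟩⟩
  rw [hP.1.spectrum_real_eq_range_eigenvalues]
  obtain ⟨i, hi⟩ := (Set.range_nonempty hP.1.eigenvalues).csInf_mem (Set.finite_range _)
  rw [← hi]
  exact hP.eigenvalues_pos i

lemma sInf_spectrum_le_sSup (hd : 1 ≤ d) (hP : P.PosDef) :
    sInf (spectrum ℝ P) ≤ sSup (spectrum ℝ P) := by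
  have : Nonempty (Fin d) := ⟨⟨0, hd⟩⟩
  rw [hP.1.spectrum_real_eq_range_eigenvalues]
  exact csInf_le_csSup (Set.range_nonempty _) (Set.finite_range _).bddBelow
    (Set.finite_range _).bddAbove

lemma inner_act_nonneg (hd : 1 ≤ d) (hP : P.PosDef) (x : EuclideanSpace ℝ (Fin d)) :
    0 ≤ inner ℝ x (act P x) :=
  (mul_nonneg (sInf_spectrum_pos hd hP).le (sq_nonneg _)).trans (sInf_spectrum_le_inner_act hP.1 x)

lemma inner_act_le_opNorm (P : Matrix (Fin d) (Fin d) ℝ) (x : EuclideanSpace ℝ (Fin d)) :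
    inner ℝ x (act P x) ≤ opNorm P * ‖x‖ ^ 2 := by
  refine (real_inner_le_norm _ _).trans ?_
  nlinarith [norm_act_le P x, norm_nonneg x]

lemma vecNorm_smul (P : Matrix (Fin d) (Fin d) ℝ) (c : ℝ) (x : EuclideanSpace ℝ (Fin d)) :
    vecNorm P (c • x) = |c| * vecNorm P x := by
  have h : act P (c • x) = c • act P x := map_smul _ _ _
  have h2 : inner ℝ (c • x) (act P (c • x)) = c ^ 2 * inner ℝ x (act P x) := by
    rw [h, inner_smul_left, inner_smul_right]; simp; ring
  rw [vecNorm, vecNorm, h2, Real.sqrt_mul (sq_nonneg c), Real.sqrt_sq_eq_abs]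

lemma vecNorm_act_le_opNormWrt (hd : 1 ≤ d) (hP : P.PosDef) (M : Matrix (Fin d) (Fin d) ℝ)
    (x : EuclideanSpace ℝ (Fin d)) : vecNorm P (act M x) ≤ opNormWrt P M * vecNorm P x := by
  have hmin := sInf_spectrum_pos hd hP
  have hmax := hmin.trans_le (sInf_spectrum_le_sSup hd hP)
  set lo := sInf (spectrum ℝ P)
  set hi := sSup (spectrum ℝ P)
  -- A supremum of an unbounded set would be zero by convention, so boundedness has to be shown
  -- before `opNormWrt` can be used.
  have hbdd : BddAbove {r : ℝ | ∃ x : EuclideanSpace ℝ (Fin d),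
      vecNorm P x = 1 ∧ r = vecNorm P (act M x)} := by
    refine ⟨Real.sqrt (hi * (opNorm M ^ 2 * lo⁻¹)), ?_⟩
    rintro r ⟨y, hy, rfl⟩
    refine Real.sqrt_le_sqrt ((inner_act_le_sSup_spectrum hP.1 _).trans ?_)
    gcongr
    have h1 : ‖y‖ ^ 2 ≤ lo⁻¹ := by
      have h2 := sInf_spectrum_le_inner_act hP.1 y
      rw [vecNorm, Real.sqrt_eq_one] at hy
      rw [hy] at h2
      rwa [← one_div, le_div_iff₀ hmin, mul_comm]
    calc ‖act M y‖ ^ 2 ≤ (opNorm M * ‖y‖) ^ 2 := by gcongr; exact norm_act_le M y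
      _ = opNorm M ^ 2 * ‖y‖ ^ 2 := by ring
      _ ≤ _ := by gcongr
  have h0 : 0 ≤ vecNorm P x := Real.sqrt_nonneg _
  rcases h0.eq_or_lt with h | h
  · have hx : x = 0 := by
      have h1 := sInf_spectrum_le_inner_act hP.1 x
      have h2 := (Real.sqrt_eq_zero (inner_act_nonneg hd hP x)).1 h.symm
      rw [h2] at h1
      have : ‖x‖ ^ 2 ≤ 0 := by nlinarith
      simpa using this
    have h3 : act M x = 0 := by rw [hx]; exact map_zero _
    rw [h3, ← h]
    simp [vecNorm]
  · have h1 : vecNorm P ((vecNorm P x)⁻¹ • x) = 1 := by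
      rw [vecNorm_smul, abs_of_pos (inv_pos.2 h), inv_mul_cancel₀ h.ne']
    have h2 := le_csSup hbdd ⟨_, h1, rfl⟩
    have h3 : act M ((vecNorm P x)⁻¹ • x) = (vecNorm P x)⁻¹ • act M x := map_smul _ _ _
    rw [h3, vecNorm_smul, abs_of_pos (inv_pos.2 h), inv_mul_le_iff₀ h] at h2
    rw [mul_comm]; exact h2

/-- One step of the recursion contracts the Lyapunov norm. -/
lemma inner_act_contraction_le (hd : 1 ≤ d) (hP : IsLyapunovSolution M P) {α : ℝ} (hα : 0 ≤ α)
    (hα' : α * opNormWrt P M ^ 2 ≤ 1 / 2 * (opNorm P)⁻¹) (hP0 : 0 < opNorm P)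
    (x : EuclideanSpace ℝ (Fin d)) :
    inner ℝ (act (1 - α • M) x) (act P (act (1 - α • M) x))
      ≤ (1 - α * ((opNorm P)⁻¹ / 2)) * inner ℝ x (act P x) := by
  have h1 : act (1 - α • M) x = x - α • act M x := by simp [act]
  have h2 : act P (x - α • act M x) = act P x - α • act P (act M x) := by simp [act]
  have h3 : inner ℝ (act M x) (act P x) + inner ℝ x (act P (act M x)) = ‖x‖ ^ 2 := by
    rw [inner_act_left, ← act_mul, ← act_mul, ← inner_add_right, ← act_add, hP.2, act_one,
      real_inner_self_eq_norm_sq]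
  have h4 : inner ℝ (act M x) (act P (act M x)) ≤ opNormWrt P M ^ 2 * inner ℝ x (act P x) := by
    have h5 := vecNorm_act_le_opNormWrt hd hP.1 M x
    have h6 : vecNorm P (act M x) ^ 2 ≤ (opNormWrt P M * vecNorm P x) ^ 2 := by
      have : 0 ≤ vecNorm P (act M x) := Real.sqrt_nonneg _
      gcongr
    rwa [mul_pow, vecNorm, vecNorm, Real.sq_sqrt (inner_act_nonneg hd hP.1 _),
      Real.sq_sqrt (inner_act_nonneg hd hP.1 _)] at h6
  have h7 : (opNorm P)⁻¹ * inner ℝ x (act P x) ≤ ‖x‖ ^ 2 := by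
    rw [inv_mul_le_iff₀ hP0]; exact inner_act_le_opNorm P x
  -- The Lyapunov equation turns the cross term into `-α‖x‖²`, which is at most `-α‖P‖⁻¹` times the
  -- form. The step size restriction lets the quadratic term give back at most half of it.
  have h8 : inner ℝ (act (1 - α • M) x) (act P (act (1 - α • M) x))
      = inner ℝ x (act P x) - α * ‖x‖ ^ 2 + α ^ 2 * inner ℝ (act M x) (act P (act M x)) := by
    rw [h1, h2, inner_sub_left, inner_sub_right, inner_sub_right, inner_smul_left,
      inner_smul_left, inner_smul_right, inner_smul_right, ← h3]
    simp only [conj_trivial]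
    ring
  rw [h8]
  have hV := inner_act_nonneg hd hP.1 x
  have h9 : α ^ 2 * inner ℝ (act M x) (act P (act M x))
      ≤ α * (1 / 2 * (opNorm P)⁻¹) * inner ℝ x (act P x) := by
    calc _ ≤ α ^ 2 * (opNormWrt P M ^ 2 * inner ℝ x (act P x)) := by gcongr
      _ = α * (α * opNormWrt P M ^ 2) * inner ℝ x (act P x) := by ring
      _ ≤ _ := by gcongr
  nlinarith [mul_le_mul_of_nonneg_left h7 hα]

lemma norm_act_pow_sq_le (hd : 1 ≤ d) (hP : IsLyapunovSolution M P) {α : ℝ} (hα : 0 ≤ α)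
    (hα' : α * opNormWrt P M ^ 2 ≤ 1 / 2 * (opNorm P)⁻¹) (hP0 : 0 < opNorm P)
    (h1 : α * ((opNorm P)⁻¹ / 2) ≤ 1) (k : ℕ) (x : EuclideanSpace ℝ (Fin d)) :
    ‖(Matrix.toEuclideanCLM (n := Fin d) (𝕜 := ℝ) (1 - α • M) ^ k) x‖ ^ 2
      ≤ sSup (spectrum ℝ P) / sInf (spectrum ℝ P) * (1 - α * ((opNorm P)⁻¹ / 2)) ^ k
        * ‖x‖ ^ 2 := by
  have hmin := sInf_spectrum_pos hd hP.1
  set T := Matrix.toEuclideanCLM (n := Fin d) (𝕜 := ℝ) (1 - α • M)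
  set r := 1 - α * ((opNorm P)⁻¹ / 2) with hr
  have hr0 : 0 ≤ r := by linarith
  have h2 : inner ℝ ((T ^ k) x) (act P ((T ^ k) x)) ≤ r ^ k * inner ℝ x (act P x) := by
    induction k with
    | zero => simp
    | succ k ih =>
      have h3 := inner_act_contraction_le hd hP hα hα' hP0 ((T ^ k) x)
      rw [pow_succ', pow_succ']
      calc _ ≤ r * inner ℝ ((T ^ k) x) (act P ((T ^ k) x)) := h3
        _ ≤ r * (r ^ k * inner ℝ x (act P x)) := by gcongr
        _ = _ := by ring
  have h4 := sInf_spectrum_le_inner_act hP.1.1 ((T ^ k) x)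
  have h5 := inner_act_le_sSup_spectrum hP.1.1 x
  rw [div_mul_eq_mul_div, div_mul_eq_mul_div, le_div_iff₀ hmin]
  calc _ ≤ r ^ k * inner ℝ x (act P x) := by linarith
    _ ≤ r ^ k * (sSup (spectrum ℝ P) * ‖x‖ ^ 2) := by gcongr
    _ = _ := by ring

/-- Testing the Lyapunov equation on a unit vector gives `1 ≤ 2 ‖M‖ ‖P‖`. -/
lemma inv_opNorm_div_two_le (hd : 1 ≤ d) (hP : IsLyapunovSolution M P) (hP0 : 0 < opNorm P) :
    (opNorm P)⁻¹ / 2 ≤ opNorm M := by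
  let x : EuclideanSpace ℝ (Fin d) := EuclideanSpace.single ⟨0, hd⟩ 1
  have hx : ‖x‖ = 1 := by simp [x]
  have h3 : inner ℝ (act M x) (act P x) + inner ℝ x (act P (act M x)) = 1 := by
    rw [inner_act_left, ← act_mul, ← act_mul, ← inner_add_right, ← act_add, hP.2, act_one,
      real_inner_self_eq_norm_sq, hx, one_pow]
  have hM := norm_act_le M x
  have hPx := norm_act_le P x
  have hPM := norm_act_le P (act M x)
  have h4 := real_inner_le_norm (act M x) (act P x)
  have h5 := real_inner_le_norm x (act P (act M x))
  rw [hx, mul_one] at hM hPx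
  rw [hx, one_mul] at h5
  have hM0 : 0 ≤ opNorm M := norm_nonneg _
  have h6 : ‖act M x‖ * ‖act P x‖ ≤ opNorm M * opNorm P := by gcongr
  have h7 : opNorm P * ‖act M x‖ ≤ opNorm P * opNorm M := by gcongr
  have h8 : 1 ≤ 2 * opNorm M * opNorm P := by linarith
  rw [div_le_iff₀ (by norm_num), inv_le_iff_one_le_mul₀ hP0]
  linarith

end QuadraticForm

/-! ### Consequences of the step size restriction. -/

namespace LSA

variable {d : ℕ} {Z : Type*} [MeasurableSpace Z] (S : LSA d Z)

/-- The quantitative consequences of the step size restriction. -/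
structure StepBounds (α p : ℝ) (m : ℕ) : Prop where
  alpha_pos : 0 < α
  a_pos : 0 < S.a
  one_le_kappa : 1 ≤ S.kappa
  CA_pos : 0 < S.CA
  a_le : S.a ≤ 2 * S.CA
  alpha_le : α * m * p * (384 * S.CA ^ 3) ≤ S.a ^ 2
  opNorm_Abar_le : opNorm S.Abar ≤ 2 * S.CA
  opNorm_Atilde_le : ∀ z, opNorm (S.Atilde z) ≤ S.CA
  norm_contraction_pow_le : ∀ k, ‖S.contraction α ^ k‖
    ≤ Real.sqrt S.kappa * Real.sqrt (1 - α * S.a) ^ k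

lemma alpha_mul_a_le {α p : ℝ} {m : ℕ} (ha : 0 < S.a) (hCA : 0 < S.CA) (haC : S.a ≤ 2 * S.CA)
    (h : α * m * p * (384 * S.CA ^ 3) ≤ S.a ^ 2) : α * S.a * m * p ≤ 1 / 48 := by
  have h1 : S.a ^ 3 ≤ (2 * S.CA) ^ 3 := by gcongr
  have h2 : α * m * p * (384 * S.CA ^ 3) * S.a ≤ S.a ^ 2 * S.a := by gcongr
  have h3 : 0 < 384 * S.CA ^ 3 := by positivity
  have h4 : α * S.a * m * p * (384 * S.CA ^ 3) ≤ 1 / 48 * (384 * S.CA ^ 3) := by nlinarith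
  exact le_of_mul_le_mul_right h4 h3

/-- A nonempty range of step sizes excludes the degenerate values: `blockLen = 0`, `CA = 0` and a
vanishing `lyap` would each make the upper limit nonpositive, inverses of zero being zero. -/
lemma stepBounds [Nonempty Z] (hd : 1 ≤ d) (hA : S.StabilityAssumption) {p : ℝ} (hp : 2 ≤ p)
    {m : ℕ} (hm : 1 ≤ m) {α : ℝ} (hα : α ∈ Set.Ioo (0 : ℝ) (S.alphaB m p)) :
    S.StepBounds α p m := by
  obtain ⟨hα0, hα1⟩ := hα
  have hm0 : (1 : ℝ) ≤ m := by exact_mod_cast hm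
  have hmpos : (0 : ℝ) < m := by linarith
  have hBpos : 0 < S.alphaB m p := hα0.trans hα1
  rw [alphaB, ← div_eq_mul_inv, lt_div_iff₀ hmpos] at hα1
  have hαM : α * m < S.alphaM (p * (1 + Real.log d)) := hα1.trans_le (min_le_left _ _)
  have hαm : 0 < α * m := by positivity
  have hαq : α * m < S.a / (12 * S.CGamma) / (p * (1 + Real.log d)) := hαM.trans_le (min_le_right _ _)
  have hαI : α * m < S.alphaInfM := hαM.trans_le (min_le_left _ _)
  have hblock : (1 : ℝ) ≤ S.blockLen := by
    rcases Nat.eq_zero_or_pos S.blockLen with h | h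
    · rw [alphaInfM, h] at hαI; simp at hαI; linarith
    · exact_mod_cast h
  have hbpos : (0 : ℝ) < S.blockLen := by linarith
  rw [alphaInfM, ← div_eq_mul_inv, lt_div_iff₀ hbpos] at hαI
  have hαb : 0 < α * m * S.blockLen := by positivity
  have hαle : α ≤ α * m * S.blockLen := by
    have : 1 ≤ (m : ℝ) * S.blockLen := by nlinarith
    nlinarith
  have h1 : α * m * S.blockLen < S.alphaInf := hαI.trans_le (min_le_left _ _)
  have h2 : α * m * S.blockLen < (Real.sqrt S.kappa)⁻¹ * S.CA⁻¹ :=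
    hαI.trans_le ((min_le_right _ _).trans (min_le_left _ _))
  have hQ0 : 0 < opNorm S.lyap := hαb.trans (h1.trans_le (min_le_right _ _))
  have hαw : α < 1 / 2 * ((opNormWrt S.lyap S.Abar) ^ 2)⁻¹ * (opNorm S.lyap)⁻¹ :=
    hαle.trans_lt (h1.trans_le (min_le_left _ _))
  -- `lyapunov` defaults to `0` when there is no solution; this contradicts `0 < opNorm S.lyap`,
  -- which follows from `α < ‖Q‖`.
  have hlyap : IsLyapunovSolution S.Abar S.lyap := by
    by_cases h : ∃ P, IsLyapunovSolution S.Abar P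
    · have : S.lyap = h.choose := by rw [lyap, lyapunov, dif_pos h]
      rw [this]; exact h.choose_spec
    · have : S.lyap = 0 := by rw [lyap, lyapunov, dif_neg h]
      rw [this] at hQ0
      simp [opNorm] at hQ0
  have ha : 0 < S.a := by rw [a]; positivity
  have hmin := sInf_spectrum_pos hd hlyap.1
  have hkap : 1 ≤ S.kappa := by
    rw [kappa, le_div_iff₀ hmin, one_mul]; exact sInf_spectrum_le_sSup hd hlyap.1
  have hsk : 1 ≤ Real.sqrt S.kappa := Real.one_le_sqrt.2 hkap
  have hCA : 0 < S.CA := by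
    have h3 : 0 < (Real.sqrt S.kappa)⁻¹ * S.CA⁻¹ := hαb.trans h2
    have h4 : 0 < (Real.sqrt S.kappa)⁻¹ := by positivity
    exact inv_pos.1 ((mul_pos_iff_of_pos_left h4).1 h3)
  have hAz : ∀ z, opNorm (S.A z) ≤ S.CA := fun z =>
    (le_ciSup hA.bdd_A z).trans (le_max_left _ _)
  have hAtz : ∀ z, opNorm (S.Atilde z) ≤ S.CA := fun z =>
    (le_ciSup hA.bdd_Atilde z).trans (le_max_right _ _)
  have hAbar : opNorm S.Abar ≤ 2 * S.CA := by
    obtain ⟨z⟩ := ‹Nonempty Z›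
    have h3 : S.Abar = S.A z - S.Atilde z := by rw [Atilde]; abel
    have h4 : opNorm S.Abar ≤ opNorm (S.A z) + opNorm (S.Atilde z) := by
      rw [h3, opNorm, map_sub]; exact norm_sub_le _ _
    linarith [hAz z, hAtz z]
  have haC : S.a ≤ 2 * S.CA := (inv_opNorm_div_two_le hd hlyap hQ0).trans hAbar
  -- Since the block length is at least `8 C_A / a`, one has `C_Γ ≥ 32 C_A³ / a`; and 384 is `12 *
  -- 32`. The factor `1 + log d` is at least 1 and is dropped.
  have hαbound : α * m * p * (384 * S.CA ^ 3) ≤ S.a ^ 2 := by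
    have hlog : 0 ≤ Real.log d := Real.log_natCast_nonneg d
    have hC1 : 32 * S.CA ^ 3 / S.a ≤ S.CGamma := by
      have h3 : 8 * Real.sqrt S.kappa * S.CA / S.a ≤ S.blockLen := Nat.le_ceil _
      have h4 : 8 * S.CA / S.a ≤ S.blockLen := by
        refine le_trans ?_ h3
        gcongr; linarith
      have h5 : S.CA ^ 2 ≤ (Real.sqrt S.kappa * S.CA + S.a / 6) ^ 2 := by
        gcongr; nlinarith
      rw [CGamma]
      calc 32 * S.CA ^ 3 / S.a = 4 * S.CA ^ 2 * (8 * S.CA / S.a) := by ring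
        _ ≤ _ := by gcongr
    have hCpos : 0 < S.CGamma := lt_of_lt_of_le (by positivity) hC1
    have hq : α * m * (p * (1 + Real.log d)) < S.a / (12 * S.CGamma) :=
      (lt_div_iff₀ (by positivity)).1 hαq
    rw [lt_div_iff₀ (by positivity)] at hq
    have h6 : α * m * p ≤ α * m * (p * (1 + Real.log d)) := by
      gcongr; nlinarith
    rw [div_le_iff₀ ha] at hC1
    calc α * m * p * (384 * S.CA ^ 3) ≤ α * m * p * (12 * (S.CGamma * S.a)) := by
          exact mul_le_mul_of_nonneg_left (by linarith) (by positivity)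
      _ = α * m * p * (12 * S.CGamma) * S.a := by ring
      _ ≤ α * m * (p * (1 + Real.log d)) * (12 * S.CGamma) * S.a := by gcongr
      _ ≤ S.a * S.a := by gcongr
      _ = _ := by ring
  refine ⟨hα0, ha, hkap, hCA, haC, hαbound, hAbar, hAtz, fun k => ?_⟩
  have hαa : α * S.a ≤ 1 := by
    have h3 := S.alpha_mul_a_le ha hCA haC hαbound
    have h4 : 1 ≤ (m : ℝ) * p := by nlinarith
    have h5 : 0 < α * S.a := by positivity
    nlinarith
  have hw : α * opNormWrt S.lyap S.Abar ^ 2 ≤ 1 / 2 * (opNorm S.lyap)⁻¹ := by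
    rcases eq_or_ne (opNormWrt S.lyap S.Abar) 0 with h | h
    · rw [h]; simp; positivity
    · calc _ ≤ 1 / 2 * ((opNormWrt S.lyap S.Abar) ^ 2)⁻¹ * (opNorm S.lyap)⁻¹
            * opNormWrt S.lyap S.Abar ^ 2 := by gcongr
        _ = _ := by field_simp
  refine ContinuousLinearMap.opNorm_le_bound _ (by positivity) fun x => ?_
  have h3 := norm_act_pow_sq_le hd hlyap hα0.le hw hQ0 hαa k x
  have h4 : 0 ≤ 1 - α * S.a := by linarith
  refine le_of_sq_le_sq ?_ (by positivity)
  rw [mul_pow, mul_pow, Real.sq_sqrt (by linarith), ← pow_mul, mul_comm k 2, pow_mul,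
    Real.sq_sqrt h4]
  exact h3

end LSA

/-! ### Conditional means of `ψ`. -/

namespace LSA

variable {d : ℕ} {Z : Type*} [MeasurableSpace Z] (S : LSA d Z)

/-- The matrix `Ã(z)` as a continuous linear map. -/
noncomputable def noiseCLM (z : Z) : EuclideanSpace ℝ (Fin d) →L[ℝ] EuclideanSpace ℝ (Fin d) :=
  Matrix.toEuclideanCLM (n := Fin d) (𝕜 := ℝ) (S.Atilde z)

lemma psi_eq (y : EuclideanSpace ℝ (Fin d) × Z) : S.psi y = S.noiseCLM y.2 y.1 := rfl

lemma noiseCLM_eq_sum (z : Z) : S.noiseCLM z = ∑ i, ∑ j, (S.A z i j - S.Abar i j) •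
    Matrix.toEuclideanCLM (n := Fin d) (𝕜 := ℝ) (Matrix.single i j 1) := by
  rw [noiseCLM]
  conv_lhs => rw [Matrix.matrix_eq_sum_single (S.Atilde z)]
  simp only [map_sum]
  refine Finset.sum_congr rfl fun i _ => Finset.sum_congr rfl fun j _ => ?_
  rw [← map_smul, Matrix.smul_single, smul_eq_mul, mul_one, Atilde, Matrix.sub_apply]

lemma stronglyMeasurable_noiseCLM : StronglyMeasurable S.noiseCLM := by
  have h : S.noiseCLM = fun z => ∑ i, ∑ j, (S.A z i j - S.Abar i j) •
      Matrix.toEuclideanCLM (n := Fin d) (𝕜 := ℝ) (Matrix.single i j 1) :=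
    funext S.noiseCLM_eq_sum
  rw [h]
  exact Finset.stronglyMeasurable_fun_sum _ fun i _ => Finset.stronglyMeasurable_fun_sum _
    fun j _ => (((S.measurable_A i j).sub_const _).stronglyMeasurable).smul_const _

lemma stronglyMeasurable_psi : StronglyMeasurable S.psi :=
  (isBoundedBilinearMap_apply (𝕜 := ℝ) (E := EuclideanSpace ℝ (Fin d))
    (F := EuclideanSpace ℝ (Fin d))).continuous.comp_stronglyMeasurable
    ((S.stronglyMeasurable_noiseCLM.comp_measurable measurable_snd).prodMk
      measurable_fst.stronglyMeasurable)

lemma integral_noiseCLM {π : Measure Z} [IsProbabilityMeasure π] (hN : S.NoiseAssumption π) :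
    ∫ z, S.noiseCLM z ∂π = 0 := by
  have hi : ∀ i j, Integrable (fun z => S.A z i j - S.Abar i j) π := fun i j =>
    (hN.integrable_A i j).sub (integrable_const _)
  simp only [noiseCLM_eq_sum]
  rw [integral_finsetSum _ fun i _ => integrable_finsetSum _ fun j _ => (hi i j).smul_const _]
  refine Finset.sum_eq_zero fun i _ => ?_
  rw [integral_finsetSum _ fun j _ => (hi i j).smul_const _]
  refine Finset.sum_eq_zero fun j _ => ?_
  rw [integral_smul_const, integral_sub (hN.integrable_A i j) (integrable_const _),
    hN.integral_A]
  simp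

lemma integral_eps {π : Measure Z} [IsProbabilityMeasure π] (hN : S.NoiseAssumption π)
    {C : ℝ} (hC : ∀ z, ‖S.noiseCLM z‖ ≤ C) : ∫ z, S.eps z ∂π = 0 := by
  have hi : Integrable S.noiseCLM π :=
    Integrable.of_bound S.stronglyMeasurable_noiseCLM.aestronglyMeasurable C (ae_of_all _ hC)
  have h : ∀ z, S.eps z = S.noiseCLM z S.thetaStar - (S.b z - S.bbar) := fun z => rfl
  simp only [h]
  rw [integral_sub (f := fun z => S.noiseCLM z S.thetaStar) (g := fun z => S.b z - S.bbar)
      (hi.apply_continuousLinearMap _) (hN.integrable_b.sub (integrable_const _)),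
    integral_sub (f := S.b) (g := fun _ => S.bbar) hN.integrable_b (integrable_const _),
    hN.integral_b, ← ContinuousLinearMap.integral_apply hi, S.integral_noiseCLM hN]
  simp

/-- The conditional mean of `Ã` after `s` steps. -/
noncomputable def meanNoise (Q : Kernel Z Z) (s : ℕ) (z : Z) :
    EuclideanSpace ℝ (Fin d) →L[ℝ] EuclideanSpace ℝ (Fin d) :=
  ∫ z', S.noiseCLM z' ∂(Q ^ s) z

lemma stronglyMeasurable_meanNoise (Q : Kernel Z Z) (s : ℕ) : StronglyMeasurable (S.meanNoise Q s) :=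
  stronglyMeasurable_integral_pow S.stronglyMeasurable_noiseCLM s

lemma stronglyMeasurable_meanNoise_apply (Q : Kernel Z Z) {α : ℝ} (s j : ℕ) :
    StronglyMeasurable fun z => S.meanNoise Q s z ((S.contraction α ^ j) (S.eps z)) :=
  (isBoundedBilinearMap_apply (𝕜 := ℝ) (E := EuclideanSpace ℝ (Fin d))
    (F := EuclideanSpace ℝ (Fin d))).continuous.comp_stronglyMeasurable
    ((S.stronglyMeasurable_meanNoise Q s).prodMk
      ((S.contraction α ^ j).continuous.comp_stronglyMeasurable
        S.measurable_eps.stronglyMeasurable))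

/-- The part of the conditional mean of `ψ` after `s` steps that does not depend on `J`. -/
noncomputable def psiRemainder (Q : Kernel Z Z) (α : ℝ) : ℕ → Z → EuclideanSpace ℝ (Fin d)
  | 0, _ => 0
  | s + 1, z => ∫ z', psiRemainder Q α s z' ∂Q z
      - α • S.meanNoise Q (s + 1) z ((S.contraction α ^ s) (S.eps z))

lemma stronglyMeasurable_psiRemainder (Q : Kernel Z Z) {α : ℝ} (s : ℕ) : StronglyMeasurable (S.psiRemainder Q α s) := by
  induction s with
  | zero => exact stronglyMeasurable_const
  | succ s ih =>
    exact (StronglyMeasurable.integral_kernel ih).sub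
      ((S.stronglyMeasurable_meanNoise_apply Q _ _).const_smul α)

variable (Q : Kernel Z Z) [IsMarkovKernel Q] {α : ℝ}

lemma integral_kernelJ_pow_snd {F : Type*} [NormedAddCommGroup F] [NormedSpace ℝ F]
    [CompleteSpace F] {f : Z → F} (hf : StronglyMeasurable f) {C : ℝ} (hC : ∀ z, ‖f z‖ ≤ C) (s : ℕ)
    (y : EuclideanSpace ℝ (Fin d) × Z) :
    ∫ w, f w.2 ∂(S.kernelJ Q α ^ s) y = ∫ z, f z ∂(Q ^ s) y.2 := by
  have hf2 : StronglyMeasurable fun w : EuclideanSpace ℝ (Fin d) × Z => f w.2 :=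
    hf.comp_measurable measurable_snd
  induction s generalizing y with
  | zero =>
    have h : (S.kernelJ Q α ^ 0) y = Measure.dirac y := by rw [pow_zero]; exact Kernel.id_apply _
    have h' : (Q ^ 0) y.2 = Measure.dirac y.2 := by rw [pow_zero]; exact Kernel.id_apply _
    rw [h, h', integral_dirac' _ _ hf, integral_dirac' _ _ hf2]
  | succ s ih =>
    rw [integral_pow_succ s y (Integrable.of_bound hf2.aestronglyMeasurable C
        (ae_of_all _ fun w => hC _)),
      integral_pow_succ s y.2 (Integrable.of_bound hf.aestronglyMeasurable C (ae_of_all _ hC)),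
      S.integral_kernelJ Q α y (stronglyMeasurable_integral_pow hf2 s)]
    exact integral_congr_ae (ae_of_all _ fun z => ih (S.stepJ α y, z))

variable {S}

/-- From a bounded start, `J` stays bounded after finitely many steps. The constant is irrelevant;
only integrability of `ψ` is drawn from it. -/
lemma exists_ae_norm_fst_le (hε : BddAbove (Set.range fun z => ‖S.eps z‖)) (s : ℕ) (r : ℝ) :
    ∃ C : ℝ, ∀ x : EuclideanSpace ℝ (Fin d) × Z, ‖x.1‖ ≤ r →
      ∀ᵐ y ∂(S.kernelJ Q α ^ s) x, ‖y.1‖ ≤ C := by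
  induction s generalizing r with
  | zero =>
    refine ⟨r, fun x hx => ?_⟩
    have h : (S.kernelJ Q α ^ 0) x = Measure.dirac x := by rw [pow_zero]; exact Kernel.id_apply _
    rw [h, ae_dirac_iff (measurableSet_le measurable_fst.norm measurable_const)]
    exact hx
  | succ s ih =>
    obtain ⟨C, hC⟩ := ih (‖S.contraction α‖ * |r| + |α| * S.epsSup)
    refine ⟨C, fun x hx => ?_⟩
    have hB : MeasurableSet {y : EuclideanSpace ℝ (Fin d) × Z | ¬ ‖y.1‖ ≤ C} :=
      (measurableSet_le measurable_fst.norm measurable_const).compl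
    have h : (S.kernelJ Q α ^ (s + 1)) = (S.kernelJ Q α ^ s) ∘ₖ S.kernelJ Q α := pow_succ _ _
    rw [ae_iff, h, Kernel.comp_apply' _ _ _ hB,
      S.lintegral_kernelJ Q α x (Kernel.measurable_coe _ hB)]
    refine lintegral_eq_zero_of_ae_eq_zero (ae_of_all _ fun z => ?_)
    refine ae_iff.1 (hC (S.stepJ α x, z) ?_)
    rw [stepJ_eq]
    refine (norm_sub_le _ _).trans (add_le_add ?_ ?_)
    · refine ((S.contraction α).le_opNorm _).trans ?_
      gcongr
      exact hx.trans (le_abs_self r)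
    · rw [norm_smul, Real.norm_eq_abs]
      gcongr
      exact S.norm_eps_le hε _

lemma integrable_psi_of_ae_le {C c : ℝ} (hC : ∀ z, ‖S.noiseCLM z‖ ≤ C)
    {μ : Measure (EuclideanSpace ℝ (Fin d) × Z)} [IsFiniteMeasure μ]
    (h : ∀ᵐ y ∂μ, ‖y.1‖ ≤ c) : Integrable S.psi μ := by
  refine Integrable.of_bound S.stronglyMeasurable_psi.aestronglyMeasurable (C * c) ?_
  filter_upwards [h] with y hy
  rw [psi_eq]
  exact ContinuousLinearMap.le_of_opNorm_le_of_le _ (hC _) hy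

lemma integrable_psi_kernelJ_pow (hε : BddAbove (Set.range fun z => ‖S.eps z‖)) {C : ℝ}
    (hC : ∀ z, ‖S.noiseCLM z‖ ≤ C) (s : ℕ) (x : EuclideanSpace ℝ (Fin d) × Z) :
    Integrable S.psi ((S.kernelJ Q α ^ s) x) := by
  obtain ⟨c, hc⟩ := exists_ae_norm_fst_le Q (α := α) hε s ‖x.1‖
  exact integrable_psi_of_ae_le hC (hc x le_rfl)

lemma norm_meanNoise_le {C : ℝ} (hC : ∀ z, ‖S.noiseCLM z‖ ≤ C) (s : ℕ) (z : Z) :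
    ‖S.meanNoise Q s z‖ ≤ C := by
  rw [meanNoise]
  simpa using norm_integral_le_of_norm_le_const (μ := (Q ^ s) z) (ae_of_all _ hC)

lemma meanNoise_succ {C : ℝ} (hC : ∀ z, ‖S.noiseCLM z‖ ≤ C) (s : ℕ) (z : Z) :
    ∫ z', S.meanNoise Q s z' ∂Q z = S.meanNoise Q (s + 1) z :=
  (integral_pow_succ s z (Integrable.of_bound
    S.stronglyMeasurable_noiseCLM.aestronglyMeasurable C (ae_of_all _ hC))).symm

lemma exists_norm_psiRemainder_le (hε : BddAbove (Set.range fun z => ‖S.eps z‖)) {C : ℝ}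
    (hC : ∀ z, ‖S.noiseCLM z‖ ≤ C) (s : ℕ) : ∃ c, ∀ z, ‖S.psiRemainder Q α s z‖ ≤ c := by
  induction s with
  | zero => exact ⟨0, fun z => by simp [psiRemainder]⟩
  | succ s ih =>
    obtain ⟨c, hc⟩ := ih
    refine ⟨c + |α| * (C * (‖S.contraction α ^ s‖ * S.epsSup)), fun z => ?_⟩
    rw [psiRemainder]
    refine (norm_sub_le _ _).trans (add_le_add ?_ ?_)
    · simpa using norm_integral_le_of_norm_le_const (μ := Q z) (ae_of_all _ hc)
    · rw [norm_smul, Real.norm_eq_abs]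
      gcongr
      exact ContinuousLinearMap.le_of_opNorm_le_of_le _ (norm_meanNoise_le Q hC _ _)
        (ContinuousLinearMap.le_of_opNorm_le_of_le _ le_rfl (S.norm_eps_le hε z))

/-- One step replaces `J` by `G J - α ε(z)`, which does not depend on the new noise, so it comes out
of the mean of `M_s`. The term in `ε(z)` feeds the recursion of `psiRemainder`. -/
lemma integral_psi_kernelJ_pow (hε : BddAbove (Set.range fun z => ‖S.eps z‖)) {C : ℝ}
    (hC : ∀ z, ‖S.noiseCLM z‖ ≤ C) (s : ℕ) (y : EuclideanSpace ℝ (Fin d) × Z) :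
    ∫ w, S.psi w ∂(S.kernelJ Q α ^ s) y
      = S.meanNoise Q s y.2 ((S.contraction α ^ s) y.1) + S.psiRemainder Q α s y.2 := by
  induction s generalizing y with
  | zero =>
    have h : (S.kernelJ Q α ^ 0) y = Measure.dirac y := by rw [pow_zero]; exact Kernel.id_apply _
    have h' : (Q ^ 0) y.2 = Measure.dirac y.2 := by rw [pow_zero]; exact Kernel.id_apply _
    rw [h, integral_dirac' _ _ S.stronglyMeasurable_psi, meanNoise, h',
      integral_dirac' _ _ S.stronglyMeasurable_noiseCLM]
    simp [psiRemainder, psi_eq]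
  | succ s ih =>
    obtain ⟨c, hc⟩ := exists_norm_psiRemainder_le Q (α := α) hε hC s
    have hi1 : Integrable (S.meanNoise Q s) (Q y.2) :=
      Integrable.of_bound (S.stronglyMeasurable_meanNoise Q s).aestronglyMeasurable C
        (ae_of_all _ (norm_meanNoise_le Q hC s))
    have hi2 : Integrable (S.psiRemainder Q α s) (Q y.2) :=
      Integrable.of_bound (S.stronglyMeasurable_psiRemainder Q s).aestronglyMeasurable c
        (ae_of_all _ hc)
    rw [integral_pow_succ s y (integrable_psi_kernelJ_pow Q hε hC _ _),
      S.integral_kernelJ Q α y (stronglyMeasurable_integral_pow S.stronglyMeasurable_psi s)]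
    simp only [ih]
    rw [integral_add (hi1.apply_continuousLinearMap _) hi2,
      ← ContinuousLinearMap.integral_apply hi1, meanNoise_succ Q hC, psiRemainder, stepJ_eq]
    simp only [map_sub, map_smul, pow_succ, mul_apply_eq_comp]
    abel

variable {Q} {π : Measure Z} [IsProbabilityMeasure π] {m : ℕ}

lemma norm_meanNoise_le_of_uniformlyErgodic (hQ : UniformlyErgodic Q π m)
    (hN : S.NoiseAssumption π) {C : ℝ} (hC : ∀ z, ‖S.noiseCLM z‖ ≤ C) (s : ℕ) (z : Z) :
    ‖S.meanNoise Q s z‖ ≤ 2 * C * (1 / 4) ^ (s / m) := by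
  have h := hQ.norm_integral_pow_sub_integral_le hQ.invariant S.stronglyMeasurable_noiseCLM hC s z
  rwa [S.integral_noiseCLM hN, sub_zero] at h

lemma norm_contraction_pow_le_pow {g : ℝ} (hg : ‖S.contraction α‖ ≤ g) (s : ℕ) :
    ‖S.contraction α ^ s‖ ≤ g ^ s := by
  induction s with
  | zero => rw [pow_zero, pow_zero]; exact ContinuousLinearMap.norm_id_le
  | succ s ih =>
    rw [pow_succ, pow_succ]
    exact (norm_mul_le _ _).trans
      (mul_le_mul ih hg (norm_nonneg _) ((norm_nonneg _).trans ih))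

/-- Unrolling the recursion writes the remainder as `s` terms. Each is small by centring of `Ã` over
the later steps, and has a small oscillation by mixing over the earlier ones. Averaging first over
`Q ^ r` makes the induction on `s` possible. -/
lemma norm_psiRemainder_sub_le (hQ : UniformlyErgodic Q π m) (hN : S.NoiseAssumption π)
    {C g : ℝ} (hC : ∀ z, ‖S.noiseCLM z‖ ≤ C) (hα : 0 ≤ α) (hg : ‖S.contraction α‖ ≤ g)
    (hg1 : 1 ≤ g) (r s : ℕ) (z z' : Z) :
    ‖∫ w, S.psiRemainder Q α s w ∂(Q ^ r) z - ∫ w, S.psiRemainder Q α s w ∂(Q ^ r) z'‖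
      ≤ 16 * α * C * S.epsSup * s * (1 / 4) ^ ((r + s) / m) * g ^ s := by
  have hε0 : 0 ≤ S.epsSup := Real.iSup_nonneg fun z => norm_nonneg _
  have hC0 : 0 ≤ C := (norm_nonneg _).trans (hC z)
  induction s generalizing r z z' with
  | zero => simp [psiRemainder]
  | succ s ih =>
    obtain ⟨c, hc⟩ := exists_norm_psiRemainder_le Q (α := α) hN.bdd_eps hC s
    set k : Z → EuclideanSpace ℝ (Fin d) :=
      fun z => S.meanNoise Q (s + 1) z ((S.contraction α ^ s) (S.eps z)) with hk
    have hkm : StronglyMeasurable k := S.stronglyMeasurable_meanNoise_apply Q _ _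
    have hkb : ∀ z, ‖k z‖ ≤ 2 * C * (1 / 4) ^ ((s + 1) / m) * (g ^ s * S.epsSup) := fun z => by
      refine ContinuousLinearMap.le_of_opNorm_le_of_le _
        (norm_meanNoise_le_of_uniformlyErgodic hQ hN hC _ _)
        (ContinuousLinearMap.le_of_opNorm_le_of_le _ ?_ (S.norm_eps_le hN.bdd_eps z))
      exact norm_contraction_pow_le_pow hg s
    have hkr : ‖∫ w, k w ∂(Q ^ r) z - ∫ w, k w ∂(Q ^ r) z'‖
        ≤ 16 * C * S.epsSup * (1 / 4) ^ ((r + (s + 1)) / m) * g ^ s := by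
      refine (hQ.norm_integral_pow_sub_le hkm hkb r z z').trans ?_
      -- Splitting a time in two loses at most one unit in the integer parts, hence a factor 4.
      have h1 : (1 / 4 : ℝ) ^ ((s + 1) / m) * (1 / 4) ^ (r / m)
          ≤ 4 * (1 / 4) ^ ((r + (s + 1)) / m) := by
        rw [← pow_add]
        have h2 : (r + (s + 1)) / m ≤ (s + 1) / m + r / m + 1 := by
          have hm := hQ.tmix_pos
          rw [Nat.add_div hm]; split_ifs <;> omega
        have h3 : (1 / 4 : ℝ) ^ ((s + 1) / m + r / m + 1) ≤ (1 / 4) ^ ((r + (s + 1)) / m) :=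
          pow_le_pow_of_le_one (by norm_num) (by norm_num) h2
        rw [pow_succ] at h3
        linarith
      calc _ = 4 * C * S.epsSup * g ^ s * ((1 / 4 : ℝ) ^ ((s + 1) / m) * (1 / 4) ^ (r / m)) := by
            ring
        _ ≤ 4 * C * S.epsSup * g ^ s * (4 * (1 / 4) ^ ((r + (s + 1)) / m)) := by gcongr
        _ = _ := by ring
    have hsplit : ∀ z, ∫ w, S.psiRemainder Q α (s + 1) w ∂(Q ^ r) z
        = ∫ w, S.psiRemainder Q α s w ∂(Q ^ (r + 1)) z - α • ∫ w, k w ∂(Q ^ r) z := fun z => by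
      have hsm := S.stronglyMeasurable_psiRemainder Q (α := α) s
      have hcomp : Q ^ (r + 1) = Q ∘ₖ (Q ^ r) := pow_succ' Q r
      have hi : ∀ (μ : Measure Z) [IsProbabilityMeasure μ], Integrable (S.psiRemainder Q α s) μ :=
        fun μ _ => Integrable.of_bound hsm.aestronglyMeasurable c (ae_of_all _ hc)
      have hi1 : Integrable (fun w => ∫ z', S.psiRemainder Q α s z' ∂Q w) ((Q ^ r) z) :=
        Integrable.of_bound (StronglyMeasurable.integral_kernel hsm).aestronglyMeasurable c
          (ae_of_all _ fun w => by
            simpa using norm_integral_le_of_norm_le_const (μ := Q w) (ae_of_all _ hc))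
      have hi2 : Integrable k ((Q ^ r) z) :=
        Integrable.of_bound hkm.aestronglyMeasurable _ (ae_of_all _ hkb)
      have h6 : ∫ w, S.psiRemainder Q α s w ∂(Q ^ (r + 1)) z
          = ∫ w, ∫ z', S.psiRemainder Q α s z' ∂Q w ∂(Q ^ r) z := by
        have h7 := hi ((Q ^ (r + 1)) z)
        rw [hcomp] at h7 ⊢
        exact Kernel.integral_comp h7
      rw [h6, ← integral_smul]
      exact integral_sub hi1 (hi2.smul α)
    rw [hsplit, hsplit, sub_sub_sub_comm, ← smul_sub]
    refine (norm_sub_le _ _).trans ?_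
    have h4 := ih (r + 1) z z'
    rw [norm_smul, Real.norm_of_nonneg hα]
    have h5 : r + 1 + s = r + (s + 1) := by ring
    rw [h5] at h4
    calc _ ≤ 16 * α * C * S.epsSup * s * (1 / 4) ^ ((r + (s + 1)) / m) * g ^ s
          + α * (16 * C * S.epsSup * (1 / 4) ^ ((r + (s + 1)) / m) * g ^ s) := by gcongr
      _ = 16 * α * C * S.epsSup * (s + 1 : ℕ) * (1 / 4) ^ ((r + (s + 1)) / m) * g ^ s := by
          push_cast; ring
      _ ≤ _ := by
          gcongr ?_ * ?_
          exact pow_le_pow_right₀ hg1 (Nat.le_succ s)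

end LSA

/-! ### Geometric sums and `lpNorm` estimates. -/

section Auxiliary

/-- The ratio `13/50` is slightly above the mixing factor `1/4`; the slack absorbs the variation of
powers of `G` over `m` steps. -/
lemma sum_geometric_weights_le (K : ℕ) :
    ∑ k ∈ Finset.range K, (if k = 0 then 1 else 2 * (13 / 50 : ℝ) ^ k) ≤ 7 / 4 := by
  have h : ∀ K : ℕ, ∑ k ∈ Finset.range (K + 1), (if k = 0 then 1 else 2 * (13 / 50 : ℝ) ^ k)
      = 63 / 37 - 26 / 37 * (13 / 50) ^ K := fun K => by
    induction K with
    | zero => norm_num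
    | succ K ih => rw [Finset.sum_range_succ, ih, if_neg (Nat.succ_ne_zero K), pow_succ]; ring
  rcases K with _ | K
  · norm_num
  · rw [h]
    have : (0 : ℝ) ≤ (13 / 50) ^ K := by positivity
    linarith

lemma sum_mul_geometric_le (K : ℕ) :
    ∑ k ∈ Finset.range K, (k : ℝ) * (13 / 50 : ℝ) ^ k ≤ 1 / 2 := by
  have h : ∑ k ∈ Finset.range K, (k : ℝ) * (13 / 50 : ℝ) ^ k
      = 650 / 1369 - (650 / 1369 + 50 / 37 * K) * (13 / 50) ^ K := by
    induction K with
    | zero => norm_num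
    | succ K ih => rw [Finset.sum_range_succ, ih, pow_succ]; push_cast; ring
  rw [h]
  have : (0 : ℝ) ≤ (650 / 1369 + 50 / 37 * K) * (13 / 50) ^ K := by positivity
  linarith

lemma sum_pow_le_inv {r : ℝ} (h0 : 0 ≤ r) (h1 : r < 1) (n : ℕ) :
    ∑ k ∈ Finset.range n, r ^ k ≤ (1 - r)⁻¹ := by
  rw [← tsum_geometric_of_lt_one h0 h1]
  exact (summable_geometric_of_lt_one h0 h1).sum_le_tsum _ fun k _ => pow_nonneg h0 k

variable {Ω : Type*} {m0 : MeasurableSpace Ω} {μ : Measure Ω} {E : Type*} [NormedAddCommGroup E]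

lemma lpNorm_le_of_ae_bound [IsProbabilityMeasure μ] {q : ℝ≥0∞} {f : Ω → E} {C : ℝ} (hC : 0 ≤ C)
    (h : ∀ᵐ x ∂μ, ‖f x‖ ≤ C) : lpNorm f q μ ≤ C := by
  by_cases hf : AEStronglyMeasurable f μ
  · rw [← toReal_eLpNorm hf]
    refine ENNReal.toReal_le_of_le_ofReal hC ?_
    simpa using eLpNorm_le_of_ae_bound (p := q) h
  · rw [lpNorm_of_not_aestronglyMeasurable hf]; exact hC

lemma lpNorm_mono_ae_real {q : ℝ≥0∞} {f : Ω → E} {g : Ω → ℝ} (hg : MemLp g q μ)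
    (h : ∀ᵐ x ∂μ, ‖f x‖ ≤ g x) : lpNorm f q μ ≤ lpNorm g q μ := by
  by_cases hf : AEStronglyMeasurable f μ
  · rw [← toReal_eLpNorm hf, ← toReal_eLpNorm hg.1]
    exact ENNReal.toReal_mono hg.2.ne (eLpNorm_mono_ae_real h)
  · rw [lpNorm_of_not_aestronglyMeasurable hf]; exact lpNorm_nonneg

lemma lpNorm_comp_of_map_eq {Ω' : Type*} {m0' : MeasurableSpace Ω'} {μ' : Measure Ω'} {g : Ω → Ω'}
    (hg : Measurable g) (hμ : μ.map g = μ') {q : ℝ≥0∞} {f : Ω' → E}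
    (hf : AEStronglyMeasurable f μ') : lpNorm (fun x => f (g x)) q μ = lpNorm f q μ' := by
  subst hμ
  have h : AEStronglyMeasurable (fun x => f (g x)) μ := hf.comp_measurable hg
  rw [← toReal_eLpNorm hf, ← toReal_eLpNorm h, eLpNorm_map_measure hf hg.aemeasurable]
  rfl

lemma integral_norm_le_lpNorm [IsProbabilityMeasure μ] {q : ℝ≥0∞} (hq : 1 ≤ q) {f : Ω → E}
    (hf : MemLp f q μ) : ∫ x, ‖f x‖ ∂μ ≤ lpNorm f q μ := by
  rw [← lpNorm_one_eq_integral_norm hf.1, ← toReal_eLpNorm hf.1, ← toReal_eLpNorm hf.1]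
  exact ENNReal.toReal_mono hf.2.ne (eLpNorm_le_eLpNorm_of_exponent_le hq hf.1)

lemma lpNorm_clm_apply_le [NormedSpace ℝ E] {F : Type*} [NormedAddCommGroup F] [NormedSpace ℝ F]
    {q : ℝ≥0∞} {f : Ω → E} (hf : MemLp f q μ) {T : E →L[ℝ] F} {c : ℝ} (hT : ‖T‖ ≤ c) :
    lpNorm (fun x => T (f x)) q μ ≤ c * lpNorm f q μ := by
  have hc : 0 ≤ c := (norm_nonneg T).trans hT
  refine (lpNorm_mono_ae_real (hf.norm.const_mul c) (ae_of_all _ fun x =>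
    T.le_of_opNorm_le hT (f x))).trans (le_of_eq ?_)
  have h := lpNorm_const_smul (p := q) c (fun x => ‖f x‖) μ
  rw [lpNorm_norm hf.1, coe_nnnorm, Real.norm_of_nonneg hc] at h
  exact h

lemma stronglyMeasurable_piLE_eval {X : Type*} [MeasurableSpace X] {f : X → E}
    (hf : StronglyMeasurable f) (j : ℕ) :
    StronglyMeasurable[Filtration.piLE j] fun ω : ℕ → X => f (ω j) := by
  rw [Filtration.piLE_eq_comap_frestrictLe]
  exact (hf.comp_measurable (measurable_lastPoint j)).comp_measurable (comap_measurable _)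

end Auxiliary

/-! ### Moments of `J`. -/

namespace LSA

open Preorder Filtration

variable {d : ℕ} {Z : Type*} [MeasurableSpace Z] {S : LSA d Z} {α p : ℝ} {m : ℕ}

namespace StepBounds

lemma alpha_mul_CA_le (hS : S.StepBounds α p m) : α * m * p * S.CA ≤ 1 / 96 := by
  have h1 : S.a ^ 2 ≤ (2 * S.CA) ^ 2 := by
    have := hS.a_pos; have := hS.a_le; gcongr
  have h2 := hS.CA_pos
  have h3 : 0 < 384 * S.CA ^ 2 := by positivity
  have h4 := hS.alpha_le
  refine le_of_mul_le_mul_right (a := 384 * S.CA ^ 2) ?_ h3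
  calc _ = α * m * p * (384 * S.CA ^ 3) := by ring
    _ ≤ _ := by nlinarith

lemma alpha_mul_a_le (hS : S.StepBounds α p m) : α * S.a * m * p ≤ 1 / 48 :=
  S.alpha_mul_a_le hS.a_pos hS.CA_pos hS.a_le hS.alpha_le

lemma alpha_mul_a_mul_le (hS : S.StepBounds α p m) (hp : 2 ≤ p) : α * S.a * m ≤ 1 / 96 := by
  have h1 := hS.alpha_mul_a_le
  have h2 : 0 ≤ α * S.a * m := by
    have := hS.alpha_pos; have := hS.a_pos; positivity
  nlinarith

lemma alpha_mul_a_le' (hS : S.StepBounds α p m) (hp : 2 ≤ p) (hm : 1 ≤ m) :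
    α * S.a ≤ 1 / 96 := by
  have h1 := hS.alpha_mul_a_mul_le hp
  have h2 : 0 < α * S.a := mul_pos hS.alpha_pos hS.a_pos
  have h3 : (1 : ℝ) ≤ m := by exact_mod_cast hm
  nlinarith

/-- Over one mixing time the contraction is negligible: its rate to the power `m` is at least `1 -
αam ≥ 95/96` by Bernoulli. -/
lemma le_rate_pow (hS : S.StepBounds α p m) (hp : 2 ≤ p) (hm : 1 ≤ m) :
    1 / 4 ≤ 13 / 50 * Real.sqrt (1 - α * S.a) ^ m := by
  have h1 := hS.alpha_mul_a_mul_le hp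
  have h2 := hS.alpha_mul_a_le' hp hm
  have h3 : 0 < α * S.a := mul_pos hS.alpha_pos hS.a_pos
  have h4 : 1 - α * S.a ≤ Real.sqrt (1 - α * S.a) := Real.le_sqrt_of_sq_le (by nlinarith)
  have h5 : 1 + m * -(α * S.a) ≤ (1 + -(α * S.a)) ^ m :=
    one_add_mul_le_pow (by linarith) m
  have h6 : (1 + -(α * S.a)) ^ m ≤ Real.sqrt (1 - α * S.a) ^ m := by
    gcongr
    · linarith
    · linarith
  nlinarith

lemma norm_contraction_le (hS : S.StepBounds α p m) :
    ‖S.contraction α‖ ≤ 1 + α * (2 * S.CA) := by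
  rw [contraction, map_sub, map_smul, map_one]
  refine (norm_sub_le _ _).trans (add_le_add ContinuousLinearMap.norm_id_le ?_)
  rw [norm_smul, Real.norm_of_nonneg hS.alpha_pos.le]
  exact mul_le_mul_of_nonneg_left hS.opNorm_Abar_le hS.alpha_pos.le

/-- The crude bound `‖G‖ ≤ 1 + 2αC_A` costs almost nothing over `m` steps and, unlike the Lyapunov
bound, brings no factor `√κ`. -/
lemma growth_pow_le (hS : S.StepBounds α p m) (hp : 2 ≤ p) :
    1 / 4 * (1 + α * (2 * S.CA)) ^ m ≤ 13 / 50 := by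
  have h1 := hS.alpha_mul_CA_le
  have h2 := hS.CA_pos
  have h3 := hS.alpha_pos
  have h4 : (m : ℝ) * (α * (2 * S.CA)) ≤ 1 / 96 := by
    have : 0 ≤ α * m * S.CA := by positivity
    nlinarith
  have h5 : (1 + α * (2 * S.CA)) ^ m ≤ Real.exp (m * (α * (2 * S.CA))) := by
    rw [Real.exp_nat_mul]
    gcongr
    linarith [Real.add_one_le_exp (α * (2 * S.CA))]
  have h6 : Real.exp (1 / 96) ≤ 96 / 95 := by
    have h7 := Real.add_one_le_exp (-(1 / 96) : ℝ)
    rw [Real.exp_neg] at h7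
    have h8 : 0 < Real.exp (1 / 96) := Real.exp_pos _
    have h9 : (95 / 96) * Real.exp (1 / 96) ≤ 1 := by
      have := mul_le_mul_of_nonneg_right h7 h8.le
      rw [inv_mul_cancel₀ h8.ne'] at this
      linarith
    linarith
  have := Real.exp_le_exp.2 h4
  linarith

end StepBounds

variable {Q : Kernel Z Z} [IsMarkovKernel Q]

lemma ae_fst_eq (S : LSA d Z) (α : ℝ) (ξ : Measure (EuclideanSpace ℝ (Fin d) × Z))
    [IsProbabilityMeasure ξ] :
    ∀ᵐ ω ∂chainLaw (S.kernelJ Q α) ξ, ∀ t, (ω t).1 = (S.contraction α ^ t) (ω 0).1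
      - α • ∑ s ∈ Finset.range t, (S.contraction α ^ (t - 1 - s)) (S.eps (ω s).2) := by
  have h : ∀ᵐ ω ∂chainLaw (S.kernelJ Q α) ξ, ∀ t, (ω (t + 1)).1 = S.stepJ α (ω t) := by
    refine ae_all_iff.2 fun t => ?_
    refine ae_chainLaw_of_forall (S.kernelJ Q α) ξ
      (R := fun y => y.2.1 = S.stepJ α y.1) ?_ (fun x => ?_) t
    · exact measurableSet_eq_fun (measurable_fst.comp measurable_snd)
        ((S.measurable_stepJ α).comp measurable_fst)
    · rw [kernelJ_apply]
      exact (ae_map_iff (p := fun y : EuclideanSpace ℝ (Fin d) × Z => y.1 = S.stepJ α x)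
        measurable_prodMk_left.aemeasurable
        (measurableSet_eq_fun measurable_fst measurable_const)).2 (ae_of_all _ fun z => rfl)
  filter_upwards [h] with ω hω t
  induction t with
  | zero => simp
  | succ t ih =>
    rw [hω, stepJ_eq, ih, Finset.sum_range_succ, map_sub, map_smul, map_sum]
    have h1 : ∀ s ∈ Finset.range t, S.contraction α ((S.contraction α ^ (t - 1 - s))
        (S.eps (ω s).2)) = (S.contraction α ^ (t + 1 - 1 - s)) (S.eps (ω s).2) := fun s hs => by
      have hs' := Finset.mem_range.1 hs
      have h2 : t + 1 - 1 - s = (t - 1 - s) + 1 := by omega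
      rw [h2, pow_succ', mul_apply_eq_comp]
    have h3 : t + 1 - 1 - t = 0 := by omega
    rw [Finset.sum_congr rfl h1, h3, pow_zero, pow_succ', mul_apply_eq_comp, smul_add,
      one_apply_eq_self]
    abel

variable {π : Measure Z} [IsProbabilityMeasure π]

lemma noiseCLM_le (hS : S.StepBounds α p m) (z : Z) : ‖S.noiseCLM z‖ ≤ S.CA :=
  hS.opNorm_Atilde_le z

lemma epsSup_nonneg (S : LSA d Z) : 0 ≤ S.epsSup := Real.iSup_nonneg fun _ => norm_nonneg _

/-- The terms have conditional means decaying at the mixing rate because `∫ ε dπ = 0`. The squared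
weights sum to at most `κ / (αa)`, and `147/2` is `24 * (7/4)²`. -/
lemma lpNorm_noise_sq_le (hS : S.StepBounds α p m) (hp : 2 ≤ p) (hQ : UniformlyErgodic Q π m)
    (hN : S.NoiseAssumption π) (ξ : Measure (EuclideanSpace ℝ (Fin d) × Z))
    [IsProbabilityMeasure ξ] (n : ℕ) :
    lpNorm (∑ s ∈ Finset.range n, fun ω : ℕ → EuclideanSpace ℝ (Fin d) × Z =>
        (S.contraction α ^ (n - 1 - s)) (S.eps (ω s).2)) (ENNReal.ofReal p)
      (chainLaw (S.kernelJ Q α) ξ) ^ 2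
      ≤ 147 / 2 * (p * m * S.kappa / (α * S.a)) * S.epsSup ^ 2 := by
  set μ := chainLaw (S.kernelJ Q α) ξ
  set q := Real.sqrt (1 - α * S.a) with hq
  have hm := hQ.tmix_pos
  have hαa := hS.alpha_mul_a_le' hp hm
  have hαa0 : 0 < α * S.a := mul_pos hS.alpha_pos hS.a_pos
  have hκ := hS.one_le_kappa
  have hq0 : 0 ≤ q := Real.sqrt_nonneg _
  have hε0 := S.epsSup_nonneg
  have hq2 : q ^ 2 = 1 - α * S.a := Real.sq_sqrt (by linarith)
  let f : ℕ → EuclideanSpace ℝ (Fin d) × Z → EuclideanSpace ℝ (Fin d) :=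
    fun r y => (S.contraction α ^ r) (S.eps y.2)
  have hfz : ∀ r, StronglyMeasurable fun z => (S.contraction α ^ r) (S.eps z) := fun r =>
    (S.contraction α ^ r).continuous.comp_stronglyMeasurable S.measurable_eps.stronglyMeasurable
  have hf : ∀ r, StronglyMeasurable (f r) := fun r => (hfz r).comp_measurable measurable_snd
  have hfzb : ∀ r z, ‖(S.contraction α ^ r) (S.eps z)‖ ≤ Real.sqrt S.kappa * q ^ r * S.epsSup :=
    fun r z => ContinuousLinearMap.le_of_opNorm_le_of_le _ (hS.norm_contraction_pow_le r)
      (S.norm_eps_le hN.bdd_eps z)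
  have hint0 : ∀ r, ∫ z, (S.contraction α ^ r) (S.eps z) ∂π = 0 := fun r => by
    have hi : Integrable S.eps π := Integrable.of_bound S.measurable_eps.aestronglyMeasurable
      S.epsSup (ae_of_all _ (S.norm_eps_le hN.bdd_eps))
    rw [ContinuousLinearMap.integral_comp_comm _ hi, S.integral_eps hN (noiseCLM_le hS), map_zero]
  have hfm : ∀ r j, StronglyMeasurable[piLE j]
      fun ω : ℕ → EuclideanSpace ℝ (Fin d) × Z => f r (ω j) := fun r j =>
    stronglyMeasurable_piLE_eval (hf r) j
  have hev : ∀ j, Measurable fun ω : ℕ → EuclideanSpace ℝ (Fin d) × Z => ω j := fun j =>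
    measurable_pi_apply j
  have hfLp : ∀ r j, MemLp (fun ω : ℕ → EuclideanSpace ℝ (Fin d) × Z => f r (ω j))
      (ENNReal.ofReal p) μ := fun r j =>
    MemLp.of_bound ((hf r).comp_measurable (hev j)).aestronglyMeasurable _
      (ae_of_all _ fun ω => hfzb r _)
  have hcond : ∀ r t s, lpNorm (μ[fun ω => f r (ω (t + s))|piLE t]) (ENNReal.ofReal p) μ
      ≤ (if s = 0 then 1 else 2 * (1 / 4) ^ (s / m)) * (Real.sqrt S.kappa * q ^ r * S.epsSup) := by
    intro r t s
    have hc := condExp_chainLaw (S.kernelJ Q α) ξ (hf r)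
      (fun s x => Integrable.of_bound (hf r).aestronglyMeasurable _
        (ae_of_all _ fun y => hfzb r y.2))
      (fun t => (hfLp r t).integrable (ENNReal.one_le_ofReal.2 (by linarith))) t s
    refine lpNorm_le_of_ae_bound (by positivity) ?_
    filter_upwards [hc] with ω hω
    rw [hω, S.integral_kernelJ_pow_snd Q (hfz r) (hfzb r)]
    split_ifs with h
    · rw [one_mul]
      simpa using norm_integral_le_of_norm_le_const (μ := (Q ^ s) (ω t).2) (ae_of_all _ (hfzb r))
    · have h1 := hQ.norm_integral_pow_sub_integral_le hQ.invariant (hfz r) (hfzb r) s (ω t).2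
      rw [hint0, sub_zero] at h1
      exact h1.trans (le_of_eq (by ring))
  have key := lpNorm_sum_sq_le_of_condExp_step (μ := μ) hp
    (piLE (X := fun _ : ℕ => EuclideanSpace ℝ (Fin d) × Z))
    (X := fun s ω => f (n - 1 - s) (ω s)) (fun j => hfLp _ j) (fun j => hfm _ j)
    (B := fun s => 7 / 4 * (Real.sqrt S.kappa * q ^ (n - 1 - s) * S.epsSup)) hm (n := n) ?_
  · refine key.trans ?_
    have h1 : ∀ s, (7 / 4 * (Real.sqrt S.kappa * q ^ (n - 1 - s) * S.epsSup)) ^ 2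
        = 49 / 16 * S.kappa * S.epsSup ^ 2 * (1 - α * S.a) ^ (n - 1 - s) := fun s => by
      rw [← hq2, mul_pow, mul_pow, mul_pow, Real.sq_sqrt (by linarith)]; ring
    simp only [h1]
    rw [← Finset.mul_sum, Finset.sum_range_reflect (fun k => (1 - α * S.a) ^ k) n]
    have h2 := sum_pow_le_inv (r := 1 - α * S.a) (by linarith) (by linarith) n
    rw [sub_sub_cancel] at h2
    calc _ ≤ 24 * p * m * (49 / 16 * S.kappa * S.epsSup ^ 2 * (α * S.a)⁻¹) := by gcongr
      _ = _ := by rw [div_eq_mul_inv]; ring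
  · intro t K ht hK
    refine (Finset.sum_le_sum fun k hk => ?_).trans (?_ : ∑ k ∈ Finset.range K,
      (if k = 0 then 1 else 2 * (13 / 50 : ℝ) ^ k)
        * (Real.sqrt S.kappa * q ^ (n - 1 - t) * S.epsSup) ≤ _)
    · have hk' := hK k (Finset.mem_range.1 hk)
      refine (hcond (n - 1 - (t + k * m)) t (k * m)).trans ?_
      rw [Nat.mul_div_cancel _ hm]
      rcases Nat.eq_zero_or_pos k with rfl | hk0
      · simp
      · have hkm : k * m ≠ 0 := by positivity
        rw [if_neg hkm, if_neg hk0.ne']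
        have h3 : n - 1 - t = n - 1 - (t + k * m) + m * k := by rw [mul_comm m k]; omega
        -- Later noise carries a larger weight, by `q^(-mk)`; mixing beats this growth, leaving the
        -- ratio `13/50` relative to the weight at `t`.
        have h4 : (1 / 4 : ℝ) ^ k ≤ (13 / 50) ^ k * q ^ (m * k) := by
          rw [pow_mul, ← mul_pow]
          exact pow_le_pow_left₀ (by norm_num) (hS.le_rate_pow hp hm) k
        rw [h3, pow_add]
        calc _ ≤ 2 * ((13 / 50) ^ k * q ^ (m * k))
              * (Real.sqrt S.kappa * q ^ (n - 1 - (t + k * m)) * S.epsSup) := by gcongr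
          _ = _ := by ring
    · rw [← Finset.sum_mul]
      have := sum_geometric_weights_le K
      gcongr

/-- A bound for the stationary moments of `J`. -/
noncomputable def stationaryBound (S : LSA d Z) (α p : ℝ) (m : ℕ) : ℝ :=
  Real.sqrt (147 / 2 * (p * m * S.kappa * α / S.a)) * S.epsSup

lemma memLp_fst_and_lpNorm_fst_le (hS : S.StepBounds α p m) (hp : 2 ≤ p)
    (hQ : UniformlyErgodic Q π m) (hN : S.NoiseAssumption π)
    (ξ : Measure (EuclideanSpace ℝ (Fin d) × Z)) [IsProbabilityMeasure ξ]
    (hξ : MemLp (fun y : EuclideanSpace ℝ (Fin d) × Z => y.1) (ENNReal.ofReal p) ξ) (t : ℕ) :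
    MemLp (fun ω : ℕ → EuclideanSpace ℝ (Fin d) × Z => (ω t).1) (ENNReal.ofReal p)
        (chainLaw (S.kernelJ Q α) ξ) ∧
      lpNorm (fun ω : ℕ → EuclideanSpace ℝ (Fin d) × Z => (ω t).1) (ENNReal.ofReal p)
          (chainLaw (S.kernelJ Q α) ξ)
        ≤ Real.sqrt S.kappa * Real.sqrt (1 - α * S.a) ^ t
            * lpNorm (fun y : EuclideanSpace ℝ (Fin d) × Z => y.1) (ENNReal.ofReal p) ξ
          + S.stationaryBound α p m := by
  set μ := chainLaw (S.kernelJ Q α) ξ with hμ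
  have hp1 : 1 ≤ ENNReal.ofReal p := ENNReal.one_le_ofReal.2 (by linarith)
  have hev : ∀ j, Measurable fun ω : ℕ → EuclideanSpace ℝ (Fin d) × Z => ω j := fun j =>
    measurable_pi_apply j
  have h0 : μ.map (fun ω => ω 0) = ξ := map_zero_chainLaw _ _
  have hJ0 : MemLp (fun ω : ℕ → EuclideanSpace ℝ (Fin d) × Z => (ω 0).1) (ENNReal.ofReal p) μ := by
    rw [← h0] at hξ
    exact hξ.comp_of_map (hev 0).aemeasurable
  have hJ0n : lpNorm (fun ω : ℕ → EuclideanSpace ℝ (Fin d) × Z => (ω 0).1) (ENNReal.ofReal p) μ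
      = lpNorm (fun y : EuclideanSpace ℝ (Fin d) × Z => y.1) (ENNReal.ofReal p) ξ :=
    lpNorm_comp_of_map_eq (hev 0) h0 hξ.1
  set N : (ℕ → EuclideanSpace ℝ (Fin d) × Z) → EuclideanSpace ℝ (Fin d) :=
    ∑ s ∈ Finset.range t, fun ω : ℕ → EuclideanSpace ℝ (Fin d) × Z =>
      (S.contraction α ^ (t - 1 - s)) (S.eps (ω s).2) with hNdef
  have hNm : ∀ s, MemLp (fun ω : ℕ → EuclideanSpace ℝ (Fin d) × Z =>
      (S.contraction α ^ (t - 1 - s)) (S.eps (ω s).2)) (ENNReal.ofReal p) μ := fun s =>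
    MemLp.of_bound ((S.contraction α ^ (t - 1 - s)).continuous.comp_stronglyMeasurable
        (S.measurable_eps.comp (measurable_snd.comp (hev s))).stronglyMeasurable).aestronglyMeasurable
      _ (ae_of_all _ fun ω => ContinuousLinearMap.le_of_opNorm_le_of_le _ le_rfl
        (S.norm_eps_le hN.bdd_eps _))
  have hNLp : MemLp N (ENNReal.ofReal p) μ := memLp_finsetSum' _ fun s _ => hNm s
  have hG : MemLp (fun ω : ℕ → EuclideanSpace ℝ (Fin d) × Z =>
      (S.contraction α ^ t) (ω 0).1) (ENNReal.ofReal p) μ :=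
    (S.contraction α ^ t).comp_memLp' hJ0
  have heq : (fun ω : ℕ → EuclideanSpace ℝ (Fin d) × Z => (ω t).1) =ᵐ[μ]
      (fun ω => (S.contraction α ^ t) (ω 0).1) - α • N := by
    filter_upwards [ae_fst_eq (Q := Q) S α ξ] with ω hω
    rw [hω t, hNdef]
    simp
  have hκ := hS.one_le_kappa
  have hα := hS.alpha_pos
  have ha := hS.a_pos
  refine ⟨(hG.sub (hNLp.const_smul α)).ae_eq heq.symm, ?_⟩
  rw [lpNorm_congr_ae heq]
  refine (lpNorm_sub_le hG hp1).trans (add_le_add ?_ ?_)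
  · rw [← hJ0n]
    exact lpNorm_clm_apply_le hJ0 (hS.norm_contraction_pow_le t)
  · have h1 := lpNorm_noise_sq_le hS hp hQ hN ξ t
    rw [lpNorm_const_smul, coe_nnnorm, Real.norm_of_nonneg hα.le, stationaryBound]
    refine le_of_sq_le_sq ?_ (mul_nonneg (Real.sqrt_nonneg _) S.epsSup_nonneg)
    rw [mul_pow, mul_pow, Real.sq_sqrt (by positivity)]
    calc _ ≤ α ^ 2 * (147 / 2 * (p * m * S.kappa / (α * S.a)) * S.epsSup ^ 2) := by gcongr
      _ = _ := by field_simp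

end LSA

/-! ### Moments of the centred sums of `ψ`. -/

namespace LSA

open Filtration

variable {d : ℕ} {Z : Type*} [MeasurableSpace Z] {S : LSA d Z} {α p : ℝ} {m : ℕ}
  {Q : Kernel Z Z} [IsMarkovKernel Q] {π : Measure Z} [IsProbabilityMeasure π]

lemma stationaryBound_nonneg (S : LSA d Z) (α p : ℝ) (m : ℕ) : 0 ≤ S.stationaryBound α p m :=
  mul_nonneg (Real.sqrt_nonneg _) S.epsSup_nonneg

/-- In stationarity the moment bound has the same left side at every time, so letting `t → ∞`
removes the initial term. -/
lemma integral_norm_fst_le (hS : S.StepBounds α p m) (hp : 2 ≤ p) (hQ : UniformlyErgodic Q π m)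
    (hN : S.NoiseAssumption π) {ν : Measure (EuclideanSpace ℝ (Fin d) × Z)}
    [IsProbabilityMeasure ν] (hν : Kernel.Invariant (S.kernelJ Q α) ν)
    (hνp : MemLp (fun y : EuclideanSpace ℝ (Fin d) × Z => y.1) (ENNReal.ofReal p) ν) :
    ∫ y, ‖y.1‖ ∂ν ≤ S.stationaryBound α p m := by
  have hp1 : 1 ≤ ENNReal.ofReal p := ENNReal.one_le_ofReal.2 (by linarith)
  refine (integral_norm_le_lpNorm hp1 hνp).trans ?_
  set L := lpNorm (fun y : EuclideanSpace ℝ (Fin d) × Z => y.1) (ENNReal.ofReal p) ν with hL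
  have hαa := hS.alpha_mul_a_le' hp hQ.tmix_pos
  have hαa0 : 0 < α * S.a := mul_pos hS.alpha_pos hS.a_pos
  have h1 : ∀ t : ℕ, L ≤ Real.sqrt S.kappa * Real.sqrt (1 - α * S.a) ^ t * L
      + S.stationaryBound α p m := fun t => by
    have h3 := (memLp_fst_and_lpNorm_fst_le hS hp hQ hN ν hνp t).2
    have h4 := map_chainLaw_of_invariant (S.kernelJ Q α) ν hν t
    have h5 : lpNorm (fun ω : ℕ → EuclideanSpace ℝ (Fin d) × Z => (ω t).1) (ENNReal.ofReal p)
        (chainLaw (S.kernelJ Q α) ν) = L :=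
      lpNorm_comp_of_map_eq (measurable_pi_apply t) h4 hνp.1
    rwa [h5] at h3
  have h2 : Filter.Tendsto (fun t : ℕ => Real.sqrt S.kappa * Real.sqrt (1 - α * S.a) ^ t * L
      + S.stationaryBound α p m) Filter.atTop
      (nhds (Real.sqrt S.kappa * 0 * L + S.stationaryBound α p m)) := by
    refine (((tendsto_pow_atTop_nhds_zero_of_lt_one (Real.sqrt_nonneg _) ?_).const_mul
      _).mul_const _).add_const _
    rw [Real.sqrt_lt' one_pos]; linarith
  rw [mul_zero, zero_mul, zero_add] at h2
  exact ge_of_tendsto' h2 h1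

lemma stronglyMeasurable_psiBar (S : LSA d Z) (ν : Measure (EuclideanSpace ℝ (Fin d) × Z)) :
    StronglyMeasurable (S.psiBar ν) := S.stronglyMeasurable_psi.sub stronglyMeasurable_const

/-- The part linear in `J` decays because `Ã` averages out, even though `G^(km)` need not be small;
the remainder contributes through its oscillation only. -/
lemma norm_integral_psi_kernelJ_pow_sub_le (hS : S.StepBounds α p m) (hp : 2 ≤ p)
    (hQ : UniformlyErgodic Q π m) (hN : S.NoiseAssumption π) (k : ℕ)
    (y y' : EuclideanSpace ℝ (Fin d) × Z) :
    ‖∫ w, S.psi w ∂(S.kernelJ Q α ^ (k * m)) y - ∫ w, S.psi w ∂(S.kernelJ Q α ^ (k * m)) y'‖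
      ≤ (if k = 0 then 1 else 2 * (13 / 50) ^ k) * S.CA * (‖y.1‖ + ‖y'.1‖)
        + 16 * α * m * S.CA * S.epsSup * (k * (13 / 50) ^ k) := by
  have hm := hQ.tmix_pos
  have hC := noiseCLM_le hS
  have hCA := hS.CA_pos
  have hα := hS.alpha_pos
  have hε := S.epsSup_nonneg
  set g := 1 + α * (2 * S.CA) with hg
  have hg1 : 1 ≤ g := by
    have : 0 < α * (2 * S.CA) := by positivity
    linarith
  have hgk : (1 / 4 : ℝ) ^ k * g ^ (k * m) ≤ (13 / 50) ^ k := by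
    rw [mul_comm k m, pow_mul, ← mul_pow]
    exact pow_le_pow_left₀ (by positivity) (hS.growth_pow_le hp) k
  have hM : ∀ y : EuclideanSpace ℝ (Fin d) × Z,
      ‖S.meanNoise Q (k * m) y.2 ((S.contraction α ^ (k * m)) y.1)‖
        ≤ (if k = 0 then 1 else 2 * (13 / 50) ^ k) * S.CA * ‖y.1‖ := fun y => by
    have h1 : ‖(S.contraction α ^ (k * m)) y.1‖ ≤ g ^ (k * m) * ‖y.1‖ :=
      ContinuousLinearMap.le_of_opNorm_le _
        (norm_contraction_pow_le_pow hS.norm_contraction_le _) _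
    rcases Nat.eq_zero_or_pos k with rfl | hk
    · rw [zero_mul] at h1 ⊢
      rw [pow_zero g, one_mul] at h1
      rw [if_pos rfl, one_mul]
      exact ContinuousLinearMap.le_of_opNorm_le_of_le _ (norm_meanNoise_le Q hC _ _) h1
    · have h2 := norm_meanNoise_le_of_uniformlyErgodic hQ hN hC (k * m) y.2
      rw [Nat.mul_div_cancel _ hm] at h2
      rw [if_neg hk.ne']
      refine (ContinuousLinearMap.le_of_opNorm_le_of_le _ h2 h1).trans ?_
      calc _ = 2 * ((1 / 4 : ℝ) ^ k * g ^ (k * m)) * S.CA * ‖y.1‖ := by ring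
        _ ≤ _ := by gcongr
  have hH := norm_psiRemainder_sub_le hQ hN hC hα.le hS.norm_contraction_le hg1 0 (k * m) y.2 y'.2
  have h0 : ∀ z, (Q ^ 0) z = Measure.dirac z := fun z => by rw [pow_zero]; exact Kernel.id_apply _
  have hsm := S.stronglyMeasurable_psiRemainder Q (α := α) (k * m)
  rw [h0, h0, integral_dirac' _ _ hsm, integral_dirac' _ _ hsm, zero_add,
    Nat.mul_div_cancel _ hm] at hH
  have hH' : ‖S.psiRemainder Q α (k * m) y.2 - S.psiRemainder Q α (k * m) y'.2‖
      ≤ 16 * α * m * S.CA * S.epsSup * (k * (13 / 50) ^ k) := by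
    refine hH.trans ?_
    push_cast
    calc _ = 16 * α * m * S.CA * S.epsSup * (k * ((1 / 4 : ℝ) ^ k * g ^ (k * m))) := by ring
      _ ≤ _ := by gcongr
  rw [integral_psi_kernelJ_pow Q hN.bdd_eps hC, integral_psi_kernelJ_pow Q hN.bdd_eps hC,
    add_sub_add_comm]
  refine (norm_add_le _ _).trans (add_le_add ?_ hH')
  refine (norm_sub_le _ _).trans ((add_le_add (hM y) (hM y')).trans (le_of_eq (by ring)))

/-- Centring by `∫ ψ dν` is averaging the comparison of two starting points over a stationary `y'`.
-/
lemma norm_integral_psiBar_kernelJ_pow_le (hS : S.StepBounds α p m) (hp : 2 ≤ p)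
    (hQ : UniformlyErgodic Q π m) (hN : S.NoiseAssumption π)
    {ν : Measure (EuclideanSpace ℝ (Fin d) × Z)} [IsProbabilityMeasure ν]
    (hν : Kernel.Invariant (S.kernelJ Q α) ν) {c : ℝ} (hc : ∀ᵐ y ∂ν, ‖y.1‖ ≤ c) (k : ℕ)
    (y : EuclideanSpace ℝ (Fin d) × Z) :
    ‖∫ w, S.psiBar ν w ∂(S.kernelJ Q α ^ (k * m)) y‖
      ≤ (if k = 0 then 1 else 2 * (13 / 50) ^ k) * S.CA * (‖y.1‖ + S.stationaryBound α p m)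
        + 16 * α * m * S.CA * S.epsSup * (k * (13 / 50) ^ k) := by
  have hC := noiseCLM_le hS
  have hCA := hS.CA_pos
  set s := k * m
  have hψν : Integrable S.psi ν := integrable_psi_of_ae_le hC hc
  have hinv := invariant_pow hν s
  have hψ2 : Integrable (fun y => ∫ w, S.psi w ∂(S.kernelJ Q α ^ s) y) ν :=
    integrable_integral_of_invariant hinv hψν
  have hfst : MemLp (fun y : EuclideanSpace ℝ (Fin d) × Z => y.1) (ENNReal.ofReal p) ν :=
    MemLp.of_bound measurable_fst.aestronglyMeasurable c hc
  have hnorm : Integrable (fun y : EuclideanSpace ℝ (Fin d) × Z => ‖y.1‖) ν :=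
    (Integrable.of_bound measurable_fst.aestronglyMeasurable c hc).norm
  have hadd : Integrable (fun y' : EuclideanSpace ℝ (Fin d) × Z => ‖y.1‖ + ‖y'.1‖) ν :=
    (integrable_const _).add hnorm
  have h1 : ∫ w, S.psiBar ν w ∂(S.kernelJ Q α ^ s) y
      = ∫ y', (∫ w, S.psi w ∂(S.kernelJ Q α ^ s) y - ∫ w, S.psi w ∂(S.kernelJ Q α ^ s) y') ∂ν := by
    rw [integral_sub (integrable_const _) hψ2, integral_invariant hinv hψν]
    have h2 : ∀ w, S.psiBar ν w = S.psi w - ∫ y', S.psi y' ∂ν := fun w => rfl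
    simp only [h2]
    rw [integral_sub (integrable_psi_kernelJ_pow Q hN.bdd_eps hC s y) (integrable_const _)]
    simp
  rw [h1]
  refine (norm_integral_le_of_norm_le (g := fun y' : EuclideanSpace ℝ (Fin d) × Z =>
    (if k = 0 then 1 else 2 * (13 / 50) ^ k) * S.CA * (‖y.1‖ + ‖y'.1‖)
        + 16 * α * m * S.CA * S.epsSup * (k * (13 / 50) ^ k)) ?_ (ae_of_all _ fun y' =>
    norm_integral_psi_kernelJ_pow_sub_le hS hp hQ hN k y y')).trans ?_
  · exact (hadd.const_mul _).add (integrable_const _)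
  · rw [integral_add (hadd.const_mul _) (integrable_const _),
      integral_const_mul, integral_add (integrable_const _) hnorm]
    simp only [integral_const, probReal_univ, one_smul]
    have := integral_norm_fst_le hS hp hQ hN hν hfst
    gcongr

/-- The moment bound in terms of the initial moment of `J`. -/
lemma lpNorm_sum_psiBar_sq_le (hS : S.StepBounds α p m) (hp : 2 ≤ p)
    (hQ : UniformlyErgodic Q π m) (hN : S.NoiseAssumption π)
    {ν : Measure (EuclideanSpace ℝ (Fin d) × Z)} [IsProbabilityMeasure ν]
    (hν : Kernel.Invariant (S.kernelJ Q α) ν) {c : ℝ} (hc : ∀ᵐ y ∂ν, ‖y.1‖ ≤ c)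
    (ξ : Measure (EuclideanSpace ℝ (Fin d) × Z)) [IsProbabilityMeasure ξ]
    (hξ : MemLp (fun y : EuclideanSpace ℝ (Fin d) × Z => y.1) (ENNReal.ofReal p) ξ) (n : ℕ) :
    (∀ t, MemLp (fun ω => S.psiBar ν (ω t)) (ENNReal.ofReal p) (chainLaw (S.kernelJ Q α) ξ)) ∧
    lpNorm (∑ t ∈ Finset.range n, fun ω : ℕ → EuclideanSpace ℝ (Fin d) × Z => S.psiBar ν (ω t))
        (ENNReal.ofReal p) (chainLaw (S.kernelJ Q α) ξ) ^ 2
      ≤ 24 * p * m * ∑ t ∈ Finset.range n,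
        (7 / 4 * S.CA * Real.sqrt S.kappa
            * lpNorm (fun y : EuclideanSpace ℝ (Fin d) × Z => y.1) (ENNReal.ofReal p) ξ
            * Real.sqrt (1 - α * S.a) ^ t
          + (7 / 2 * S.CA * S.stationaryBound α p m + 8 * α * m * S.CA * S.epsSup)) ^ 2 := by
  set μ := chainLaw (S.kernelJ Q α) ξ with hμ
  have hp1 : 1 ≤ ENNReal.ofReal p := ENNReal.one_le_ofReal.2 (by linarith)
  have hC := noiseCLM_le hS
  have hCA := hS.CA_pos
  have hα := hS.alpha_pos
  have hε := S.epsSup_nonneg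
  have hNb := S.stationaryBound_nonneg α p m
  have hsm := S.stronglyMeasurable_psiBar ν
  have hev : ∀ j, Measurable fun ω : ℕ → EuclideanSpace ℝ (Fin d) × Z => ω j := fun j =>
    measurable_pi_apply j
  have hJ := memLp_fst_and_lpNorm_fst_le hS hp hQ hN ξ hξ
  have hX : ∀ t, MemLp (fun ω => S.psiBar ν (ω t)) (ENNReal.ofReal p) μ := fun t => by
    refine MemLp.of_le (g := fun ω : ℕ → EuclideanSpace ℝ (Fin d) × Z =>
      S.CA * ‖(ω t).1‖ + ‖∫ y, S.psi y ∂ν‖)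
      (((hJ t).1.norm.const_mul _).add (memLp_const _))
      (hsm.comp_measurable (hev t)).aestronglyMeasurable (ae_of_all _ fun ω => ?_)
    refine (norm_sub_le _ _).trans (le_trans ?_ (le_abs_self _))
    gcongr
    exact ContinuousLinearMap.le_of_opNorm_le _ (hC _) _
  refine ⟨hX, ?_⟩
  have hcond : ∀ t k, lpNorm (μ[fun ω => S.psiBar ν (ω (t + k * m))|piLE t]) (ENNReal.ofReal p) μ
      ≤ (if k = 0 then 1 else 2 * (13 / 50) ^ k) * (S.CA * (lpNorm (fun ω :
          ℕ → EuclideanSpace ℝ (Fin d) × Z => (ω t).1) (ENNReal.ofReal p) μ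
          + S.stationaryBound α p m)) + 16 * α * m * S.CA * S.epsSup * (k * (13 / 50) ^ k) := by
    intro t k
    have h1 := condExp_chainLaw (S.kernelJ Q α) ξ hsm
      (fun s x => (integrable_psi_kernelJ_pow Q hN.bdd_eps hC s x).sub (integrable_const _))
      (fun t => (hX t).integrable hp1) t (k * m)
    set w : ℝ := if k = 0 then 1 else 2 * (13 / 50) ^ k with hw
    have hw0 : 0 ≤ w := by rw [hw]; split_ifs <;> positivity
    set b : ℝ := w * S.CA * S.stationaryBound α p m
      + 16 * α * m * S.CA * S.epsSup * (k * (13 / 50) ^ k) with hb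
    have hb0 : 0 ≤ b := by positivity
    have hg1 : MemLp (fun ω : ℕ → EuclideanSpace ℝ (Fin d) × Z => ‖(ω t).1‖)
      (ENNReal.ofReal p) μ := (hJ t).1.norm
    have hg2 : MemLp ((w * S.CA) • fun ω : ℕ → EuclideanSpace ℝ (Fin d) × Z => ‖(ω t).1‖)
      (ENNReal.ofReal p) μ := hg1.const_smul _
    have h2 : lpNorm (μ[fun ω => S.psiBar ν (ω (t + k * m))|piLE t]) (ENNReal.ofReal p) μ
        ≤ lpNorm (((w * S.CA) • fun ω : ℕ → EuclideanSpace ℝ (Fin d) × Z => ‖(ω t).1‖)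
          + fun _ => b) (ENNReal.ofReal p) μ := by
      refine lpNorm_mono_ae_real (hg2.add (memLp_const _)) ?_
      filter_upwards [h1] with ω hω
      rw [hω]
      refine (norm_integral_psiBar_kernelJ_pow_le hS hp hQ hN hν hc k (ω t)).trans (le_of_eq ?_)
      simp only [Pi.add_apply, Pi.smul_apply, smul_eq_mul, hb]
      ring
    refine h2.trans ((lpNorm_add_le hg2 hp1).trans ?_)
    rw [lpNorm_const_smul, lpNorm_norm (hJ t).1.1, coe_nnnorm,
      Real.norm_of_nonneg (by positivity)]
    refine (add_le_add_right (lpNorm_le_of_ae_bound hb0 (ae_of_all _ fun _ =>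
      (Real.norm_of_nonneg hb0).le)) _).trans (le_of_eq ?_)
    rw [hb]; ring
  refine (lpNorm_sum_sq_le_of_condExp_step (μ := μ) hp
    (piLE (X := fun _ : ℕ => EuclideanSpace ℝ (Fin d) × Z)) hX
    (fun j => stronglyMeasurable_piLE_eval hsm j)
    (B := fun t => 7 / 4 * S.CA * Real.sqrt S.kappa
            * lpNorm (fun y : EuclideanSpace ℝ (Fin d) × Z => y.1) (ENNReal.ofReal p) ξ
            * Real.sqrt (1 - α * S.a) ^ t
          + (7 / 2 * S.CA * S.stationaryBound α p m + 8 * α * m * S.CA * S.epsSup))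
    hQ.tmix_pos fun t K _ _ => ?_)
  refine (Finset.sum_le_sum fun k _ => hcond t k).trans ?_
  rw [Finset.sum_add_distrib, ← Finset.sum_mul, ← Finset.mul_sum]
  have h3 := sum_geometric_weights_le K
  have h4 := sum_mul_geometric_le K
  have h5 := (hJ t).2
  have h6 : 0 ≤ S.CA * (lpNorm (fun ω : ℕ → EuclideanSpace ℝ (Fin d) × Z => (ω t).1)
      (ENNReal.ofReal p) μ + S.stationaryBound α p m) :=
    mul_nonneg hCA.le (add_nonneg lpNorm_nonneg hNb)
  -- The weights sum to at most `7/4` and the terms `k (13/50)^k` to at most `1/2`. The stationary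
  -- size of `J` enters twice, once from `J_t` and once from the centring.
  calc _ ≤ 7 / 4 * (S.CA * ((Real.sqrt S.kappa * Real.sqrt (1 - α * S.a) ^ t
            * lpNorm (fun y : EuclideanSpace ℝ (Fin d) × Z => y.1) (ENNReal.ofReal p) ξ
          + S.stationaryBound α p m) + S.stationaryBound α p m))
        + 16 * α * m * S.CA * S.epsSup * (1 / 2) := by gcongr
    _ = _ := by ring

end LSA

/-! ### Comparison with the stated constants. -/

namespace LSA

variable {d : ℕ} {Z : Type*} [MeasurableSpace Z] {S : LSA d Z} {α p : ℝ} {m : ℕ}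

lemma D1_nonneg (ha : 0 < S.a) (hCA : 0 < S.CA) : 0 ≤ S.D1 := by
  rw [D1]; positivity

/-- This lower bound is all that the remainder estimate needs to know about `cW13`. -/
lemma sqrt_kappa_le_cW13 (ha : 0 < S.a) (hCA : 0 < S.CA) (hp : 2 ≤ p) {ζ DJ1 DJ2 : ℝ}
    (hζ : 1 ≤ ζ) (h1 : 0 ≤ DJ1) (h2 : 0 ≤ DJ2) : Real.sqrt S.kappa ≤ S.cW13 ζ p DJ1 DJ2 := by
  have hD := D1_nonneg ha hCA
  have hζ1 : 1 ≤ ζ ^ (1 / (2 * p)) := Real.one_le_rpow hζ (by positivity)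
  have hk := Real.sqrt_nonneg S.kappa
  have hW1 : 0 ≤ S.cW1 ζ p := by rw [cW1]; positivity
  have h12 : 0 ≤ S.cW12 ζ p DJ1 DJ2 := by rw [cW12]; positivity
  have h3 : Real.sqrt S.kappa
      ≤ 148 * (Real.sqrt S.kappa * (1 + Real.sqrt S.kappa) + (DJ1 + DJ2))
        + 8 * S.cW1 ζ p * Real.sqrt S.kappa * S.a⁻¹ := by
    have h4 : 0 ≤ 8 * S.cW1 ζ p * Real.sqrt S.kappa * S.a⁻¹ := by positivity
    nlinarith
  have h11 : Real.sqrt S.kappa ≤ S.cW11 ζ p DJ1 DJ2 := by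
    rw [cW11]
    exact h3.trans (le_mul_of_one_le_left (hk.trans h3) hζ1)
  rw [cW13]
  linarith

lemma le_leading_term (hS : S.StepBounds α p m) (hp : 2 ≤ p) (n : ℕ) :
    48 * p * m * (n * (7 / 2 * S.CA * S.stationaryBound α p m
        + 8 * α * m * S.CA * S.epsSup) ^ 2)
      ≤ (S.cW21 m * p ^ (3 / 2 : ℝ) * (α * n) ^ (1 / 2 : ℝ)) ^ 2 := by
  have ha := hS.a_pos
  have hα := hS.alpha_pos
  have hCA := hS.CA_pos
  have hκ := hS.one_le_kappa
  have hε := S.epsSup_nonneg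
  set X := p * m * S.kappa * α / S.a with hX
  have hX0 : 0 ≤ X := by positivity
  have h1 : Real.sqrt (147 / 2 * X) ≤ 43 / 5 * Real.sqrt X := by
    refine Real.sqrt_le_iff.2 ⟨by positivity, ?_⟩
    rw [mul_pow, Real.sq_sqrt hX0]
    linarith
  have h2 : α * m ≤ 1 / 13 * Real.sqrt X := by
    refine le_of_sq_le_sq ?_ (by positivity)
    rw [mul_pow (1 / 13), Real.sq_sqrt hX0, hX, mul_div_assoc', le_div_iff₀ ha]
    have h3 := hS.alpha_mul_a_mul_le hp
    have h4 : 0 ≤ α * m := by positivity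
    have h5 : α * m ≤ p * m * S.kappa * α := by
      have : 1 ≤ p * S.kappa := by nlinarith
      calc α * m ≤ (α * m) * (p * S.kappa) := le_mul_of_one_le_right h4 this
        _ = _ := by ring
    have h6 : 2 * (α * m) ≤ p * m * S.kappa * α := by
      calc 2 * (α * m) ≤ p * S.kappa * (α * m) := by gcongr; nlinarith
        _ = _ := by ring
    calc (α * m) ^ 2 * S.a = α * S.a * m * (α * m) := by ring
      _ ≤ 1 / 96 * (α * m) := by gcongr
      _ ≤ _ := by linarith
  have hU : 7 / 2 * S.CA * S.stationaryBound α p m + 8 * α * m * S.CA * S.epsSup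
      ≤ 31 * S.CA * S.epsSup * Real.sqrt X := by
    rw [stationaryBound, ← hX]
    have h7 : 7 / 2 * Real.sqrt (147 / 2 * X) + 8 * (α * m) ≤ 31 * Real.sqrt X := by
      have := Real.sqrt_nonneg X
      linarith
    have h8 : 0 ≤ S.CA * S.epsSup := by positivity
    have := mul_le_mul_of_nonneg_left h7 h8
    linarith
  have hU0 : 0 ≤ 7 / 2 * S.CA * S.stationaryBound α p m + 8 * α * m * S.CA * S.epsSup := by
    have := S.stationaryBound_nonneg α p m
    positivity
  have e1 : (p ^ (3 / 2 : ℝ)) ^ 2 = p ^ 3 := by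
    rw [← Real.rpow_natCast, ← Real.rpow_mul (by linarith), ← Real.rpow_natCast]; norm_num
  have e2 : ((α * n) ^ (1 / 2 : ℝ)) ^ 2 = α * n := by
    rw [← Real.rpow_natCast, ← Real.rpow_mul (by positivity)]; norm_num
  have e3 : (S.a ^ (-1 / 2 : ℝ)) ^ 2 = S.a⁻¹ := by
    rw [← Real.rpow_natCast, ← Real.rpow_mul ha.le, ← Real.rpow_neg_one]; norm_num
  calc _ ≤ 48 * p * m * (n * (31 * S.CA * S.epsSup * Real.sqrt X) ^ 2) := by gcongr
    _ = 46128 * p ^ 2 * (m ^ 2 * n * S.CA ^ 2 * S.epsSup ^ 2 * S.kappa * α * S.a⁻¹) := by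
        rw [mul_pow _ (Real.sqrt X), Real.sq_sqrt hX0, hX]; ring
    -- Here `46128 = 48 * 31²` and `36864 = 192²`; the spare factor `p ≥ 2` pays for the larger
    -- constant.
    _ ≤ 36864 * p ^ 3 * (m ^ 2 * n * S.CA ^ 2 * S.epsSup ^ 2 * S.kappa * α * S.a⁻¹) := by
        gcongr ?_ * _
        nlinarith [sq_nonneg p]
    _ = _ := by
        rw [mul_pow, mul_pow, e1, e2, cW21, mul_pow, mul_pow, e3, mul_pow, mul_pow, mul_pow,
          Real.sq_sqrt (by linarith)]
        ring

/-- The factor `αa` in the admissible initial moment cancels the relaxation time `1/(αa)`, so the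
true remainder is bounded as `α → 0`. The factors `α^(-1/2)` and the logarithm only need to be
bounded below. -/
lemma le_remainder_term (hS : S.StepBounds α p m) (hp : 2 ≤ p) (hm : 1 ≤ m) {ζ DJ1 DJ2 : ℝ}
    (hζ : 1 ≤ ζ) (h1 : 0 ≤ DJ1) (h2 : 0 ≤ DJ2) {j : ℝ} (hj0 : 0 ≤ j)
    (hj : j ≤ S.D1 * Real.sqrt (α * S.a * p * m) * S.epsSup) :
    0 ≤ S.cW22 m ζ p DJ1 DJ2 * p ^ 3 * α ^ (-1 / 2 : ℝ)
        * Real.sqrt (Real.log (1 / (α * S.a))) ∧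
    48 * p * m * ((7 / 4 * S.CA * Real.sqrt S.kappa * j) ^ 2 * (α * S.a)⁻¹)
      ≤ (S.cW22 m ζ p DJ1 DJ2 * p ^ 3 * α ^ (-1 / 2 : ℝ)
        * Real.sqrt (Real.log (1 / (α * S.a)))) ^ 2 := by
  have ha := hS.a_pos
  have hα := hS.alpha_pos
  have hCA := hS.CA_pos
  have hκ := hS.one_le_kappa
  have hε := S.epsSup_nonneg
  have hD := D1_nonneg ha hCA
  have hm1 : (1 : ℝ) ≤ m := by exact_mod_cast hm
  have hαa : 0 < α * S.a := mul_pos hα ha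
  have hαa1 := hS.alpha_mul_a_le' hp hm
  have hc := sqrt_kappa_le_cW13 ha hCA hp hζ h1 h2
  have hsκ : 0 ≤ Real.sqrt S.kappa := Real.sqrt_nonneg _
  -- The logarithm is at least 1 because `αa ≤ 1/96 < 1/e`.
  have hlog : 1 ≤ Real.sqrt (Real.log (1 / (α * S.a))) := by
    rw [Real.one_le_sqrt, Real.le_log_iff_exp_le (by positivity), le_div_iff₀ hαa]
    have := Real.exp_one_lt_d9
    nlinarith
  have hαa2 : 1 ≤ S.a ^ (-1 / 2 : ℝ) * α ^ (-1 / 2 : ℝ) := by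
    rw [← Real.mul_rpow ha.le hα.le, mul_comm]
    exact Real.one_le_rpow_of_pos_of_le_one_of_nonpos hαa (by linarith) (by norm_num)
  have hm32 : (m : ℝ) ≤ (m : ℝ) ^ (3 / 2 : ℝ) := by
    conv_lhs => rw [← Real.rpow_one (m : ℝ)]
    exact Real.rpow_le_rpow_of_exponent_le hm1 (by norm_num)
  have hp3 : p ≤ p ^ 3 := by nlinarith [sq_nonneg p]
  have hR : 13 * S.CA * S.D1 * Real.sqrt S.kappa * m * S.epsSup * p
      ≤ S.cW22 m ζ p DJ1 DJ2 * p ^ 3 * α ^ (-1 / 2 : ℝ)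
        * Real.sqrt (Real.log (1 / (α * S.a))) := by
    have h0 : 0 ≤ S.cW13 ζ p DJ1 DJ2 := hsκ.trans hc
    calc _ ≤ 432 * S.CA * S.D1 * S.cW13 ζ p DJ1 DJ2 * (m : ℝ) ^ (3 / 2 : ℝ) * S.epsSup * p ^ 3 := by
          gcongr; norm_num
      _ = 432 * S.CA * S.D1 * S.cW13 ζ p DJ1 DJ2 * (m : ℝ) ^ (3 / 2 : ℝ) * S.epsSup * p ^ 3
          * (1 * 1) := by ring
      _ ≤ 432 * S.CA * S.D1 * S.cW13 ζ p DJ1 DJ2 * (m : ℝ) ^ (3 / 2 : ℝ) * S.epsSup * p ^ 3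
          * ((S.a ^ (-1 / 2 : ℝ) * α ^ (-1 / 2 : ℝ))
            * Real.sqrt (Real.log (1 / (α * S.a)))) := by gcongr
      _ = _ := by rw [cW22]; ring
  have hL : 0 ≤ 13 * S.CA * S.D1 * Real.sqrt S.kappa * m * S.epsSup * p := by positivity
  refine ⟨hL.trans hR, ?_⟩
  have hj2 : j ^ 2 ≤ S.D1 ^ 2 * (α * S.a * p * m) * S.epsSup ^ 2 := by
    calc j ^ 2 ≤ (S.D1 * Real.sqrt (α * S.a * p * m) * S.epsSup) ^ 2 := by gcongr
      _ = _ := by rw [mul_pow, mul_pow, Real.sq_sqrt (by positivity)]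
  refine le_trans ?_ (pow_le_pow_left₀ hL hR 2)
  calc _ = 147 * p * m * S.CA ^ 2 * Real.sqrt S.kappa ^ 2 * (α * S.a)⁻¹ * j ^ 2 := by ring
    _ ≤ 147 * p * m * S.CA ^ 2 * Real.sqrt S.kappa ^ 2 * (α * S.a)⁻¹
        * (S.D1 ^ 2 * (α * S.a * p * m) * S.epsSup ^ 2) := by gcongr
    _ = 147 * (S.CA * S.D1 * Real.sqrt S.kappa * m * S.epsSup * p) ^ 2 := by
        field_simp
    _ ≤ 169 * (S.CA * S.D1 * Real.sqrt S.kappa * m * S.epsSup * p) ^ 2 := by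
        gcongr; norm_num
    _ = _ := by ring

lemma le_of_sum_sq_bound (hS : S.StepBounds α p m) (hp : 2 ≤ p) (hm : 1 ≤ m) {ζ DJ1 DJ2 : ℝ}
    (hζ : 1 ≤ ζ) (h1 : 0 ≤ DJ1) (h2 : 0 ≤ DJ2) {j : ℝ} (hj0 : 0 ≤ j)
    (hj : j ≤ S.D1 * Real.sqrt (α * S.a * p * m) * S.epsSup) {n : ℕ} {L : ℝ}
    (hL : L ^ 2 ≤ 24 * p * m * ∑ t ∈ Finset.range n,
        (7 / 4 * S.CA * Real.sqrt S.kappa * j * Real.sqrt (1 - α * S.a) ^ t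
          + (7 / 2 * S.CA * S.stationaryBound α p m + 8 * α * m * S.CA * S.epsSup)) ^ 2) :
    L ≤ S.cW21 m * p ^ (3 / 2 : ℝ) * (α * n) ^ (1 / 2 : ℝ)
        + S.cW22 m ζ p DJ1 DJ2 * p ^ 3 * α ^ (-1 / 2 : ℝ)
          * Real.sqrt (Real.log (1 / (α * S.a))) := by
  have ha := hS.a_pos
  have hα := hS.alpha_pos
  have hCA := hS.CA_pos
  have hε := S.epsSup_nonneg
  have hαa : 0 < α * S.a := mul_pos hα ha
  have hαa1 := hS.alpha_mul_a_le' hp hm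
  have hR1 := le_leading_term hS hp n
  obtain ⟨hR0, hR2⟩ := le_remainder_term hS hp hm hζ h1 h2 hj0 hj
  set R2 := S.cW22 m ζ p DJ1 DJ2 * p ^ 3 * α ^ (-1 / 2 : ℝ)
    * Real.sqrt (Real.log (1 / (α * S.a)))
  have hR10 : 0 ≤ S.cW21 m * p ^ (3 / 2 : ℝ) * (α * n) ^ (1 / 2 : ℝ) := by
    rw [cW21]; positivity
  set R1 := S.cW21 m * p ^ (3 / 2 : ℝ) * (α * n) ^ (1 / 2 : ℝ)
  set U := 7 / 2 * S.CA * S.stationaryBound α p m + 8 * α * m * S.CA * S.epsSup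
  set V := 7 / 4 * S.CA * Real.sqrt S.kappa * j
  have hsum : ∑ t ∈ Finset.range n, (V * Real.sqrt (1 - α * S.a) ^ t + U) ^ 2
      ≤ 2 * (V ^ 2 * (α * S.a)⁻¹) + 2 * (n * U ^ 2) := by
    have h3 : ∀ t ∈ Finset.range n, (V * Real.sqrt (1 - α * S.a) ^ t + U) ^ 2
        ≤ 2 * V ^ 2 * (1 - α * S.a) ^ t + 2 * U ^ 2 := fun t _ => by
      have h4 : (Real.sqrt (1 - α * S.a) ^ t) ^ 2 = (1 - α * S.a) ^ t := by
        rw [← pow_mul, mul_comm t 2, pow_mul, Real.sq_sqrt (by linarith)]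
      refine add_sq_le.trans (le_of_eq ?_)
      rw [mul_pow, h4]; ring
    refine (Finset.sum_le_sum h3).trans ?_
    rw [Finset.sum_add_distrib, ← Finset.mul_sum]
    have h5 := sum_pow_le_inv (r := 1 - α * S.a) (by linarith) (by linarith) n
    rw [sub_sub_cancel] at h5
    simp only [Finset.sum_const, Finset.card_range, nsmul_eq_mul]
    calc _ ≤ 2 * V ^ 2 * (α * S.a)⁻¹ + n * (2 * U ^ 2) := by gcongr
      _ = _ := by ring
  refine le_of_sq_le_sq ?_ (by positivity)
  calc L ^ 2 ≤ 24 * p * m * (2 * (V ^ 2 * (α * S.a)⁻¹) + 2 * (n * U ^ 2)) := hL.trans (by gcongr)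
    _ = 48 * p * m * (n * U ^ 2) + 48 * p * m * (V ^ 2 * (α * S.a)⁻¹) := by ring
    _ ≤ R1 ^ 2 + R2 ^ 2 := add_le_add hR1 hR2
    _ ≤ _ := by nlinarith

end LSA

end MarkovLSA

theorem mainTheorem7 {d : ℕ} (hd : 1 ≤ d)
    {Z : Type*} [TopologicalSpace Z] [PolishSpace Z] [MeasurableSpace Z] [BorelSpace Z]
    (Q : Kernel Z Z) [IsMarkovKernel Q] (π : Measure Z) [IsProbabilityMeasure π] (tmix : ℕ)
    (hQ : MarkovLSA.UniformlyErgodic Q π tmix)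
    (S : MarkovLSA.LSA d Z) (hA : S.StabilityAssumption) (hN : S.NoiseAssumption π)
    (ζ ρ : ℝ) (hζ : 1 ≤ ζ) (hρ : ρ ∈ Set.Ioo (0 : ℝ) 1)
    (hζρ : ∀ k : ℕ, 1 ≤ k → ∀ z : Z,
      MarkovLSA.tvNorm ((Q ^ k) z) π ≤ ENNReal.ofReal (ζ * ρ ^ k))
    (DJ1 DJ2 : ℝ) (hDJ1 : 0 ≤ DJ1) (hDJ2 : 0 ≤ DJ2)
    (p : ℝ) (hp : 2 ≤ p) (α : ℝ) (hα : α ∈ Set.Ioo (0 : ℝ) (S.alphaB tmix p)) :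
    ∃ ν : Measure (EuclideanSpace ℝ (Fin d) × Z),
      (IsProbabilityMeasure ν ∧ Kernel.Invariant (S.kernelJ Q α) ν) ∧
      (∀ ν' : Measure (EuclideanSpace ℝ (Fin d) × Z),
        IsProbabilityMeasure ν' → Kernel.Invariant (S.kernelJ Q α) ν' → ν' = ν) ∧
      Integrable S.psi ν ∧
      ∀ ξ : Measure (EuclideanSpace ℝ (Fin d) × Z), IsProbabilityMeasure ξ →
        eLpNorm (fun y : EuclideanSpace ℝ (Fin d) × Z => y.1) (ENNReal.ofReal p) ξ
          ≤ ENNReal.ofReal (S.D1 * Real.sqrt (α * S.a * p * tmix) * S.epsSup) →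
        ∀ n : ℕ,
          eLpNorm (fun ω : ℕ → EuclideanSpace ℝ (Fin d) × Z =>
              ∑ t ∈ Finset.range n, S.psiBar ν (ω t))
            (ENNReal.ofReal p) (MarkovLSA.chainLaw (S.kernelJ Q α) ξ)
          ≤ ENNReal.ofReal
              (S.cW21 tmix * p ^ (3 / 2 : ℝ) * (α * n) ^ (1 / 2 : ℝ)
                + S.cW22 tmix ζ p DJ1 DJ2 * p ^ 3 * α ^ (-1 / 2 : ℝ)
                  * Real.sqrt (Real.log (1 / (α * S.a)))) := by
  have hZ : Nonempty Z := by
    by_contra h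
    rw [not_nonempty_iff] at h
    have h1 : π Set.univ = 1 := measure_univ
    rw [Set.univ_eq_empty_iff.2 h, measure_empty] at h1
    exact zero_ne_one h1
  have hm := hQ.tmix_pos
  have hS := S.stepBounds hd hA hp hm hα
  have hαa : 0 < α * S.a := mul_pos hS.alpha_pos hS.a_pos
  have hq : Real.sqrt (1 - α * S.a) < 1 := by
    rw [Real.sqrt_lt' one_pos]; linarith
  have hG : Summable fun k => ‖S.contraction α ^ k‖ :=
    Summable.of_nonneg_of_le (fun _ => norm_nonneg _) hS.norm_contraction_pow_le
      ((summable_geometric_of_lt_one (Real.sqrt_nonneg _) hq).mul_left _)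
  obtain ⟨ν, hν1, hν2, c, hc⟩ := S.exists_invariant_kernelJ hG hN.bdd_eps hQ.invariant
  refine ⟨ν, ⟨hν1, hν2⟩, fun ν' h1 h2 => ?_,
    MarkovLSA.LSA.integrable_psi_of_ae_le (MarkovLSA.LSA.noiseCLM_le hS) hc, fun ξ hξ hξp n => ?_⟩
  · exact S.eq_of_invariant_kernelJ hQ hG.tendsto_atTop_zero h2 hν2
  · have hξm : MemLp (fun y : EuclideanSpace ℝ (Fin d) × Z => y.1) (ENNReal.ofReal p) ξ :=
      ⟨measurable_fst.aestronglyMeasurable, hξp.trans_lt ENNReal.ofReal_lt_top⟩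
    obtain ⟨hX, hL⟩ := MarkovLSA.LSA.lpNorm_sum_psiBar_sq_le hS hp hQ hN hν2 hc ξ hξm n
    have hj : lpNorm (fun y : EuclideanSpace ℝ (Fin d) × Z => y.1) (ENNReal.ofReal p) ξ
        ≤ S.D1 * Real.sqrt (α * S.a * p * tmix) * S.epsSup := by
      have hD := MarkovLSA.LSA.D1_nonneg hS.a_pos hS.CA_pos
      rw [← toReal_eLpNorm hξm.1]
      exact ENNReal.toReal_le_of_le_ofReal
        (mul_nonneg (mul_nonneg hD (Real.sqrt_nonneg _)) S.epsSup_nonneg) hξp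
    have hfin := MarkovLSA.LSA.le_of_sum_sq_bound hS hp hm hζ hDJ1 hDJ2 lpNorm_nonneg hj hL
    have hsum : (fun ω : ℕ → EuclideanSpace ℝ (Fin d) × Z =>
        ∑ t ∈ Finset.range n, S.psiBar ν (ω t))
        = ∑ t ∈ Finset.range n, fun ω => S.psiBar ν (ω t) := by
      ext1 ω; rw [Finset.sum_apply]
    have hmem : MemLp (∑ t ∈ Finset.range n, fun ω : ℕ → EuclideanSpace ℝ (Fin d) × Z =>
        S.psiBar ν (ω t)) (ENNReal.ofReal p) (MarkovLSA.chainLaw (S.kernelJ Q α) ξ) :=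
      memLp_finsetSum' _ fun t _ => hX t
    rw [hsum, ← ofReal_lpNorm hmem]
    exact ENNReal.ofReal_le_ofReal hfin
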